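/- Let $B^3\subset\mathbb R^3$ be the closed unit ball, and identify $su(2)$ with the imaginary quaternions $\mathrm{Im}\,\mathbb H$, with the Euclidean norm and the bracket $[a,b]=ab-ba$; write $\vec\sigma=(i,j,k)$ and $r=|\vec x|$. For a connection $A=\sum_i A_i\,dx_i$ and a Higgs field $\phi$ with values in $\mathrm{Im}\,\mathbb H$ put $F=dA+A\wedge A$ and $D_A\phi=d\phi+[A,\phi]$, let $D_A$ also denote the covariant exterior derivative of $\mathrm{Im}\,\mathbb H$-valued forms, and let $*$ be the Hodge star of $\mathbb R^3$. For $\epsilon>0$ and $\lambda\ge 0$ let $$\mathcal S(\gamma,\varphi)=4\pi\int_0^1\Big[2\epsilon\Big(\gamma'^2+\frac{2}{r^2}(\gamma^2+\gamma)^2\Big)+r^2\varphi'^2+2\varphi^2(1+2\gamma)^2+\frac{\lambda}{4}r^2(\varphi^2-1)^2\Big]dr\in[0,\infty]$$ on the class $\mathcal F$ of pairs $(\gamma,\varphi)$ with $\gamma\in H^1(0,1)$, $\varphi\in H^1((0,1),r^2dr)$ (taken with their representatives continuous on $[0,1]$ and on $(0,1]$, respectively), $\gamma(0)=0$, $\gamma(1)=-\frac12$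 and $\varphi(1)=1$. **Theorem.** For every $\epsilon>0$ and $\lambda\ge 0$ there exist a minimizer $(\gamma,\varphi)$ of $\mathcal S$ over $\mathcal F$ and a pair $(A,\phi)$ on $B^3$ with values in $\mathrm{Im}\,\mathbb H$, smooth up to the boundary, such that $$A=\frac{\gamma(r)}{r^2}\,\vec\sigma\cdot(\vec x\times d\vec x),\qquad \phi=\frac{\varphi(r)}{r}\,\vec\sigma\cdot\vec x\qquad(\vec x\ne 0),$$ $(A,\phi)$ is invariant under the action of $SO(3)$ that simultaneously rotates $B^3$ and $\mathrm{Im}\,\mathbb H\cong\mathbb R^3$, and $(A,\phi)$ is a classical solution of the Yang–Mills–Higgs boundary value problem $$\begin{cases}\epsilon\,{*D_A{*F}}=[D_A\phi,\phi] & \text{in the interior of } B^3,\\ {*D_A{*D_A\phi}}=\frac{\lambda}{2}(|\phi|^2-1)\phi & \text{in the interior of } B^3,\\ (D_A\phi)_\tau=0 & \text{on }\partial B^3,\\ |\phi|=1 & \text{on }\partial B^3,\end{cases}$$ where $(\cdot)_\tau$ denotes the component tangential to $\partial B^3$. -/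

import Mathlib

open MeasureTheory Set Metric
open scoped Quaternion ContDiff

noncomputable section

namespace YMH

/-- Euclidean three-space. -/
abbrev E3 : Type := EuclideanSpace ℝ (Fin 3)

/-- The closed unit ball of `ℝ³`. -/
abbrev B3 : Set E3 := closedBall (0 : E3) 1

/-- The coordinate vectors of `ℝ³`. -/
def e (i : Fin 3) : E3 := EuclideanSpace.single i 1

/-- The Lie-algebra element `σ · v = v₁ i + v₂ j + v₃ k`; this identifies `ℝ³` with the imaginary
quaternions, that is, with `su(2)`. -/
def sig (v : E3) : ℍ[ℝ] := ⟨0, v 0, v 1, v 2⟩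

/-- The coordinate vector of the imaginary part of a quaternion (inverse of `sig`). -/
def vec (q : ℍ[ℝ]) : E3 := !₂[q.imI, q.imJ, q.imK]

/-- The cross product on `ℝ³`. -/
def cross (x y : E3) : E3 :=
  !₂[x 1 * y 2 - x 2 * y 1, x 2 * y 0 - x 0 * y 2, x 0 * y 1 - x 1 * y 0]

/-! ### Forms on the ball with values in the quaternions, in the standard coordinates

A one-form `w = ∑ wᵢ dxᵢ` is the family of its coefficients; a two-form
`η = ∑_{i<j} ηᵢⱼ dxᵢ ∧ dxⱼ` is the antisymmetric family of its coefficients; a three-form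
`τ dx₁ ∧ dx₂ ∧ dx₃` is the function `τ`. Indices in `Fin 3` are cyclic, so that
`(i, i + 1, i + 2)` is always a positively oriented triple. -/

/-- Zero-forms. -/
abbrev Form0 : Type := E3 → ℍ[ℝ]
/-- One-forms. -/
abbrev Form1 : Type := Fin 3 → E3 → ℍ[ℝ]
/-- Two-forms. -/
abbrev Form2 : Type := Fin 3 → Fin 3 → E3 → ℍ[ℝ]
/-- Three-forms. -/
abbrev Form3 : Type := E3 → ℍ[ℝ]

/-- Partial derivative on the closed ball: the ordinary one at interior points, the one taken from
within the ball at boundary points. -/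
def pd (i : Fin 3) (f : E3 → ℍ[ℝ]) (x : E3) : ℍ[ℝ] := fderivWithin ℝ f B3 x (e i)

/-- The curvature `F = dA + A ∧ A`. -/
def curvature (A : Form1) : Form2 := fun i j x =>
  pd i (A j) x - pd j (A i) x + ⁅A i x, A j x⁆

/-- `D_A φ = dφ + [A, φ]`, a one-form. -/
def D0 (A : Form1) (φ : Form0) : Form1 := fun i x =>
  pd i φ x + ⁅A i x, φ x⁆

/-- `D_A w` for a one-form `w`, a two-form. -/
def D1 (A : Form1) (w : Form1) : Form2 := fun i j x =>
  (pd i (w j) x + ⁅A i x, w j x⁆) - (pd j (w i) x + ⁅A j x, w i x⁆)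

/-- `D_A η` for a two-form `η`, a three-form. -/
def D2 (A : Form1) (η : Form2) : Form3 := fun x =>
  ∑ i, (pd i (η (i + 1) (i + 2)) x + ⁅A i x, η (i + 1) (i + 2) x⁆)

/-- Hodge star on one-forms: `*dx₁ = dx₂ ∧ dx₃` and cyclically. -/
def star1 (w : Form1) : Form2 := fun i j x =>
  if j = i + 1 then w (i + 2) x else if i = j + 1 then -w (j + 2) x else 0

/-- Hodge star on two-forms: `*(dx₂ ∧ dx₃) = dx₁` and cyclically. -/
def star2 (η : Form2) : Form1 := fun i x => η (i + 1) (i + 2) x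

/-- Hodge star on three-forms: `*(dx₁ ∧ dx₂ ∧ dx₃) = 1`. -/
def star3 (τ : Form3) : Form0 := τ

/-- `A` is a smooth `su(2)`-connection on the closed ball and `Φ` a smooth Higgs field
(smooth up to the boundary, with values in the imaginary quaternions). -/
structure IsSmoothPair (A : Form1) (Φ : Form0) : Prop where
  smooth_A : ∀ i, ContDiffOn ℝ ∞ (A i) B3
  smooth_Φ : ContDiffOn ℝ ∞ Φ B3
  im_A : ∀ i, ∀ x ∈ B3, (A i x).re = 0
  im_Φ : ∀ x ∈ B3, (Φ x).re = 0

/-- The matrix `R` acting on `ℝ³`. -/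
def rot (R : Matrix (Fin 3) (Fin 3) ℝ) (x : E3) : E3 :=
  WithLp.toLp 2 (R.mulVec x.ofLp)

/-- Invariance under the group `SO(3)` which rotates simultaneously the ball and the Lie algebra:
`Φ(Rx) = R Φ(x)`, and `A_{Rx}(R v) = R (A_x(v))` for the coordinate vectors `v`. -/
def IsSymmetric (A : Form1) (Φ : Form0) : Prop :=
  ∀ R ∈ Matrix.specialOrthogonalGroup (Fin 3) ℝ, ∀ x ∈ B3,
    Φ (rot R x) = sig (rot R (vec (Φ x))) ∧
    ∀ j, ∑ i, R i j • A i (rot R x) = sig (rot R (vec (A j x)))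

/-- The Yang-Mills-Higgs Euler-Lagrange system on the unit ball with its boundary conditions. -/
structure IsSolution (ε lam : ℝ) (A : Form1) (Φ : Form0) : Prop where
  /-- `ε * D_A * F = [D_A Φ, Φ]` -/
  eq_A : ∀ x ∈ ball (0 : E3) 1, ∀ i,
    ε • star2 (D1 A (star2 (curvature A))) i x = ⁅D0 A Φ i x, Φ x⁆
  /-- `* D_A * D_A Φ = (λ/2) (|Φ|² - 1) Φ` -/
  eq_Φ : ∀ x ∈ ball (0 : E3) 1,
    star3 (D2 A (star1 (D0 A Φ))) x = (lam / 2 * (‖Φ x‖ ^ 2 - 1)) • Φ x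
  /-- the tangential part of `D_A Φ` vanishes on the boundary sphere -/
  tangential : ∀ x ∈ sphere (0 : E3) 1, ∀ v : E3, inner ℝ x v = 0 →
    ∑ i, v i • D0 A Φ i x = 0
  /-- `|Φ| = 1` on the boundary sphere -/
  norm_Φ : ∀ x ∈ sphere (0 : E3) 1, ‖Φ x‖ = 1

/-- `(A, Φ)` is the spherically symmetric pair with radial profiles `γ` and `φ`:
`A = (γ(r)/r²) σ · (x × dx)` and `Φ = (φ(r)/r) σ · x` away from the origin. -/
def HasProfile (γ φ : ℝ → ℝ) (A : Form1) (Φ : Form0) : Prop :=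
  ∀ x ∈ B3, x ≠ 0 →
    (∀ i, A i x = (γ ‖x‖ / ‖x‖ ^ 2) • sig (cross x (e i))) ∧
    Φ x = (φ ‖x‖ / ‖x‖) • sig x

/-! ### The reduced variational problem on `(0,1)` -/

/-- `g` is the weak derivative of `f` on the interval `(0,1)`. -/
def HasWeakDeriv (f g : ℝ → ℝ) : Prop :=
  LocallyIntegrableOn f (Ioo 0 1) ∧ LocallyIntegrableOn g (Ioo 0 1) ∧
  ∀ η : ℝ → ℝ, ContDiff ℝ ∞ η → HasCompactSupport η → tsupport η ⊆ Ioo 0 1 →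
    ∫ r in Ioo (0 : ℝ) 1, f r * deriv η r = -∫ r in Ioo (0 : ℝ) 1, g r * η r

/-- The measure `dr` on `(0,1)`. -/
def dr : Measure ℝ := volume.restrict (Ioo 0 1)

/-- The measure `r² dr` on `(0,1)`. -/
def rsqdr : Measure ℝ := dr.withDensity fun r => ENNReal.ofReal (r ^ 2)

/-- The admissible class: `γ ∈ H¹(0,1)` with weak derivative `γ'` and `φ ∈ H¹((0,1), r² dr)` with
weak derivative `φ'`, both represented by their continuous representatives, with `γ(0) = 0`,
`γ(1) = -1/2` and `φ(1) = 1`. -/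
structure Admissible (γ γ' φ φ' : ℝ → ℝ) : Prop where
  weak_γ : HasWeakDeriv γ γ'
  memLp_γ : MemLp γ 2 dr
  memLp_γ' : MemLp γ' 2 dr
  cont_γ : ContinuousOn γ (Icc 0 1)
  weak_φ : HasWeakDeriv φ φ'
  memLp_φ : MemLp φ 2 rsqdr
  memLp_φ' : MemLp φ' 2 rsqdr
  cont_φ : ContinuousOn φ (Ioc 0 1)
  γ_zero : γ 0 = 0
  γ_one : γ 1 = -(1 / 2)
  φ_one : φ 1 = 1

/-- The reduced functional, with values in `[0, ∞]`. It is twice the Yang-Mills-Higgs action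
`(ε/2) ‖F‖² + (1/2) ‖D_A Φ‖² + (λ/8) ‖|Φ|² - 1‖²` of the symmetric pair with profiles
`γ` and `φ`. -/
def S (ε lam : ℝ) (γ γ' φ φ' : ℝ → ℝ) : ENNReal :=
  ∫⁻ r in Ioo (0 : ℝ) 1, ENNReal.ofReal (4 * Real.pi *
    (2 * ε * (γ' r ^ 2 + 2 / r ^ 2 * (γ r ^ 2 + γ r) ^ 2) + r ^ 2 * φ' r ^ 2
      + 2 * φ r ^ 2 * (1 + 2 * γ r) ^ 2 + lam / 4 * r ^ 2 * (φ r ^ 2 - 1) ^ 2))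

/-- `(γ, φ)` minimizes the reduced functional over the admissible class. -/
def IsMinimizer (ε lam : ℝ) (γ φ : ℝ → ℝ) : Prop :=
  ∃ γ' φ' : ℝ → ℝ, Admissible γ γ' φ φ' ∧
    ∀ c c' p p' : ℝ → ℝ, Admissible c c' p p' → S ε lam γ γ' φ φ' ≤ S ε lam c c' p p'

end YMH

end

/-! The reduced action is minimised in terms of the velocities `g = γ'` and `k = r φ'`. They range
over all of `L²(0,1)` subject only to `∫ g = -1/2` (`Velocity`), and by `Admissible.eq_gam` and
`Admissible.eq_hig` they parametrise the whole admissible class. In these variables the action is a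
combination of squared `L²` norms plus a nonnegative term without derivatives (`S_gam_hig`). Weak
convergence of velocities forces pointwise convergence of profiles, so weak lower semicontinuity of
the norms together with Fatou gives a minimizer (`exists_minimizer`).

Variations supported away from `0` give the Euler-Lagrange equations on `(0,1)`. The difficulty is
the origin. With `f = γ/r²` and `h = φ/r` the singular linear terms cancel, and both functions solve
`(r⁴ u')' = r⁴ · (polynomial in r², f, h)`, a radial Poisson equation in dimension five. Square
integrability of the velocities alone gives `f, h = O(r^(-3/2))`. This excludes the fundamental
solution `r⁻³` (`singular_flux_eq`), and `3/2` lies below the fixed point `2` of the bootstrap `a ↦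
2a - 2`, so a few iterations make `f` and `h` bounded (`RadialSystem.bounded`).

As functions `F, H` of `s = r²` they then satisfy `F' = ½ ∫₀¹ t⁴ p(s t²) dt`, with `p` the
right-hand side, and likewise for `H`. Averaging preserves `C^n` and integration gains one
derivative, so induction gives smoothness on the closed interval (`IntegralSystem.contDiffOn`).

Finally `F(|x|²) σ·(x × dx)` and `H(|x|²) σ·x` are smooth because `|x|²` is, and an explicit
computation turns the boundary value problem into the profile equations (`isSolution_radial`); no
principle of symmetric criticality is invoked. The tangential condition holds because `1 + 2γ(1) =
0`. -/

noncomputable section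

namespace YMH

/-! ### Calculus of rotationally symmetric forms on the ball -/

lemma norm_sq_eq (x : E3) : ‖x‖ ^ 2 = x 0 ^ 2 + x 1 ^ 2 + x 2 ^ 2 := by
  rw [EuclideanSpace.norm_sq_eq, Fin.sum_univ_three]; simp

@[simp] lemma sig_re (v : E3) : (sig v).re = 0 := rfl
@[simp] lemma sig_imI (v : E3) : (sig v).imI = v 0 := rfl
@[simp] lemma sig_imJ (v : E3) : (sig v).imJ = v 1 := rfl
@[simp] lemma sig_imK (v : E3) : (sig v).imK = v 2 := rfl

/-- `sig` as a continuous linear map. -/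
def sigL : E3 →L[ℝ] ℍ[ℝ] :=
  LinearMap.toContinuousLinearMap
    { toFun := sig
      map_add' := fun x y => by ext <;> simp
      map_smul' := fun c x => by ext <;> simp }

@[simp] lemma sigL_apply (x : E3) : sigL x = sig x := rfl

/-- The linear map `x ↦ x × v`. -/
def crossL (v : E3) : E3 →L[ℝ] E3 :=
  LinearMap.toContinuousLinearMap
    { toFun := fun x => cross x v
      map_add' := fun x y => by ext i; fin_cases i <;> simp [cross] <;> ring
      map_smul' := fun c x => by ext i; fin_cases i <;> simp [cross] <;> ring }

@[simp] lemma crossL_apply (v x : E3) : crossL v x = cross x v := rfl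

lemma normSq_mem_Icc {x : E3} (hx : x ∈ B3) : ‖x‖ ^ 2 ∈ Icc (0 : ℝ) 1 := by
  rw [mem_closedBall_zero_iff] at hx
  exact ⟨by positivity, by nlinarith [norm_nonneg x]⟩

lemma uniqueDiffOn_B3 : UniqueDiffOn ℝ B3 :=
  uniqueDiffOn_convex (convex_closedBall _ _)
    (by rw [interior_closedBall _ one_ne_zero]; exact ⟨0, by simp⟩)

lemma hasFDerivAt_normSq (x : E3) :
    HasFDerivAt (fun y : E3 => ‖y‖ ^ 2) (2 • (innerSL ℝ x)) x :=
  (hasStrictFDerivAt_norm_sq x).hasFDerivAt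

/-- The partial derivatives of a radial function times a linear one. -/
lemma hasFDerivWithinAt_radial {G : ℝ → ℝ} {G' : ℝ} {x : E3}
    (hG : HasDerivWithinAt G G' (Icc 0 1) (‖x‖ ^ 2)) :
    HasFDerivWithinAt (fun y : E3 => G (‖y‖ ^ 2)) (G' • (2 • (innerSL ℝ x))) B3 x :=
  hG.comp_hasFDerivWithinAt x (hasFDerivAt_normSq x).hasFDerivWithinAt
    (fun _ hy => normSq_mem_Icc hy)

lemma inner_e (x : E3) (i : Fin 3) : inner ℝ x (e i) = x i := by
  simp [e, EuclideanSpace.inner_single_right]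

lemma pd_of_hasFDerivWithinAt {f : E3 → ℍ[ℝ]} {f' : E3 →L[ℝ] ℍ[ℝ]} {x : E3} (hx : x ∈ B3)
    (hf : HasFDerivWithinAt f f' B3 x) (i : Fin 3) : pd i f x = f' (e i) := by
  rw [pd, hf.fderivWithin (uniqueDiffOn_B3 x hx)]

lemma pd_radial_linear {G : ℝ → ℝ} {G' : ℝ} {x : E3} (hx : x ∈ B3)
    (hG : HasDerivWithinAt G G' (Icc 0 1) (‖x‖ ^ 2)) (T : E3 →L[ℝ] ℍ[ℝ]) (i : Fin 3) :
    pd i (fun y => G (‖y‖ ^ 2) • T y) x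
      = (2 * x i * G') • T x + G (‖x‖ ^ 2) • T (e i) := by
  refine (pd_of_hasFDerivWithinAt hx
    ((hasFDerivWithinAt_radial hG).smul T.hasFDerivWithinAt) i).trans ?_
  simp [inner_e, add_comm, two_smul]
  congr 1
  ring

/-- The form `a(|x|²) σ·eᵢ + b(|x|²) xᵢ σ·x`, the common shape of `*F` and `D_A Φ` for a symmetric
pair. -/
def radialForm (a b : ℝ → ℝ) : Form1 := fun i x =>
  a (‖x‖ ^ 2) • sig (e i) + (b (‖x‖ ^ 2) * x i) • sig x

/-- The connection `F(|x|²) σ·(x × dx)`. -/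
def radialConn (F : ℝ → ℝ) : Form1 := fun i x => F (‖x‖ ^ 2) • sig (cross x (e i))

/-- The Higgs field `H(|x|²) σ·x`. -/
def radialHiggs (H : ℝ → ℝ) : Form0 := fun x => H (‖x‖ ^ 2) • sig x

lemma pd_radialForm {a b : ℝ → ℝ} {a' b' : ℝ} {x : E3} (hx : x ∈ B3)
    (ha : HasDerivWithinAt a a' (Icc 0 1) (‖x‖ ^ 2))
    (hb : HasDerivWithinAt b b' (Icc 0 1) (‖x‖ ^ 2)) (i j : Fin 3) :
    pd i (radialForm a b j) x = (2 * x i * a') • sig (e j)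
      + (2 * x i * b' * x j + b (‖x‖ ^ 2) * (e i) j) • sig x
      + (b (‖x‖ ^ 2) * x j) • sig (e i) := by
  have h1 := (hasFDerivWithinAt_radial ha).smul_const (sig (e j))
  have h2 := ((hasFDerivWithinAt_radial hb).mul
    (EuclideanSpace.proj (𝕜 := ℝ) j : E3 →L[ℝ] ℝ).hasFDerivWithinAt).smul
      (sigL.hasFDerivWithinAt)
  have := pd_of_hasFDerivWithinAt hx (h1.add h2) i
  refine Eq.trans this ?_
  simp [inner_e, two_smul]
  ext <;> simp <;> ring

lemma pd_radialConn {F : ℝ → ℝ} {F' : ℝ} {x : E3} (hx : x ∈ B3)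
    (hF : HasDerivWithinAt F F' (Icc 0 1) (‖x‖ ^ 2)) (i j : Fin 3) :
    pd i (radialConn F j) x = (2 * x i * F') • sig (cross x (e j))
      + F (‖x‖ ^ 2) • sig (cross (e i) (e j)) :=
  pd_radial_linear hx hF (sigL.comp (crossL (e j))) i

lemma pd_radialHiggs {H : ℝ → ℝ} {H' : ℝ} {x : E3} (hx : x ∈ B3)
    (hH : HasDerivWithinAt H H' (Icc 0 1) (‖x‖ ^ 2)) (i : Fin 3) :
    pd i (radialHiggs H) x = (2 * x i * H') • sig x + H (‖x‖ ^ 2) • sig (e i) :=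
  pd_radial_linear hx hH sigL i

lemma pd_congr {f g : E3 → ℍ[ℝ]} {x : E3} (hx : x ∈ B3) (h : EqOn f g B3) (i : Fin 3) :
    pd i f x = pd i g x := by
  rw [pd, pd, fderivWithin_congr h (h hx)]

/-- Once the values of the profile and of its derivative are frozen as scalars and `‖x‖²` is
expanded, the claim is a polynomial identity in the coordinates of `x`. The same scheme proves the
next computations; it works because the curvature and `D_A Φ` both stay within the family
`radialForm`. -/
lemma star2_curvature_radialConn {F F₁ : ℝ → ℝ} {x : E3} (hx : x ∈ B3)
    (hF : HasDerivWithinAt F (F₁ (‖x‖ ^ 2)) (Icc 0 1) (‖x‖ ^ 2)) (k : Fin 3) :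
    star2 (curvature (radialConn F)) k x
      = radialForm (fun s => 2 * s * F₁ s + 2 * F s) (fun s => 2 * F s ^ 2 - 2 * F₁ s) k x := by
  simp only [star2, curvature, pd_radialConn hx hF]
  simp only [radialConn, radialForm]
  generalize F (‖x‖ ^ 2) = f
  generalize F₁ (‖x‖ ^ 2) = f₁
  rw [norm_sq_eq]
  fin_cases k <;> ext <;> simp [cross, e, Ring.lie_def] <;> ring

lemma D0_radial {F H H₁ : ℝ → ℝ} {x : E3} (hx : x ∈ B3)
    (hH : HasDerivWithinAt H (H₁ (‖x‖ ^ 2)) (Icc 0 1) (‖x‖ ^ 2)) (i : Fin 3) :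
    D0 (radialConn F) (radialHiggs H) i x
      = radialForm (fun s => H s + 2 * s * F s * H s) (fun s => 2 * H₁ s - 2 * F s * H s) i x := by
  simp only [D0, pd_radialHiggs hx hH]
  simp only [radialConn, radialHiggs, radialForm]
  generalize F (‖x‖ ^ 2) = f
  generalize H₁ (‖x‖ ^ 2) = h₁
  generalize H (‖x‖ ^ 2) = h
  rw [norm_sq_eq]
  fin_cases i <;> ext <;> simp [cross, e, Ring.lie_def] <;> ring

/-- Partial derivatives are taken within the closed ball, so an inner form may be replaced by its
radial expression before differentiating again only if the two agree on the whole ball, not merely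
at `x`. -/
lemma D1_congr {A w w' : Form1} {x : E3} (hx : x ∈ B3) (h : ∀ i, EqOn (w i) (w' i) B3)
    (i j : Fin 3) : D1 A w i j x = D1 A w' i j x := by
  simp only [D1, pd_congr hx (h _), h _ hx]

lemma star2_D1_radialForm {F a b : ℝ → ℝ} {a' b' : ℝ} {x : E3} (hx : x ∈ B3)
    (ha : HasDerivWithinAt a a' (Icc 0 1) (‖x‖ ^ 2))
    (hb : HasDerivWithinAt b b' (Icc 0 1) (‖x‖ ^ 2)) (k : Fin 3) :
    star2 (D1 (radialConn F) (radialForm a b)) k x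
      = (b (‖x‖ ^ 2) - 2 * a' + 2 * F (‖x‖ ^ 2) * (a (‖x‖ ^ 2) + ‖x‖ ^ 2 * b (‖x‖ ^ 2)))
        • sig (cross x (e k)) := by
  simp only [star2, D1, pd_radialForm hx ha hb]
  simp only [radialConn, radialForm]
  generalize F (‖x‖ ^ 2) = f
  generalize a (‖x‖ ^ 2) = a₀
  generalize b (‖x‖ ^ 2) = b₀
  rw [norm_sq_eq]
  fin_cases k <;> ext <;> simp [cross, e, Ring.lie_def] <;> ring

lemma D2_star1_radialForm {F a b : ℝ → ℝ} {a' b' : ℝ} {x : E3} (hx : x ∈ B3)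
    (ha : HasDerivWithinAt a a' (Icc 0 1) (‖x‖ ^ 2))
    (hb : HasDerivWithinAt b b' (Icc 0 1) (‖x‖ ^ 2)) :
    D2 (radialConn F) (star1 (radialForm a b)) x
      = (2 * a' + 2 * ‖x‖ ^ 2 * b' + 4 * b (‖x‖ ^ 2) - 4 * F (‖x‖ ^ 2) * a (‖x‖ ^ 2))
        • sig x := by
  -- Indices wrap around in `Fin 3`: the pair `(i + 1, i + 2)` is consecutive and its third index is
  -- `(i + 1) + 2 = i`.
  have hs : ∀ i : Fin 3, star1 (radialForm a b) (i + 1) (i + 2) = radialForm a b i := by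
    intro i; funext y; fin_cases i <;> simp [star1]
  simp only [D2, hs, pd_radialForm hx ha hb, Fin.sum_univ_three]
  simp only [radialConn, radialForm]
  generalize F (‖x‖ ^ 2) = f
  generalize a (‖x‖ ^ 2) = a₀
  generalize b (‖x‖ ^ 2) = b₀
  rw [norm_sq_eq]
  ext <;> simp [cross, e, Ring.lie_def] <;> ring

lemma D2_congr {A : Form1} {w w' : Form1} {x : E3} (hx : x ∈ B3) (h : ∀ i, EqOn (w i) (w' i) B3) :
    D2 A (star1 w) x = D2 A (star1 w') x := by
  have hs : ∀ (w : Form1) (i : Fin 3), star1 w (i + 1) (i + 2) = w i := by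
    intro w i; funext y; fin_cases i <;> simp [star1]
  simp only [D2, hs, pd_congr hx (h _), h _ hx]

lemma norm_sig (v : E3) : ‖sig v‖ = ‖v‖ := by
  have h : ‖sig v‖ ^ 2 = ‖v‖ ^ 2 := by
    rw [norm_sq_eq, sq ‖sig v‖, ← Quaternion.normSq_eq_norm_mul_self, Quaternion.normSq_def']
    simp
  exact (pow_left_inj₀ (norm_nonneg _) (norm_nonneg _) two_ne_zero).1 h

/-- The profile equations for `F(s) = γ(r) / r²`, `H(s) = φ(r) / r`, `s = r²`. -/
structure ProfileEq (ε lam : ℝ) (F F₁ F₂ H H₁ H₂ : ℝ → ℝ) : Prop where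
  dF : ∀ s ∈ Icc (0 : ℝ) 1, HasDerivWithinAt F (F₁ s) (Icc 0 1) s
  dF₁ : ∀ s ∈ Icc (0 : ℝ) 1, HasDerivWithinAt F₁ (F₂ s) (Icc 0 1) s
  dH : ∀ s ∈ Icc (0 : ℝ) 1, HasDerivWithinAt H (H₁ s) (Icc 0 1) s
  dH₁ : ∀ s ∈ Icc (0 : ℝ) 1, HasDerivWithinAt H₁ (H₂ s) (Icc 0 1) s
  eqF : ∀ s ∈ Icc (0 : ℝ) 1, 4 * s * F₂ s + 10 * F₁ s
    = 6 * F s ^ 2 + 4 * s * F s ^ 3 + 2 / ε * H s ^ 2 * (1 + 2 * s * F s)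
  eqH : ∀ s ∈ Icc (0 : ℝ) 1, 4 * s * H₂ s + 10 * H₁ s
    = 8 * F s * H s + 8 * s * F s ^ 2 * H s + lam / 2 * H s * (s * H s ^ 2 - 1)
  F_one : F 1 = -(1 / 2)
  H_one : H 1 = 1

theorem isSolution_radial {ε lam : ℝ} (hε : 0 < ε) {F F₁ F₂ H H₁ H₂ : ℝ → ℝ}
    (h : ProfileEq ε lam F F₁ F₂ H H₁ H₂) :
    IsSolution ε lam (radialConn F) (radialHiggs H) := by
  have hid : ∀ s : ℝ, HasDerivWithinAt (fun s : ℝ => s) 1 (Icc 0 1) s :=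
    fun s => hasDerivWithinAt_id s _
  refine ⟨fun x hx i => ?_, fun x hx => ?_, fun x hx v hv => ?_, fun x hx => ?_⟩
  · have hx := ball_subset_closedBall hx
    have hs := normSq_mem_Icc hx
    have hc : ∀ k, EqOn (star2 (curvature (radialConn F)) k)
        (radialForm (fun s => 2 * s * F₁ s + 2 * F s) (fun s => 2 * F s ^ 2 - 2 * F₁ s) k) B3 :=
      fun k y hy => star2_curvature_radialConn hy (h.dF _ (normSq_mem_Icc hy)) k
    have e1 : star2 (D1 (radialConn F) (star2 (curvature (radialConn F)))) i x
        = star2 (D1 (radialConn F) (radialForm (fun s => 2 * s * F₁ s + 2 * F s)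
          (fun s => 2 * F s ^ 2 - 2 * F₁ s))) i x := D1_congr hx hc _ _
    have e2 := star2_D1_radialForm (F := F) hx
      ((((hid _).const_mul 2).mul (h.dF₁ _ hs)).add ((h.dF _ hs).const_mul 2))
      ((((h.dF _ hs).pow 2).const_mul 2).sub ((h.dF₁ _ hs).const_mul 2)) i
    rw [D0_radial hx (h.dH _ hs)]
    refine (congrArg (ε • ·) (e1.trans e2)).trans ?_
    simp only [Pi.add_apply, Pi.sub_apply, Pi.mul_apply, Pi.pow_apply]
    have hE := h.eqF _ hs
    simp only [radialForm, radialHiggs]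
    generalize F (‖x‖ ^ 2) = f at *
    generalize F₁ (‖x‖ ^ 2) = f₁ at *
    generalize F₂ (‖x‖ ^ 2) = f₂ at *
    generalize H (‖x‖ ^ 2) = k at *
    generalize H₁ (‖x‖ ^ 2) = k₁ at *
    generalize ‖x‖ ^ 2 = s at *
    -- With `a = 2sF₁ + 2F` and `b = 2F² - 2F₁` one has `b - 2a' + 2F(a + sb) = -(4sF₂ + 10F₁ - 6F²
    -- - 4sF³)`, which explains the left side.
    have hE' : ε * (4 * s * f₂ + 10 * f₁ - 6 * f ^ 2 - 4 * s * f ^ 3)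
        = 2 * k ^ 2 * (1 + 2 * s * f) := by
      rw [hE]; field_simp; ring
    -- The `xᵢ σ·x` part of `D_A Φ` commutes with `Φ`; only the `σ·eᵢ` part contributes to the
    -- bracket.
    have hl : ⁅(k + 2 * s * f * k) • sig (e i) + ((2 * k₁ - 2 * f * k) * x i) • sig x,
        k • sig x⁆ = (-2 * k ^ 2 * (1 + 2 * s * f)) • sig (cross x (e i)) := by
      fin_cases i <;> ext <;> simp [cross, e, Ring.lie_def] <;> ring
    rw [hl, smul_smul]
    congr 1
    linear_combination -hE'
  · have hx := ball_subset_closedBall hx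
    have hs := normSq_mem_Icc hx
    have e1 := D2_congr (A := radialConn F) hx
      (fun k y hy => D0_radial (F := F) hy (h.dH _ (normSq_mem_Icc hy)) k)
    have e2 := D2_star1_radialForm (F := F) hx
      ((h.dH _ hs).add ((((hid _).const_mul 2).mul (h.dF _ hs)).mul (h.dH _ hs)))
      (((h.dH₁ _ hs).const_mul 2).sub (((h.dF _ hs).const_mul 2).mul (h.dH _ hs)))
    refine (e1.trans e2).trans ?_
    have hE := h.eqH _ hs
    have hn : ‖radialHiggs H x‖ ^ 2 = H (‖x‖ ^ 2) ^ 2 * ‖x‖ ^ 2 := by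
      rw [radialHiggs, norm_smul, norm_sig, mul_pow, Real.norm_eq_abs, sq_abs]
    rw [hn, radialHiggs, smul_smul]
    congr 1
    simp only [Pi.add_apply, Pi.sub_apply, Pi.mul_apply]
    linear_combination hE
  · have hxB := sphere_subset_closedBall hx
    have hs := normSq_mem_Icc hxB
    have h1 : ‖x‖ ^ 2 = 1 := by rw [mem_sphere_zero_iff_norm.1 hx]; norm_num
    -- At `s = 1` the coefficient `H + 2sFH` of `σ·eᵢ` is `1 + 2·(-1/2) = 0`, and what remains is
    -- proportional to `x · v`.
    simp only [D0_radial hxB (h.dH _ hs), radialForm, h1, h.F_one, h.H_one]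
    have hv' : x 0 * v 0 + x 1 * v 1 + x 2 * v 2 = 0 := by
      rw [← hv, PiLp.inner_apply, Fin.sum_univ_three]; simp; ring
    rw [Fin.sum_univ_three]
    have h2 : (v 0 * x 0 + v 1 * x 1 + v 2 * x 2) = 0 := by linarith
    have h3 : v 0 • (((1 : ℝ) + 2 * 1 * -(1 / 2) * 1) • sig (e 0)
        + ((2 * H₁ 1 - 2 * -(1 / 2) * 1) * x 0) • sig x)
        + v 1 • (((1 : ℝ) + 2 * 1 * -(1 / 2) * 1) • sig (e 1)
        + ((2 * H₁ 1 - 2 * -(1 / 2) * 1) * x 1) • sig x)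
        + v 2 • (((1 : ℝ) + 2 * 1 * -(1 / 2) * 1) • sig (e 2)
        + ((2 * H₁ 1 - 2 * -(1 / 2) * 1) * x 2) • sig x)
        = ((2 * H₁ 1 + 1) * (v 0 * x 0 + v 1 * x 1 + v 2 * x 2)) • sig x := by
      ext <;> simp [e] <;> ring
    rw [h3, h2]; simp
  · have h1 := mem_sphere_zero_iff_norm.1 hx
    rw [radialHiggs, norm_smul, norm_sig, h1]
    simp [h.H_one]

/-! ### Smoothness and equivariance of radial pairs -/

/-- The profiles are functions of `|x|²` rather than of `|x|` because only the former is smooth at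
the origin. -/
lemma contDiff_sig_comp (T : E3 →L[ℝ] ℍ[ℝ]) {G : ℝ → ℝ} (hG : ContDiffOn ℝ ∞ G (Icc 0 1)) :
    ContDiffOn ℝ ∞ (fun x : E3 => G (‖x‖ ^ 2) • T x) B3 :=
  (hG.comp (contDiff_norm_sq ℝ).contDiffOn (fun _ hx => normSq_mem_Icc hx)).smul
    T.contDiff.contDiffOn

theorem isSmoothPair_radial {F H : ℝ → ℝ} (hF : ContDiffOn ℝ ∞ F (Icc 0 1))
    (hH : ContDiffOn ℝ ∞ H (Icc 0 1)) : IsSmoothPair (radialConn F) (radialHiggs H) where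
  smooth_A i := contDiff_sig_comp (sigL.comp (crossL (e i))) hF
  smooth_Φ := contDiff_sig_comp sigL hH
  im_A i x _ := by simp [radialConn]
  im_Φ x _ := by simp [radialHiggs]

lemma vec_smul_sig (c : ℝ) (v : E3) : vec (c • sig v) = c • v := by
  ext i; fin_cases i <;> simp [vec]

lemma rot_smul (R : Matrix (Fin 3) (Fin 3) ℝ) (c : ℝ) (v : E3) : rot R (c • v) = c • rot R v := by
  simp [rot, Matrix.mulVec_smul]

lemma norm_rot {R : Matrix (Fin 3) (Fin 3) ℝ}
    (hR : R ∈ Matrix.specialOrthogonalGroup (Fin 3) ℝ) (x : E3) : ‖rot R x‖ ^ 2 = ‖x‖ ^ 2 := by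
  have h := (Matrix.mem_orthogonalGroup_iff' (Fin 3) ℝ).1
    (Matrix.mem_specialOrthogonalGroup_iff.1 hR).1
  rw [EuclideanSpace.real_norm_sq_eq, EuclideanSpace.real_norm_sq_eq]
  have : (R.mulVec x.ofLp) ⬝ᵥ (R.mulVec x.ofLp) = x.ofLp ⬝ᵥ x.ofLp := by
    rw [Matrix.dotProduct_mulVec, ← Matrix.mulVec_transpose, Matrix.mulVec_mulVec]
    rw [h, Matrix.one_mulVec]
  simpa [dotProduct, sq, rot] using this

/-- For `R` in `SO(3)` the adjugate equals the transpose, so every entry of `R` is its own cofactor;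
the `2 × 2` minors produced by the cross product are therefore entries of `R`. Both `RᵀR = 1` and
`det R = 1` enter. -/
lemma cross_rot {R : Matrix (Fin 3) (Fin 3) ℝ}
    (hR : R ∈ Matrix.specialOrthogonalGroup (Fin 3) ℝ) (x y : E3) :
    cross (rot R x) (rot R y) = rot R (cross x y) := by
  have h := (Matrix.mem_specialOrthogonalGroup_iff.1 hR)
  have h1 := (Matrix.mem_orthogonalGroup_iff' (Fin 3) ℝ).1 h.1
  have hadj : R.adjugate = R.transpose := by
    have h2 := R.mul_adjugate
    rw [h.2, one_smul] at h2
    calc R.adjugate = (R.transpose * R) * R.adjugate := by rw [h1, one_mul]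
      _ = R.transpose := by rw [mul_assoc, h2, mul_one]
  have hc : ∀ i j, R j i = R.adjugate i j := by
    intro i j; rw [hadj]; simp
  simp only [Matrix.adjugate_fin_three] at hc
  have h00 := hc 0 0
  have h01 := hc 0 1
  have h02 := hc 0 2
  have h10 := hc 1 0
  have h11 := hc 1 1
  have h12 := hc 1 2
  have h20 := hc 2 0
  have h21 := hc 2 1
  have h22 := hc 2 2
  simp at h00 h01 h02 h10 h11 h12 h20 h21 h22
  ext i
  fin_cases i <;> simp [cross, rot, Matrix.mulVec, dotProduct, Fin.sum_univ_three]
  · rw [h00, h10, h20]; ring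
  · rw [h01, h11, h21]; ring
  · rw [h02, h12, h22]; ring

theorem isSymmetric_radial (F H : ℝ → ℝ) : IsSymmetric (radialConn F) (radialHiggs H) := by
  intro R hR x _
  refine ⟨?_, fun j => ?_⟩
  · simp only [radialHiggs, norm_rot hR, vec_smul_sig, rot_smul]
    exact (sigL.map_smul _ _).symm
  · have hj : rot R (e j) = ∑ i, R i j • e i := by
      ext k; simp [rot, e, Pi.single_apply]
    simp only [radialConn, norm_rot hR, vec_smul_sig, rot_smul, ← cross_rot hR, hj]
    ext <;> simp [Fin.sum_univ_three, cross, e] <;> ring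

/-! ### Weak derivatives and primitives on the interval -/

open Filter Topology in
/-- Integration by parts for a primitive of an integrable function and a `C¹` function. -/
lemma integral_primitive_mul_deriv {f g η : ℝ → ℝ} {a b : ℝ} (hab : a ≤ b)
    (hg : IntervalIntegrable g volume a b) (hf : ∀ r ∈ Icc a b, f r = f a + ∫ t in a..r, g t)
    (hη : ContDiff ℝ 1 η) :
    ∫ r in a..b, f r * deriv η r = f b * η b - f a * η a - ∫ r in a..b, g r * η r := by
  have hAC : AbsolutelyContinuousOnInterval (fun x => ∫ v in a..x, g v) a b :=
    hg.absolutelyContinuousOnInterval_intervalIntegral (by simp)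
  have hηAC : AbsolutelyContinuousOnInterval η a b :=
    hη.contDiffOn.absolutelyContinuousOnInterval
  have hη' : IntervalIntegrable (deriv η) volume a b :=
    (hη.continuous_deriv le_rfl).intervalIntegrable _ _
  have h1 := hAC.integral_mul_deriv_eq_deriv_mul hηAC
  have h2 : ∫ r in a..b, deriv (fun x => ∫ v in a..x, g v) r * η r = ∫ r in a..b, g r * η r := by
    refine intervalIntegral.integral_congr_ae ?_
    filter_upwards [hg.ae_hasDerivAt_integral] with x hx hx'
    rw [(hx (uIoc_subset_uIcc hx') a (by simp)).deriv]
  have h3 : ∫ r in a..b, f r * deriv η r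
      = ∫ r in a..b, (f a * deriv η r + (∫ v in a..r, g v) * deriv η r) := by
    refine intervalIntegral.integral_congr fun r hr => ?_
    rw [uIcc_of_le hab] at hr
    simp only [hf r hr]; ring
  rw [h3, intervalIntegral.integral_add (hη'.const_mul _)
    (hη'.continuousOn_mul hAC.continuousOn), intervalIntegral.integral_const_mul, h1, h2,
    intervalIntegral.integral_deriv_eq_sub (fun x _ => hη.differentiable one_ne_zero x) hη',
    hf b ⟨hab, le_rfl⟩, intervalIntegral.integral_same]
  ring

/-- Adjoining `[1/4, 3/4]` to `K` keeps the interval nondegenerate even for empty `K`, and makes it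
contain the support of the fixed bump of `exists_bump`. -/
lemma exists_Icc_superset {K : Set ℝ} (hK : IsCompact K) (hK' : K ⊆ Ioo 0 1) :
    ∃ a b : ℝ, 0 < a ∧ a ≤ 1 / 4 ∧ 3 / 4 ≤ b ∧ b < 1 ∧ K ⊆ Icc a b := by
  have hL : IsCompact (K ∪ Icc (1 / 4) (3 / 4)) := hK.union isCompact_Icc
  have hL' : K ∪ Icc (1 / 4) (3 / 4) ⊆ Ioo (0 : ℝ) 1 :=
    union_subset hK' fun x hx => ⟨by linarith [hx.1], by linarith [hx.2]⟩
  have hne : (K ∪ Icc (1 / 4 : ℝ) (3 / 4)).Nonempty := ⟨1 / 2, Or.inr ⟨by norm_num, by norm_num⟩⟩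
  obtain ⟨a, ha, ha'⟩ := hL.exists_isLeast hne
  obtain ⟨b, hb, hb'⟩ := hL.exists_isGreatest hne
  exact ⟨a, b, (hL' ha).1, ha' (Or.inr ⟨by norm_num, by norm_num⟩),
    hb' (Or.inr ⟨by norm_num, by norm_num⟩), (hL' hb).2,
    fun x hx => ⟨ha' (Or.inl hx), hb' (Or.inl hx)⟩⟩

/-- Reduction of the integral of a function supported in `[a, b]`. -/
lemma setIntegral_Ioo_eq_intervalIntegral {F : ℝ → ℝ} {a b : ℝ} (ha : 0 < a) (hab : a ≤ b)
    (hb : b < 1) (hF : ∀ r, r ∉ Icc a b → F r = 0) :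
    ∫ r in Ioo (0 : ℝ) 1, F r = ∫ r in a..b, F r := by
  rw [intervalIntegral.integral_of_le hab, ← integral_Icc_eq_integral_Ioc]
  exact setIntegral_eq_of_subset_of_forall_sdiff_eq_zero measurableSet_Ioo
    (fun x hx => ⟨ha.trans_le hx.1, hx.2.trans_lt hb⟩) (fun x hx => hF x hx.2)

lemma intervalIntegrable_of_locallyIntegrableOn {g : ℝ → ℝ}
    (hg : LocallyIntegrableOn g (Ioo 0 1)) {a b : ℝ} (ha : a ∈ Ioo (0 : ℝ) 1)
    (hb : b ∈ Ioo (0 : ℝ) 1) : IntervalIntegrable g volume a b :=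
  (hg.integrableOn_compact_subset (ordConnected_Ioo.uIcc_subset ha hb)
    isCompact_uIcc).intervalIntegrable

/-- A locally integrable function is the weak derivative of its primitive. -/
lemma hasWeakDeriv_of_primitive {f g : ℝ → ℝ} (hg : LocallyIntegrableOn g (Ioo 0 1))
    (hf : ContinuousOn f (Ioo 0 1))
    (h : ∀ a ∈ Ioo (0 : ℝ) 1, ∀ b ∈ Ioo (0 : ℝ) 1, a ≤ b → f b = f a + ∫ t in a..b, g t) :
    HasWeakDeriv f g := by
  refine ⟨hf.locallyIntegrableOn measurableSet_Ioo, hg, fun η hη hηc hηs => ?_⟩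
  obtain ⟨a, b, ha, ha', hb', hb, hK⟩ := exists_Icc_superset hηc hηs
  have hη0 : ∀ r, r ∉ Icc a b → η r = 0 := fun r hr =>
    image_eq_zero_of_notMem_tsupport fun h' => hr (hK h')
  have hη1 : ∀ r, r ∉ Icc a b → deriv η r = 0 := fun r hr =>
    image_eq_zero_of_notMem_tsupport fun h' => hr (hK (tsupport_deriv_subset h'))
  -- A strictly larger interval, so that `η` is known to vanish at its endpoints and the boundary
  -- terms drop out.
  obtain ⟨a₁, b₁, h1, h2, h3, h4⟩ : ∃ a₁ b₁ : ℝ, 0 < a₁ ∧ a₁ < a ∧ b < b₁ ∧ b₁ < 1 :=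
    ⟨a / 2, (b + 1) / 2, by linarith, by linarith, by linarith, by linarith⟩
  have hmem : ∀ r ∈ Icc a₁ b₁, r ∈ Ioo (0 : ℝ) 1 := fun r hr =>
    ⟨h1.trans_le hr.1, hr.2.trans_lt h4⟩
  have hab : a₁ ≤ b₁ := by linarith
  have hnot : ∀ r, r ∉ Icc a₁ b₁ → r ∉ Icc a b := fun r hr hr' =>
    hr ⟨by linarith [hr'.1], by linarith [hr'.2]⟩
  rw [setIntegral_Ioo_eq_intervalIntegral h1 hab h4
      (fun r hr => by rw [hη1 r (hnot r hr), mul_zero]),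
    setIntegral_Ioo_eq_intervalIntegral h1 hab h4
      (fun r hr => by rw [hη0 r (hnot r hr), mul_zero]),
    integral_primitive_mul_deriv hab
      (intervalIntegrable_of_locallyIntegrableOn hg (hmem _ ⟨le_rfl, hab⟩) (hmem _ ⟨hab, le_rfl⟩))
      (fun r hr => h _ (hmem _ ⟨le_rfl, hab⟩) _ (hmem _ hr) hr.1)
      (hη.of_le (by exact_mod_cast le_top)),
    hη0 a₁ (fun h' => by linarith [h'.1]), hη0 b₁ (fun h' => by linarith [h'.2])]
  ring

/-- A bump function on `(0, 1)` with integral one. -/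
lemma exists_bump : ∃ ψ : ℝ → ℝ, ContDiff ℝ ∞ ψ ∧ (∀ r, r ∉ Icc (1 / 4 : ℝ) (3 / 4) → ψ r = 0) ∧
    ∫ r, ψ r = 1 := by
  let B : ContDiffBump (1 / 2 : ℝ) := ⟨1 / 8, 1 / 4, by norm_num, by norm_num⟩
  refine ⟨B.normed volume, B.contDiff_normed, fun r hr => ?_, B.integral_normed⟩
  by_contra h
  have : r ∈ ball (1 / 2 : ℝ) (1 / 4) := by
    rw [← B.support_normed_eq (μ := volume)]; exact h
  rw [mem_ball, Real.dist_eq, abs_lt] at this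
  exact hr ⟨by linarith [this.1], by linarith [this.2]⟩

/-- **Du Bois-Reymond lemma**: a continuous function with vanishing weak derivative is constant. -/
lemma const_of_weakDeriv_zero {f : ℝ → ℝ} (hf : ContinuousOn f (Ioo 0 1))
    (h : ∀ η : ℝ → ℝ, ContDiff ℝ ∞ η → HasCompactSupport η → tsupport η ⊆ Ioo 0 1 →
      ∫ r in Ioo (0 : ℝ) 1, f r * deriv η r = 0) :
    ∃ c, ∀ r ∈ Ioo (0 : ℝ) 1, f r = c := by
  obtain ⟨ψ, hψ, hψ0, hψ1⟩ := exists_bump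
  have hloc : LocallyIntegrableOn f (Ioo 0 1) := hf.locallyIntegrableOn measurableSet_Ioo
  -- If `f` is constant, its average against the normalised bump is that constant.
  set c := ∫ r in Ioo (0 : ℝ) 1, f r * ψ r with hc
  refine ⟨c, ?_⟩
  have hae : ∀ᵐ r, r ∈ Ioo (0 : ℝ) 1 → f r - c = 0 := by
    refine isOpen_Ioo.ae_eq_zero_of_integral_contDiff_smul_eq_zero
      (hloc.sub (continuousOn_const.locallyIntegrableOn measurableSet_Ioo)) fun g hg hgc hgs => ?_
    obtain ⟨a, b, ha, ha', hb', hb, hK⟩ := exists_Icc_superset hgc hgs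
    have hg0 : ∀ r, r ∉ Icc a b → g r = 0 := fun r hr =>
      image_eq_zero_of_notMem_tsupport fun h' => hr (hK h')
    have hψ0' : ∀ r, r ∉ Icc a b → ψ r = 0 := fun r hr =>
      hψ0 r fun h' => hr ⟨ha'.trans h'.1, h'.2.trans hb'⟩
    have hab : a ≤ b := by linarith
    have hsub : Icc a b ⊆ Ioo (0 : ℝ) 1 := fun x hx => ⟨ha.trans_le hx.1, hx.2.trans_lt hb⟩
    set m := ∫ r in a..b, g r with hm
    have hψm : ∫ r in a..b, ψ r = 1 := by
      rw [← hψ1, intervalIntegral.integral_of_le hab, ← integral_Icc_eq_integral_Ioc]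
      exact setIntegral_eq_integral_of_forall_compl_eq_zero hψ0'
    -- Subtracting the multiple of `ψ` with the same integral makes the mean zero, so the primitive
    -- of `θ` is again compactly supported and is a legitimate test function. Testing with it gives
    -- `∫ f g = c ∫ g`.
    let θ : ℝ → ℝ := fun r => g r - m * ψ r
    have hθ : ContDiff ℝ ∞ θ := hg.sub (contDiff_const.mul hψ)
    have hθ0 : ∀ r, r ∉ Icc a b → θ r = 0 := fun r hr => by simp [θ, hg0 r hr, hψ0' r hr]
    have hθi : ∀ u v, IntervalIntegrable θ volume u v := fun u v =>
      hθ.continuous.intervalIntegrable u v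
    have hθint : ∫ r in a..b, θ r = 0 := by
      simp only [θ]
      rw [intervalIntegral.integral_sub (hg.continuous.intervalIntegrable _ _)
        ((hψ.continuous.intervalIntegrable _ _).const_mul _),
        intervalIntegral.integral_const_mul, hψm]
      simp [hm]
    let η : ℝ → ℝ := fun r => ∫ t in a..r, θ t
    have hηd : ∀ r, HasDerivAt η (θ r) r := fun r =>
      intervalIntegral.integral_hasDerivAt_right (hθi a r)
        (hθ.continuous.stronglyMeasurableAtFilter _ _) hθ.continuous.continuousAt
    have hηderiv : deriv η = θ := funext fun r => (hηd r).deriv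
    have hη : ContDiff ℝ ∞ η := by
      rw [contDiff_infty_iff_deriv, hηderiv]
      exact ⟨fun r => (hηd r).differentiableAt, hθ⟩
    have hη0 : ∀ r, r ∉ Icc a b → η r = 0 := by
      intro r hr
      rcases lt_or_ge r a with h1 | h1
      · refine intervalIntegral.integral_zero_ae ?_
        -- The range of integration is `(r, a]`, where `θ` is known to vanish except at the null
        -- point `a`.
        have : ∀ᵐ t : ℝ, t ≠ a := by simp [ae_iff, measure_singleton]
        filter_upwards [this] with t ht ht'
        rw [uIoc_of_ge h1.le] at ht'
        exact hθ0 t fun h' => ht (le_antisymm ht'.2 h'.1)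
      · have h2 : b < r := not_le.1 fun h2 => hr ⟨h1, h2⟩
        simp only [η]
        rw [← intervalIntegral.integral_add_adjacent_intervals (hθi a b) (hθi b r), hθint, zero_add]
        refine intervalIntegral.integral_zero_ae (Filter.Eventually.of_forall fun t ht' => ?_)
        rw [uIoc_of_le h2.le] at ht'
        exact hθ0 t fun h' => by linarith [h'.2, ht'.1]
    have hηts : tsupport η ⊆ Icc a b := closure_minimal
      (fun r hr => by by_contra h'; exact hr (hη0 r h')) isClosed_Icc
    have key := h η hη (isCompact_Icc.of_isClosed_subset (isClosed_tsupport η) hηts)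
      (hηts.trans hsub)
    have hfi : IntervalIntegrable f volume a b :=
      intervalIntegrable_of_locallyIntegrableOn hloc (hsub ⟨le_rfl, hab⟩) (hsub ⟨hab, le_rfl⟩)
    have hfg : IntervalIntegrable (fun r => f r * g r) volume a b :=
      hfi.mul_continuousOn hg.continuous.continuousOn
    have hfψ : IntervalIntegrable (fun r => f r * ψ r) volume a b :=
      hfi.mul_continuousOn hψ.continuous.continuousOn
    have hc' : c = ∫ r in a..b, f r * ψ r :=
      setIntegral_Ioo_eq_intervalIntegral ha hab hb fun r hr => by rw [hψ0' r hr, mul_zero]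
    rw [hηderiv, setIntegral_Ioo_eq_intervalIntegral ha hab hb
      (fun r hr => by rw [hθ0 r hr, mul_zero])] at key
    have e1 : ∫ r in a..b, f r * θ r = (∫ r in a..b, f r * g r) - m * c := by
      rw [hc', ← intervalIntegral.integral_const_mul, ← intervalIntegral.integral_sub hfg
        (hfψ.const_mul _)]
      refine intervalIntegral.integral_congr fun r _ => ?_
      simp only [θ]; ring
    have e2 : ∫ r, g r • (f r - c) = ∫ r in a..b, g r • (f r - c) := by
      rw [intervalIntegral.integral_of_le hab, ← integral_Icc_eq_integral_Ioc]
      exact (setIntegral_eq_integral_of_forall_compl_eq_zero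
        fun r hr => by rw [hg0 r hr, zero_smul]).symm
    have e3 : ∫ r in a..b, g r • (f r - c) = (∫ r in a..b, f r * g r) - c * m := by
      rw [hm, ← intervalIntegral.integral_const_mul, ← intervalIntegral.integral_sub hfg
        ((hg.continuous.intervalIntegrable _ _).const_mul _)]
      refine intervalIntegral.integral_congr fun r _ => ?_
      simp only [smul_eq_mul]; ring
    rw [e2, e3]
    linarith
  have hae' : f =ᵐ[volume.restrict (Ioo (0 : ℝ) 1)] fun _ => c := by
    rw [Filter.EventuallyEq, ae_restrict_iff' measurableSet_Ioo]
    filter_upwards [hae] with r hr hr'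
    linarith [hr hr']
  exact fun r hr => Measure.eqOn_open_of_ae_eq hae' isOpen_Ioo hf continuousOn_const hr

/-- A continuous function is the primitive of its weak derivative. -/
lemma HasWeakDeriv.eq_integral {f g : ℝ → ℝ} (h : HasWeakDeriv f g) (hf : ContinuousOn f (Ioo 0 1))
    {a b : ℝ} (ha : a ∈ Ioo (0 : ℝ) 1) (hb : b ∈ Ioo (0 : ℝ) 1) :
    f b = f a + ∫ t in a..b, g t := by
  obtain ⟨h1, h2, h3⟩ := h
  have hc : (1 / 2 : ℝ) ∈ Ioo (0 : ℝ) 1 := by constructor <;> norm_num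
  have hii : ∀ u ∈ Ioo (0 : ℝ) 1, ∀ v ∈ Ioo (0 : ℝ) 1, IntervalIntegrable g volume u v :=
    fun u hu v hv => intervalIntegrable_of_locallyIntegrableOn h2 hu hv
  -- The base point is interior because `g` need not be integrable up to `0` or `1`.
  let G : ℝ → ℝ := fun r => ∫ t in (1 / 2)..r, g t
  have hGsub : ∀ u ∈ Ioo (0 : ℝ) 1, ∀ v ∈ Ioo (0 : ℝ) 1, G v = G u + ∫ t in u..v, g t :=
    fun u hu v hv =>
      (intervalIntegral.integral_add_adjacent_intervals (hii _ hc _ hu) (hii _ hu _ hv)).symm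
  have hGc : ContinuousOn G (Ioo 0 1) := by
    intro r hr
    obtain ⟨u, v, hu, hv, hrm, hcm⟩ : ∃ u v : ℝ, u ∈ Ioo (0 : ℝ) 1 ∧ v ∈ Ioo (0 : ℝ) 1 ∧
        r ∈ Ioo u v ∧ (1 / 2 : ℝ) ∈ Ioo u v := by
      refine ⟨min r (1 / 2) / 2, (max r (1 / 2) + 1) / 2, ?_⟩
      rcases hr with ⟨hr0, hr1⟩
      rcases le_total r (1 / 2) with h' | h'
      · rw [min_eq_left h', max_eq_right h']
        refine ⟨⟨?_, ?_⟩, ⟨?_, ?_⟩, ⟨?_, ?_⟩, ?_, ?_⟩ <;> linarith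
      · rw [min_eq_right h', max_eq_left h']
        refine ⟨⟨?_, ?_⟩, ⟨?_, ?_⟩, ⟨?_, ?_⟩, ?_, ?_⟩ <;> linarith
    have hAC := (hii u hu v hv).absolutelyContinuousOnInterval_intervalIntegral
      (c := 1 / 2) (by rw [uIcc_of_le (by linarith [hrm.1, hrm.2])]; exact Ioo_subset_Icc_self hcm)
    have := hAC.continuousOn
    rw [uIcc_of_le (by linarith [hrm.1, hrm.2])] at this
    exact (this.continuousAt (Icc_mem_nhds hrm.1 hrm.2)).continuousWithinAt
  have hGw := hasWeakDeriv_of_primitive h2 hGc (fun u hu v hv _ => hGsub u hu v hv)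
  obtain ⟨c, hc'⟩ := const_of_weakDeriv_zero (hf.sub hGc) fun η hη hηc hηs => by
    obtain ⟨a', b', ha, ha', hb', hb, hK⟩ := exists_Icc_superset hηc hηs
    have hη1 : ∀ r, r ∉ Icc a' b' → deriv η r = 0 := fun r hr =>
      image_eq_zero_of_notMem_tsupport fun h' => hr (hK (tsupport_deriv_subset h'))
    have hab : a' ≤ b' := by linarith
    have hsub : uIcc a' b' ⊆ Ioo (0 : ℝ) 1 := by
      rw [uIcc_of_le hab]; exact fun x hx => ⟨ha.trans_le hx.1, hx.2.trans_lt hb⟩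
    have e1 := h3 η hη hηc hηs
    have e2 := hGw.2.2 η hη hηc hηs
    rw [setIntegral_Ioo_eq_intervalIntegral ha hab hb (fun r hr => by rw [hη1 r hr, mul_zero])]
      at e1 e2 ⊢
    have hcd := (hη.continuous_deriv (by exact_mod_cast le_top)).continuousOn (s := uIcc a' b')
    rw [← e2] at e1
    have e3 : ∀ r, (f - G) r * deriv η r = f r * deriv η r - G r * deriv η r := fun r => by
      simp only [Pi.sub_apply]; ring
    simp only [e3]
    rw [intervalIntegral.integral_sub, e1, sub_self]
    · exact ((hf.mono hsub).mul hcd).intervalIntegrable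
    · exact ((hGc.mono hsub).mul hcd).intervalIntegrable
  have ea := hc' a ha
  have eb := hc' b hb
  simp only [Pi.sub_apply] at ea eb
  linarith [hGsub a ha b hb]

/-! ### Parametrisation of the admissible class by velocities -/

instance : IsFiniteMeasure dr := by unfold dr; infer_instance

/-- The primitive `γ(r) = ∫₀ʳ g`. -/
def gam (g : ℝ → ℝ) (r : ℝ) : ℝ := ∫ t in (0 : ℝ)..r, g t

/-- The profile `φ(r) = 1 - ∫ᵣ¹ k(t)/t dt`, for which `k(r) = r φ'(r)`. -/
def hig (k : ℝ → ℝ) (r : ℝ) : ℝ := 1 - ∫ t in r..1, k t / t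

lemma intervalIntegrable_of_integrable_dr {g : ℝ → ℝ} (hg : Integrable g dr) {a b : ℝ}
    (ha : a ∈ Icc (0 : ℝ) 1) (hb : b ∈ Icc (0 : ℝ) 1) : IntervalIntegrable g volume a b := by
  have h : IntegrableOn g (Icc 0 1) := by
    rw [integrableOn_Icc_iff_integrableOn_Ioo]; exact hg
  exact (h.mono_set (ordConnected_Icc.uIcc_subset ha hb)).intervalIntegrable

lemma intervalIntegrable_div {k : ℝ → ℝ} (hk : Integrable k dr) {a b : ℝ}
    (ha : a ∈ Ioc (0 : ℝ) 1) (hb : b ∈ Ioc (0 : ℝ) 1) :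
    IntervalIntegrable (fun t => k t / t) volume a b := by
  have h := intervalIntegrable_of_integrable_dr hk (Ioc_subset_Icc_self ha)
    (Ioc_subset_Icc_self hb)
  simp only [div_eq_mul_inv]
  refine h.mul_continuousOn (continuousOn_id.inv₀ fun x hx => ?_)
  exact ((ordConnected_Ioc.uIcc_subset ha hb) hx).1.ne'

lemma integrable_of_memLp {g : ℝ → ℝ} (hg : MemLp g 2 dr) : Integrable g dr :=
  hg.integrable (by norm_num)

lemma locallyIntegrableOn_of_integrable_dr {g : ℝ → ℝ} (hg : Integrable g dr) :
    LocallyIntegrableOn g (Ioo 0 1) :=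
  IntegrableOn.locallyIntegrableOn hg

lemma continuousOn_Ioc_of_Icc {f : ℝ → ℝ} (h : ∀ a ∈ Ioc (0 : ℝ) 1, ContinuousOn f (Icc a 1)) :
    ContinuousOn f (Ioc 0 1) := by
  intro r hr
  have h1 := h (r / 2) ⟨by linarith [hr.1], by linarith [hr.1, hr.2]⟩ r
    ⟨by linarith [hr.1], hr.2⟩
  refine h1.mono_of_mem_nhdsWithin ?_
  refine mem_nhdsWithin.2 ⟨Ioi (r / 2), isOpen_Ioi, by simp; linarith [hr.1], ?_⟩
  exact fun x hx => ⟨le_of_lt hx.1, hx.2.2⟩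

lemma continuousOn_gam {g : ℝ → ℝ} (hg : Integrable g dr) : ContinuousOn (gam g) (Icc 0 1) := by
  have h := intervalIntegrable_of_integrable_dr hg (a := 0) (b := 1) (by simp) (by simp)
  have := (h.absolutelyContinuousOnInterval_intervalIntegral (c := 0) (by simp)).continuousOn
  rwa [uIcc_of_le zero_le_one] at this

lemma gam_sub {g : ℝ → ℝ} (hg : Integrable g dr) {a b : ℝ} (ha : a ∈ Icc (0 : ℝ) 1)
    (hb : b ∈ Icc (0 : ℝ) 1) : gam g b = gam g a + ∫ t in a..b, g t :=
  (intervalIntegral.integral_add_adjacent_intervals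
    (intervalIntegrable_of_integrable_dr hg (by simp) ha)
    (intervalIntegrable_of_integrable_dr hg ha hb)).symm

lemma hig_sub {k : ℝ → ℝ} (hk : Integrable k dr) {a b : ℝ} (ha : a ∈ Ioc (0 : ℝ) 1)
    (hb : b ∈ Ioc (0 : ℝ) 1) : hig k b = hig k a + ∫ t in a..b, k t / t := by
  have := intervalIntegral.integral_add_adjacent_intervals
    (intervalIntegrable_div hk ha hb) (intervalIntegrable_div hk hb (b := 1) (by simp))
  simp only [hig]
  linarith

lemma continuousOn_hig {k : ℝ → ℝ} (hk : Integrable k dr) : ContinuousOn (hig k) (Ioc 0 1) := by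
  refine continuousOn_Ioc_of_Icc fun a ha => ?_
  have h := (intervalIntegrable_div hk ha (b := 1) (by simp))
  have h' := (h.absolutelyContinuousOnInterval_intervalIntegral (c := a) (by simp)).continuousOn
  rw [uIcc_of_le ha.2] at h'
  refine (h'.const_add (hig k a)).congr fun r hr => ?_
  exact hig_sub hk ha ⟨ha.1.trans_le hr.1, hr.2⟩

lemma integral_sq_le {g : ℝ → ℝ} (hg : MemLp g 2 dr) {a b : ℝ} (ha : 0 ≤ a) (hab : a ≤ b)
    (hb : b ≤ 1) : ∫ t in a..b, g t ^ 2 ≤ ∫ t, g t ^ 2 ∂dr := by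
  have h : ∫ t, g t ^ 2 ∂dr = ∫ t in (0 : ℝ)..1, g t ^ 2 := by
    rw [intervalIntegral.integral_of_le zero_le_one, integral_Ioc_eq_integral_Ioo, dr]
  rw [h]
  exact intervalIntegral.integral_mono_interval ha hab hb
    (Filter.Eventually.of_forall fun t => sq_nonneg _)
    (intervalIntegrable_of_integrable_dr hg.integrable_sq (by simp) (by simp))

/-- Young's inequality `|g| ≤ (√r/2) g² + 1/(2√r)` integrated over `[0, r]`. The rate `√r` is the
one Cauchy-Schwarz would give. -/
lemma abs_gam_le {g : ℝ → ℝ} (hg : MemLp g 2 dr) {r : ℝ} (hr : r ∈ Ioc (0 : ℝ) 1) :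
    |gam g r| ≤ (∫ t, g t ^ 2 ∂dr + 1) / 2 * √r := by
  have hr0 : 0 < √r := Real.sqrt_pos.2 hr.1
  have hi : IntervalIntegrable (fun t => g t ^ 2) volume 0 r :=
    intervalIntegrable_of_integrable_dr hg.integrable_sq (by simp) (Ioc_subset_Icc_self hr)
  have h1 : ‖∫ t in (0 : ℝ)..r, g t‖ ≤ ∫ t in (0 : ℝ)..r, (√r / 2 * g t ^ 2 + 1 / (2 * √r)) := by
    refine intervalIntegral.norm_integral_le_of_norm_le hr.1.le
      (Filter.Eventually.of_forall fun t _ => ?_) ((hi.const_mul _).add (by simp))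
    rw [Real.norm_eq_abs]
    have : √r / 2 * g t ^ 2 + 1 / (2 * √r) - |g t| = (√r * |g t| - 1) ^ 2 / (2 * √r) := by
      rw [← sq_abs (g t)]; field_simp; ring
    have h2 : 0 ≤ (√r * |g t| - 1) ^ 2 / (2 * √r) := by positivity
    linarith
  rw [intervalIntegral.integral_add (hi.const_mul _) (by simp),
    intervalIntegral.integral_const_mul, intervalIntegral.integral_const] at h1
  have h3 := integral_sq_le hg le_rfl hr.1.le hr.2
  have h4 : (r - 0) • (1 / (2 * √r)) = √r / 2 := by
    rw [smul_eq_mul, sub_zero]; field_simp; linarith [Real.sq_sqrt hr.1.le]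
  rw [h4] at h1
  refine h1.trans ?_
  nlinarith [mul_le_mul_of_nonneg_left h3 hr0.le]

/-- Young's inequality `|k|/t ≤ k²/(2√r) + (√r/2) t⁻²` integrated over `[r, 1]`, where `∫ t⁻² ≤
1/r`. This rate and that of `abs_gam_le` give the initial `r^(-3/2)` bound near the origin. -/
lemma abs_hig_le {k : ℝ → ℝ} (hk : MemLp k 2 dr) {r : ℝ} (hr : r ∈ Ioc (0 : ℝ) 1) :
    |hig k r| ≤ 1 + (∫ t, k t ^ 2 ∂dr + 1) / (2 * √r) := by
  have hr0 : 0 < √r := Real.sqrt_pos.2 hr.1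
  have hsq : √r * √r = r := Real.mul_self_sqrt hr.1.le
  have hi : IntervalIntegrable (fun t => k t ^ 2) volume r 1 :=
    intervalIntegrable_of_integrable_dr hk.integrable_sq (Ioc_subset_Icc_self hr) (by simp)
  have hz : (0 : ℝ) ∉ uIcc r 1 := by rw [uIcc_of_le hr.2]; exact fun h => by linarith [h.1, hr.1]
  have hi2 : IntervalIntegrable (fun t : ℝ => t ^ (-2 : ℤ)) volume r 1 :=
    intervalIntegral.intervalIntegrable_zpow (Or.inr hz)
  have h1 : ‖∫ t in r..1, k t / t‖
      ≤ ∫ t in r..1, (1 / (2 * √r) * k t ^ 2 + √r / 2 * t ^ (-2 : ℤ)) := by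
    refine intervalIntegral.norm_integral_le_of_norm_le hr.2
      (Filter.Eventually.of_forall fun t ht => ?_) ((hi.const_mul _).add (hi2.const_mul _))
    have ht0 : 0 < t := hr.1.trans ht.1
    rw [Real.norm_eq_abs, abs_div, abs_of_pos ht0]
    have : 1 / (2 * √r) * k t ^ 2 + √r / 2 * t ^ (-2 : ℤ) - |k t| / t
        = (|k t| - √r / t) ^ 2 / (2 * √r) := by
      rw [← sq_abs (k t), zpow_neg]; norm_cast; field_simp; ring
    have h2 : 0 ≤ (|k t| - √r / t) ^ 2 / (2 * √r) := by positivity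
    linarith
  rw [intervalIntegral.integral_add (hi.const_mul _) (hi2.const_mul _),
    intervalIntegral.integral_const_mul, intervalIntegral.integral_const_mul,
    integral_zpow (Or.inr ⟨by norm_num, hz⟩)] at h1
  have h3 := integral_sq_le hk hr.1.le hr.2 le_rfl
  have h4 : √r / 2 * ((1 ^ (-2 + 1 : ℤ) - r ^ (-2 + 1 : ℤ)) / (((-2 : ℤ) : ℝ) + 1))
      ≤ 1 / (2 * √r) := by
    norm_num
    have : r⁻¹ = (√r)⁻¹ * (√r)⁻¹ := by rw [← mul_inv, hsq]
    rw [this]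
    have h5 : 0 < (√r)⁻¹ := by positivity
    have h6 : √r * (√r)⁻¹ = 1 := mul_inv_cancel₀ hr0.ne'
    nlinarith [mul_pos hr0 h5]
  have h7 : |hig k r| ≤ 1 + ‖∫ t in r..1, k t / t‖ := by
    rw [hig, Real.norm_eq_abs]
    exact (abs_sub _ _).trans (by simp)
  have h8 : 1 / (2 * √r) * ∫ t in r..1, k t ^ 2 ≤ 1 / (2 * √r) * ∫ t, k t ^ 2 ∂dr :=
    mul_le_mul_of_nonneg_left h3 (by positivity)
  have h9 : (∫ t, k t ^ 2 ∂dr + 1) / (2 * √r)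
      = 1 / (2 * √r) * ∫ t, k t ^ 2 ∂dr + 1 / (2 * √r) := by ring
  linarith

lemma memLp_rsqdr_iff {f : ℝ → ℝ} (hf : AEStronglyMeasurable f dr) :
    MemLp f 2 rsqdr ↔ MemLp (fun r => r * f r) 2 dr := by
  have h1 : AEStronglyMeasurable f rsqdr := hf.mono_ac (withDensity_absolutelyContinuous _ _)
  have h2 : AEStronglyMeasurable (fun r => r * f r) dr :=
    (measurable_id.aestronglyMeasurable).mul hf
  rw [memLp_two_iff_integrable_sq h1, memLp_two_iff_integrable_sq h2, rsqdr,
    integrable_withDensity_iff (by fun_prop) (Filter.Eventually.of_forall fun _ => by simp)]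
  refine integrable_congr (Filter.Eventually.of_forall fun r => ?_)
  simp only
  rw [ENNReal.toReal_ofReal (sq_nonneg r)]; ring

lemma ae_dr_iff {p : ℝ → Prop} : (∀ᵐ r ∂dr, p r) ↔ ∀ᵐ r, r ∈ Ioo (0 : ℝ) 1 → p r :=
  ae_restrict_iff' measurableSet_Ioo

/-- Every velocity pair yields an admissible pair: the pointwise growth bounds show that `γ` and
`rφ` are bounded, hence square integrable. The converse is `Admissible.eq_gam` and
`Admissible.eq_hig`. -/
lemma admissible_gam_hig {g k : ℝ → ℝ} (hg : MemLp g 2 dr) (hk : MemLp k 2 dr)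
    (hg1 : gam g 1 = -(1 / 2)) : Admissible (gam g) g (hig k) (fun t => k t / t) := by
  have hgi := integrable_of_memLp hg
  have hki := integrable_of_memLp hk
  have hkloc : LocallyIntegrableOn (fun t => k t / t) (Ioo 0 1) := by
    simp only [div_eq_mul_inv]
    exact (locallyIntegrableOn_of_integrable_dr hki).mul_continuousOn
      (continuousOn_id.inv₀ fun x hx => hx.1.ne') isOpen_Ioo.isLocallyClosed
  have hcφ := continuousOn_hig hki
  have hcγ := continuousOn_gam hgi
  have hφm : AEStronglyMeasurable (hig k) dr :=
    (hcφ.mono Ioo_subset_Ioc_self).aestronglyMeasurable measurableSet_Ioo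
  refine ⟨hasWeakDeriv_of_primitive (locallyIntegrableOn_of_integrable_dr hgi)
      (hcγ.mono Ioo_subset_Icc_self) fun a ha b hb _ => gam_sub hgi (Ioo_subset_Icc_self ha)
        (Ioo_subset_Icc_self hb), ?_, hg, hcγ,
    hasWeakDeriv_of_primitive hkloc (hcφ.mono Ioo_subset_Ioc_self) fun a ha b hb _ =>
      hig_sub hki (Ioo_subset_Ioc_self ha) (Ioo_subset_Ioc_self hb), ?_, ?_, hcφ, by simp [gam],
    hg1, by simp [hig]⟩
  · refine MemLp.of_bound ((hcγ.mono Ioo_subset_Icc_self).aestronglyMeasurable measurableSet_Ioo)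
      ((∫ t, g t ^ 2 ∂dr + 1) / 2) ?_
    rw [ae_dr_iff]
    refine Filter.Eventually.of_forall fun r hr => (abs_gam_le hg (Ioo_subset_Ioc_self hr)).trans ?_
    have : √r ≤ 1 := Real.sqrt_le_one.2 hr.2.le
    have h0 : 0 ≤ ∫ t, g t ^ 2 ∂dr := integral_nonneg fun t => sq_nonneg _
    exact mul_le_of_le_one_right (by positivity) this
  · rw [memLp_rsqdr_iff hφm]
    refine MemLp.of_bound (measurable_id.aestronglyMeasurable.mul hφm)
      (1 + (∫ t, k t ^ 2 ∂dr + 1) / 2) ?_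
    rw [ae_dr_iff]
    refine Filter.Eventually.of_forall fun r hr => ?_
    rw [Real.norm_eq_abs, abs_mul, abs_of_pos hr.1]
    have hr0 : 0 < √r := Real.sqrt_pos.2 hr.1
    have h0 : 0 ≤ ∫ t, k t ^ 2 ∂dr := integral_nonneg fun t => sq_nonneg _
    have h1 : √r ≤ 1 := Real.sqrt_le_one.2 hr.2.le
    have hsq : √r * √r = r := Real.mul_self_sqrt hr.1.le
    refine (mul_le_mul_of_nonneg_left (abs_hig_le hk (Ioo_subset_Ioc_self hr)) hr.1.le).trans ?_
    have : r * (1 + (∫ t, k t ^ 2 ∂dr + 1) / (2 * √r))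
        = r + (∫ t, k t ^ 2 ∂dr + 1) / 2 * √r := by
      generalize √r = q at *
      subst hsq
      field_simp
    rw [this]
    exact add_le_add hr.2.le (mul_le_of_le_one_right (by positivity) h1)
  · have hm : AEStronglyMeasurable (fun t => k t / t) dr :=
      hk.1.mul (measurable_inv.aestronglyMeasurable) |>.congr
        (Filter.Eventually.of_forall fun t => by simp [div_eq_mul_inv])
    rw [memLp_rsqdr_iff hm]
    refine (memLp_congr_ae ?_).1 hk
    rw [Filter.EventuallyEq, ae_dr_iff]
    exact Filter.Eventually.of_forall fun r hr => by
      have := hr.1.ne'; field_simp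

/-- Both sides are continuous with the same weak derivative, so they differ by a constant on the
open interval and, by continuity, on its closure; the value at `0` fixes the constant. For the Higgs
profile the value at `1` plays this role, as continuity at `0` is not available. -/
lemma Admissible.eq_gam {γ γ' φ φ' : ℝ → ℝ} (h : Admissible γ γ' φ φ') :
    EqOn γ (gam γ') (Icc 0 1) := by
  have hi := integrable_of_memLp h.memLp_γ'
  have hc := h.cont_γ.sub (continuousOn_gam hi)
  have h12 : (1 / 2 : ℝ) ∈ Ioo (0 : ℝ) 1 := by constructor <;> norm_num
  have h1 : EqOn (fun r => γ r - gam γ' r) (fun _ => γ (1 / 2) - gam γ' (1 / 2)) (Ioo 0 1) := by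
    intro r hr
    have e1 := h.weak_γ.eq_integral (h.cont_γ.mono Ioo_subset_Icc_self) h12 hr
    have e2 := gam_sub hi (Ioo_subset_Icc_self h12) (Ioo_subset_Icc_self hr)
    simp only; linarith
  have h2 := h1.of_subset_closure hc continuousOn_const Ioo_subset_Icc_self
    (by rw [closure_Ioo zero_ne_one])
  intro r hr
  have e1 := h2 hr
  have e2 := h2 (left_mem_Icc.2 zero_le_one)
  have e3 : gam γ' 0 = 0 := by simp [gam]
  simp only [h.γ_zero, e3] at e1 e2
  linarith

lemma Admissible.memLp_mul {γ γ' φ φ' : ℝ → ℝ} (h : Admissible γ γ' φ φ') :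
    MemLp (fun r => r * φ' r) 2 dr := by
  have hm : AEStronglyMeasurable φ' dr := h.weak_φ.2.1.aestronglyMeasurable
  exact (memLp_rsqdr_iff hm).1 h.memLp_φ'

lemma Admissible.eq_hig {γ γ' φ φ' : ℝ → ℝ} (h : Admissible γ γ' φ φ') :
    EqOn φ (hig fun r => r * φ' r) (Ioc 0 1) := by
  have hi := integrable_of_memLp h.memLp_mul
  have hc := h.cont_φ.sub (continuousOn_hig hi)
  have h12 : (1 / 2 : ℝ) ∈ Ioo (0 : ℝ) 1 := by constructor <;> norm_num
  have h1 : EqOn (fun r => φ r - hig (fun r => r * φ' r) r)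
      (fun _ => φ (1 / 2) - hig (fun r => r * φ' r) (1 / 2)) (Ioo 0 1) := by
    intro r hr
    have e1 := h.weak_φ.eq_integral (h.cont_φ.mono Ioo_subset_Ioc_self) h12 hr
    have e2 := hig_sub hi (Ioo_subset_Ioc_self h12) (Ioo_subset_Ioc_self hr)
    have e3 : ∫ t in (1 / 2)..r, t * φ' t / t = ∫ t in (1 / 2)..r, φ' t := by
      refine intervalIntegral.integral_congr fun t ht => ?_
      have := ((ordConnected_Ioo.uIcc_subset h12 hr) ht).1.ne'
      field_simp
    simp only; linarith
  have h2 := h1.of_subset_closure hc continuousOn_const Ioo_subset_Ioc_self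
    (by rw [closure_Ioo zero_ne_one]; exact Ioc_subset_Icc_self)
  intro r hr
  have e1 := h2 hr
  have e2 := h2 (right_mem_Ioc.2 zero_lt_one)
  have e3 : hig (fun r => r * φ' r) 1 = 1 := by simp [hig]
  simp only [h.φ_one, e3] at e1 e2
  linarith

/-! ### The direct method -/

open Filter Topology in
/-- Bounded sequences of square-integrable functions have weakly convergent subsequences. -/
lemma exists_weak_subseq {f : ℕ → ℝ → ℝ} (hf : ∀ n, MemLp (f n) 2 dr) {C : ℝ}
    (hC : ∀ n, ∫ t, f n t ^ 2 ∂dr ≤ C) :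
    ∃ g : ℝ → ℝ, MemLp g 2 dr ∧ ∃ σ : ℕ → ℕ, StrictMono σ ∧ ∀ h : ℝ → ℝ, MemLp h 2 dr →
      Tendsto (fun n => ∫ t, f (σ n) t * h t ∂dr) atTop (𝓝 (∫ t, g t * h t ∂dr)) := by
  -- This provides separability of `L²`, on which the sequential form of Banach-Alaoglu depends.
  have : Fact ((2 : ENNReal) ≠ ⊤) := ⟨by simp⟩
  let X := Lp ℝ 2 dr
  have hin : ∀ (u v : ℝ → ℝ) (hu : MemLp u 2 dr) (hv : MemLp v 2 dr),
      inner ℝ (hu.toLp u) (hv.toLp v) = ∫ t, u t * v t ∂dr := by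
    intro u v hu hv
    rw [L2.inner_def]
    refine integral_congr_ae ?_
    filter_upwards [hu.coeFn_toLp, hv.coeFn_toLp] with t h1 h2
    rw [h1, h2]; simp [mul_comm]
  let x : ℕ → X := fun n => (hf n).toLp (f n)
  have hx : ∀ n, ‖x n‖ ≤ √C := by
    intro n
    refine Real.le_sqrt_of_sq_le ?_
    rw [← real_inner_self_eq_norm_sq, hin]
    simpa [sq] using hC n
  let y : ℕ → WeakDual ℝ X := fun n => StrongDual.toWeakDual (InnerProductSpace.toDual ℝ X (x n))
  have hy : ∀ n, y n ∈ WeakDual.toStrongDual ⁻¹' closedBall (0 : StrongDual ℝ X) (√C) := by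
    intro n
    simp only [mem_preimage, mem_closedBall_zero_iff]
    exact (LinearIsometryEquiv.norm_map (InnerProductSpace.toDual ℝ X) (x n)).le.trans (hx n)
  obtain ⟨z, _, σ, hσ, hlim⟩ := WeakDual.isSeqCompact_closedBall ℝ X 0 (√C) hy
  let w : X := (InnerProductSpace.toDual ℝ X).symm (WeakDual.toStrongDual z)
  refine ⟨w, Lp.memLp w, σ, hσ, fun h hh => ?_⟩
  have h1 : Tendsto (fun n => y (σ n) (hh.toLp h)) atTop (𝓝 (z (hh.toLp h))) :=
    ((WeakDual.eval_continuous (hh.toLp h)).tendsto z).comp hlim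
  have h2 : z (hh.toLp h) = ∫ t, w t * h t ∂dr := by
    have : z (hh.toLp h) = inner ℝ w (hh.toLp h) := by
      simp [w]
    rw [this, ← hin _ _ (Lp.memLp w) hh, Lp.toLp_coeFn]
  have h3 : ∀ n, y n (hh.toLp h) = ∫ t, f n t * h t ∂dr := by
    intro n
    rw [← hin _ _ (hf n) hh]
    rfl
  simpa only [h2, h3] using h1

/-- The zeroth-order part of the reduced functional. -/
def pot (ε lam r y z : ℝ) : ℝ :=
  4 * Real.pi * (2 * ε * (2 / r ^ 2 * (y ^ 2 + y) ^ 2) + 2 * z ^ 2 * (1 + 2 * y) ^ 2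
    + lam / 4 * r ^ 2 * (z ^ 2 - 1) ^ 2)

lemma pot_nonneg {ε lam : ℝ} (hε : 0 < ε) (hlam : 0 ≤ lam) (r y z : ℝ) :
    0 ≤ pot ε lam r y z := by
  unfold pot; positivity

lemma aemeasurable_pot {ε lam : ℝ} {u v : ℝ → ℝ} (hu : AEMeasurable u dr)
    (hv : AEMeasurable v dr) : AEMeasurable (fun r => pot ε lam r (u r) (v r)) dr := by
  unfold pot; fun_prop

lemma aemeasurable_ofReal_pot {ε lam : ℝ} {u v : ℝ → ℝ} (hu : AEMeasurable u dr) (hv : AEMeasurable v dr) :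
    AEMeasurable (fun r => ENNReal.ofReal (pot ε lam r (u r) (v r))) dr :=
  (aemeasurable_pot hu hv).ennreal_ofReal

lemma S_congr {ε lam : ℝ} {u u' v v' a a' b b' : ℝ → ℝ} (h1 : EqOn u a (Ioo 0 1))
    (h2 : EqOn u' a' (Ioo 0 1)) (h3 : EqOn v b (Ioo 0 1)) (h4 : EqOn v' b' (Ioo 0 1)) :
    S ε lam u u' v v' = S ε lam a a' b b' :=
  setLIntegral_congr_fun measurableSet_Ioo fun r hr => by
    simp only [h1 hr, h2 hr, h3 hr, h4 hr]

lemma aemeasurable_gam {g : ℝ → ℝ} (hg : Integrable g dr) : AEMeasurable (gam g) dr :=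
  (((continuousOn_gam hg).mono Ioo_subset_Icc_self).aestronglyMeasurable
    measurableSet_Ioo).aemeasurable

lemma aemeasurable_hig {k : ℝ → ℝ} (hk : Integrable k dr) : AEMeasurable (hig k) dr :=
  (((continuousOn_hig hk).mono Ioo_subset_Ioc_self).aestronglyMeasurable
    measurableSet_Ioo).aemeasurable

/-- Since `r² (k/r)² = k²`, the weight disappears from the derivative part, which becomes a sum of
plain `L²` norms and is always finite. Only the zeroth-order part can be infinite. -/
lemma S_gam_hig {ε lam : ℝ} (hε : 0 < ε) (hlam : 0 ≤ lam) {g k : ℝ → ℝ} (hg : MemLp g 2 dr)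
    (hk : MemLp k 2 dr) : S ε lam (gam g) g (hig k) (fun t => k t / t)
      = ENNReal.ofReal (4 * Real.pi * (2 * ε * ∫ t, g t ^ 2 ∂dr + ∫ t, k t ^ 2 ∂dr))
        + ∫⁻ r, ENNReal.ofReal (pot ε lam r (gam g r) (hig k r)) ∂dr := by
  have hi : Integrable (fun t => 4 * Real.pi * (2 * ε * g t ^ 2 + k t ^ 2)) dr :=
    ((hg.integrable_sq.const_mul _).add hk.integrable_sq).const_mul _
  have e1 : 4 * Real.pi * (2 * ε * ∫ t, g t ^ 2 ∂dr + ∫ t, k t ^ 2 ∂dr)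
      = ∫ t, 4 * Real.pi * (2 * ε * g t ^ 2 + k t ^ 2) ∂dr := by
    rw [integral_const_mul, integral_add (hg.integrable_sq.const_mul _) hk.integrable_sq,
      integral_const_mul]
  have hnn : ∀ t, 0 ≤ 4 * Real.pi * (2 * ε * g t ^ 2 + k t ^ 2) := fun t => by positivity
  rw [e1, ofReal_integral_eq_lintegral_ofReal hi (Filter.Eventually.of_forall hnn),
    ← lintegral_add_right' _ (aemeasurable_ofReal_pot (aemeasurable_gam (integrable_of_memLp hg))
      (aemeasurable_hig (integrable_of_memLp hk)))]
  refine setLIntegral_congr_fun measurableSet_Ioo fun r hr => ?_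
  simp only
  rw [← ENNReal.ofReal_add (hnn r) (pot_nonneg hε hlam _ _ _)]
  congr 1
  have := hr.1.ne'
  unfold pot
  field_simp
  ring

/-- Evaluation at `r` is the pairing of the velocity with a fixed `L²` function, so weak convergence
of velocities implies pointwise convergence of profiles. For `hig` the function is `1/t` on `(r,
1)`, which is in `L²` because `r > 0`. -/
lemma gam_eq_integral_indicator (g : ℝ → ℝ) {r : ℝ} (hr : r ∈ Ioo (0 : ℝ) 1) :
    gam g r = ∫ t, g t * (Ioc 0 r).indicator (fun _ => 1) t ∂dr := by
  have : ∀ t, g t * (Ioc 0 r).indicator (fun _ => 1) t = (Ioc 0 r).indicator g t := fun t => by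
    by_cases ht : t ∈ Ioc 0 r <;> simp [ht]
  simp only [this]
  rw [integral_indicator measurableSet_Ioc, dr, Measure.restrict_restrict measurableSet_Ioc, gam,
    intervalIntegral.integral_of_le hr.1.le, inter_eq_left.2]
  exact fun t ht => ⟨ht.1, ht.2.trans_lt hr.2⟩

lemma hig_eq_integral_indicator (k : ℝ → ℝ) {r : ℝ} (hr : r ∈ Ioo (0 : ℝ) 1) :
    hig k r = 1 - ∫ t, k t * (Ioo r 1).indicator (fun t => t⁻¹) t ∂dr := by
  have : ∀ t, k t * (Ioo r 1).indicator (fun t => t⁻¹) t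
      = (Ioo r 1).indicator (fun t => k t / t) t := fun t => by
    by_cases ht : t ∈ Ioo r 1 <;> simp [ht, div_eq_mul_inv]
  simp only [this]
  rw [integral_indicator measurableSet_Ioo, dr, Measure.restrict_restrict measurableSet_Ioo, hig,
    intervalIntegral.integral_of_le hr.2.le, inter_eq_left.2, integral_Ioc_eq_integral_Ioo]
  exact fun t ht => ⟨hr.1.trans ht.1, ht.2⟩

lemma memLp_indicator_one (r : ℝ) : MemLp ((Ioc 0 r).indicator fun _ => (1 : ℝ)) 2 dr :=
  (memLp_const 1).indicator measurableSet_Ioc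

lemma memLp_indicator_inv {r : ℝ} (hr : 0 < r) :
    MemLp ((Ioo r 1).indicator fun t : ℝ => t⁻¹) 2 dr := by
  refine MemLp.of_bound ((measurable_inv.indicator measurableSet_Ioo).aestronglyMeasurable) r⁻¹
    (Filter.Eventually.of_forall fun t => ?_)
  by_cases ht : t ∈ Ioo r 1
  · simp only [indicator_of_mem ht, norm_inv, Real.norm_eq_abs, abs_of_pos (hr.trans ht.1)]
    exact inv_anti₀ hr ht.1.le
  · simp [ht, hr.le]

/-- Admissible velocities `(g, k) = (γ', r φ')`. -/
def Velocity (g k : ℝ → ℝ) : Prop := MemLp g 2 dr ∧ MemLp k 2 dr ∧ gam g 1 = -(1 / 2)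

/-- The reduced functional in terms of the velocities. -/
def energy (ε lam : ℝ) (g k : ℝ → ℝ) : ENNReal :=
  S ε lam (gam g) g (hig k) (fun t => k t / t)

/-- The trial profiles are `γ = -r²/2` and `φ = r`: then `γ² + γ = O(r²)`, which compensates the
factor `2/r²`. -/
lemma exists_finite_energy {ε lam : ℝ} (hε : 0 < ε) (hlam : 0 ≤ lam) :
    ∃ g k, Velocity g k ∧ energy ε lam g k < ⊤ := by
  have hg : MemLp (fun r : ℝ => -r) 2 dr := by
    refine MemLp.of_bound (by fun_prop) 1 ?_
    rw [ae_dr_iff]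
    exact Filter.Eventually.of_forall fun r hr => by
      rw [norm_neg, Real.norm_eq_abs, abs_of_pos hr.1]; exact hr.2.le
  have hk : MemLp (fun r : ℝ => r) 2 dr := by
    refine hg.neg.ae_eq (Filter.Eventually.of_forall fun r => ?_)
    simp
  have e1 : ∀ r, gam (fun r => -r) r = -(r ^ 2 / 2) := fun r => by
    rw [gam, intervalIntegral.integral_neg, integral_id]; ring
  have e2 : ∀ r ∈ Ioo (0 : ℝ) 1, hig (fun r => r) r = r := fun r hr => by
    have : ∫ t in r..1, t / t = ∫ t in r..1, (1 : ℝ) := by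
      refine intervalIntegral.integral_congr fun t ht => ?_
      rw [uIcc_of_le hr.2.le] at ht
      exact div_self (hr.1.trans_le ht.1).ne'
    simp [hig, this]
  refine ⟨fun r => -r, fun r => r, ⟨hg, hk, by rw [e1]; norm_num⟩, ?_⟩
  rw [energy, S_gam_hig hε hlam hg hk, ENNReal.add_lt_top]
  refine ⟨ENNReal.ofReal_lt_top, ?_⟩
  have hb : ∫⁻ r, ENNReal.ofReal (pot ε lam r (gam (fun r => -r) r) (hig (fun r => r) r)) ∂dr
      ≤ ∫⁻ _, ENNReal.ofReal (4 * Real.pi * (2 * ε * 2 + 2 + lam / 4)) ∂dr := by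
    refine lintegral_mono_ae ?_
    rw [ae_dr_iff]
    refine Filter.Eventually.of_forall fun r hr => ENNReal.ofReal_le_ofReal ?_
    rw [e1, e2 r hr, pot]
    have hr0 := hr.1
    have hr1 := hr.2
    have h2 : r ^ 2 ≤ 1 := by nlinarith
    have h3 : 2 / r ^ 2 * ((-(r ^ 2 / 2)) ^ 2 + -(r ^ 2 / 2)) ^ 2 ≤ 2 := by
      have : 2 / r ^ 2 * ((-(r ^ 2 / 2)) ^ 2 + -(r ^ 2 / 2)) ^ 2
          = r ^ 2 / 2 * (1 - r ^ 2 / 2) ^ 2 := by field_simp; ring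
      rw [this]
      have h4 : (1 - r ^ 2 / 2) ^ 2 ≤ 1 := by nlinarith
      nlinarith [sq_nonneg r]
    have h5 : 2 * r ^ 2 * (1 + 2 * -(r ^ 2 / 2)) ^ 2 ≤ 2 := by
      have h4 : (1 + 2 * -(r ^ 2 / 2)) ^ 2 ≤ 1 := by nlinarith
      nlinarith [sq_nonneg r]
    have h6 : lam / 4 * r ^ 2 * (r ^ 2 - 1) ^ 2 ≤ lam / 4 := by
      have h4 : (r ^ 2 - 1) ^ 2 ≤ 1 := by nlinarith
      have h7 : r ^ 2 * (r ^ 2 - 1) ^ 2 ≤ 1 := by nlinarith [sq_nonneg r]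
      rw [mul_assoc]
      exact mul_le_of_le_one_right (by positivity) h7
    gcongr
  exact hb.trans_lt (by simp [ENNReal.mul_lt_top_iff])

open Filter Topology in
/-- Existence of energy-minimizing velocities, by the direct method. -/
theorem exists_minimizer {ε lam : ℝ} (hε : 0 < ε) (hlam : 0 ≤ lam) :
    ∃ g k, Velocity g k ∧ energy ε lam g k < ⊤ ∧
      ∀ g' k', Velocity g' k' → energy ε lam g k ≤ energy ε lam g' k' := by
  set I : Set ENNReal := {x | ∃ g k, Velocity g k ∧ energy ε lam g k = x} with hI
  obtain ⟨g₀, k₀, hv₀, hf₀⟩ := exists_finite_energy hε hlam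
  have hne : I.Nonempty := ⟨_, g₀, k₀, hv₀, rfl⟩
  have hinf : sInf I < ⊤ := (sInf_le (hI ▸ ⟨g₀, k₀, hv₀, rfl⟩)).trans_lt hf₀
  obtain ⟨x, _, hx, hxI⟩ := exists_seq_tendsto_sInf hne (OrderBot.bddBelow I)
  choose g k hv hE using hxI
  -- discard finitely many terms so that the energies are bounded
  obtain ⟨M, hM1, hM2⟩ := ENNReal.lt_iff_exists_nnreal_btwn.1 hinf
  obtain ⟨N, hN⟩ := Filter.eventually_atTop.1 (hx.eventually (gt_mem_nhds hM1))
  have hquad : ∀ n, 4 * Real.pi * (2 * ε * ∫ t, g (n + N) t ^ 2 ∂dr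
      + ∫ t, k (n + N) t ^ 2 ∂dr) ≤ M := by
    intro n
    have h1 := (hN (n + N) (by omega)).le
    rw [← hE, energy, S_gam_hig hε hlam (hv (n + N)).1 (hv (n + N)).2.1] at h1
    have h2 := le_self_add.trans h1
    rw [ENNReal.ofReal_le_iff_le_toReal (by simp)] at h2
    simpa using h2
  have hsq : ∀ f : ℝ → ℝ, 0 ≤ ∫ t, f t ^ 2 ∂dr := fun f => integral_nonneg fun t => sq_nonneg _
  have hgb : ∀ n, ∫ t, g (n + N) t ^ 2 ∂dr ≤ M / (8 * Real.pi * ε) := by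
    intro n
    rw [le_div_iff₀ (by positivity)]
    nlinarith [hquad n, hsq (k (n + N)), mul_nonneg Real.pi_pos.le (hsq (k (n + N)))]
  have hkb : ∀ n, ∫ t, k (n + N) t ^ 2 ∂dr ≤ M / (4 * Real.pi) := by
    intro n
    rw [le_div_iff₀ (by positivity)]
    nlinarith [hquad n, mul_nonneg (mul_nonneg Real.pi_pos.le hε.le) (hsq (g (n + N)))]
  obtain ⟨G, hG, σ, hσ, hGlim⟩ := exists_weak_subseq (fun n => (hv (n + N)).1) hgb
  obtain ⟨K, hK, τ, hτ, hKlim⟩ := exists_weak_subseq (fun n => (hv (σ n + N)).2.1)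
    -- The second extraction is made along the first subsequence, so that both velocities converge
    -- along `σ ∘ τ`.
    (fun n => hkb (σ n))
  set m : ℕ → ℕ := fun n => σ (τ n) + N with hm
  have hGlim' : ∀ h : ℝ → ℝ, MemLp h 2 dr →
      Tendsto (fun n => ∫ t, g (m n) t * h t ∂dr) atTop (𝓝 (∫ t, G t * h t ∂dr)) :=
    fun h hh => (hGlim h hh).comp hτ.tendsto_atTop
  have hx' : Tendsto (fun n => x (m n)) atTop (𝓝 (sInf I)) :=
    hx.comp ((tendsto_add_atTop_nat N).comp ((hσ.comp hτ).tendsto_atTop))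
  have hG1 : gam G 1 = -(1 / 2) := by
    have h1 := hGlim' (fun _ => 1) (memLp_const 1)
    have h2 : ∀ f : ℝ → ℝ, ∫ t, f t * 1 ∂dr = gam f 1 := fun f => by
      simp only [mul_one]
      rw [gam, intervalIntegral.integral_of_le zero_le_one, integral_Ioc_eq_integral_Ioo, dr]
    simp only [h2, (hv _).2.2] at h1
    exact (tendsto_nhds_unique h1 tendsto_const_nhds)
  have hγlim : ∀ r ∈ Ioo (0 : ℝ) 1, Tendsto (fun n => gam (g (m n)) r) atTop (𝓝 (gam G r)) := by
    intro r hr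
    simp only [gam_eq_integral_indicator _ hr]
    exact hGlim' _ (memLp_indicator_one r)
  have hφlim : ∀ r ∈ Ioo (0 : ℝ) 1, Tendsto (fun n => hig (k (m n)) r) atTop (𝓝 (hig K r)) := by
    intro r hr
    simp only [hig_eq_integral_indicator _ hr]
    exact (hKlim _ (memLp_indicator_inv hr.1)).const_sub 1
  refine ⟨G, K, ⟨hG, hK, hG1⟩, ?_⟩
  suffices h : energy ε lam G K ≤ sInf I from
    ⟨h.trans_lt hinf, fun g' k' hv' => h.trans (sInf_le ⟨g', k', hv', rfl⟩)⟩
  -- lower semicontinuity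
  set b : ℕ → ENNReal := fun n => ENNReal.ofReal (4 * Real.pi *
    (2 * ε * (2 * (∫ t, g (m n) t * G t ∂dr) - ∫ t, G t ^ 2 ∂dr)
      + (2 * (∫ t, k (m n) t * K t ∂dr) - ∫ t, K t ^ 2 ∂dr))) with hb
  set B : ENNReal := ENNReal.ofReal (4 * Real.pi *
    (2 * ε * ∫ t, G t ^ 2 ∂dr + ∫ t, K t ^ 2 ∂dr)) with hB
  have hblim : Tendsto b atTop (𝓝 B) := by
    have e1 : B = ENNReal.ofReal (4 * Real.pi *
        (2 * ε * (2 * (∫ t, G t * G t ∂dr) - ∫ t, G t ^ 2 ∂dr)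
          + (2 * (∫ t, K t * K t ∂dr) - ∫ t, K t ^ 2 ∂dr))) := by
      simp only [← sq]; rw [hB]; congr 1; ring
    rw [e1]
    refine ENNReal.tendsto_ofReal (Tendsto.const_mul _ (Tendsto.add (Tendsto.const_mul _
      (((hGlim' G hG).const_mul 2).sub_const _)) (((hKlim K hK).const_mul 2).sub_const _)))
  -- The lower bound `2⟨u,v⟩ - ‖v‖²` for `‖u‖²` is affine in `u`, hence passes to weak limits, and
  -- it is sharp at `u = v`.
  have hyoung : ∀ u v : ℝ → ℝ, MemLp u 2 dr → MemLp v 2 dr →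
      2 * (∫ t, u t * v t ∂dr) - ∫ t, v t ^ 2 ∂dr ≤ ∫ t, u t ^ 2 ∂dr := by
    intro u v hu hv
    have huv : Integrable (fun t => u t * v t) dr := hu.integrable_mul hv
    have hd : Integrable (fun t => u t ^ 2 - 2 * (u t * v t)) dr :=
      hu.integrable_sq.sub (huv.const_mul 2)
    have h1 : ∫ t, (u t - v t) ^ 2 ∂dr
        = ∫ t, u t ^ 2 ∂dr - 2 * (∫ t, u t * v t ∂dr) + ∫ t, v t ^ 2 ∂dr := by
      rw [← integral_const_mul, ← integral_sub hu.integrable_sq (huv.const_mul 2),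
        ← integral_add hd hv.integrable_sq]
      refine integral_congr_ae (Eventually.of_forall fun t => ?_)
      simp only; ring
    linarith [integral_nonneg (μ := dr) (f := fun t => (u t - v t) ^ 2) fun t => sq_nonneg _]
  set P : ℕ → ENNReal := fun n =>
    ∫⁻ r, ENNReal.ofReal (pot ε lam r (gam (g (m n)) r) (hig (k (m n)) r)) ∂dr with hP
  have hbP : ∀ n, b n + P n ≤ x (m n) := by
    intro n
    rw [← hE, energy, S_gam_hig hε hlam (hv (m n)).1 (hv (m n)).2.1]
    refine add_le_add (ENNReal.ofReal_le_ofReal ?_) le_rfl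
    have h1 := hyoung _ _ (hv (m n)).1 hG
    have h2 := hyoung _ _ (hv (m n)).2.1 hK
    gcongr
  have hFatou : ∫⁻ r, ENNReal.ofReal (pot ε lam r (gam G r) (hig K r)) ∂dr
      ≤ liminf P atTop := by
    refine le_trans (le_of_eq ?_) (lintegral_liminf_le' fun n =>
      aemeasurable_ofReal_pot (aemeasurable_gam (integrable_of_memLp (hv (m n)).1))
        (aemeasurable_hig (integrable_of_memLp (hv (m n)).2.1)))
    refine lintegral_congr_ae ?_
    rw [EventuallyEq, ae_dr_iff]
    refine Eventually.of_forall fun r hr => (Tendsto.liminf_eq ?_).symm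
    refine ENNReal.tendsto_ofReal ?_
    unfold pot
    have h1 := hγlim r hr
    have h2 := hφlim r hr
    exact ((((((h1.pow 2).add h1).pow 2).const_mul _).const_mul _).add
      (((h2.pow 2).const_mul 2).mul (((h1.const_mul 2).const_add 1).pow 2))).add
      ((((h2.pow 2).sub_const 1).pow 2).const_mul _) |>.const_mul _
  rw [energy, S_gam_hig hε hlam hG hK]
  -- Subtraction in `ENNReal` is truncated; this inequality is what allows `B + (sInf I - B)` to be
  -- simplified at the end.
  have hBle : B ≤ sInf I := le_of_tendsto_of_tendsto' hblim hx' fun n => le_self_add.trans (hbP n)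
  have hPle : liminf P atTop ≤ sInf I - B := by
    have h1 : Tendsto (fun n => x (m n) - b n) atTop (𝓝 (sInf I - B)) :=
      ENNReal.Tendsto.sub hx' hblim (Or.inr ENNReal.ofReal_ne_top)
    rw [← h1.liminf_eq]
    refine liminf_le_liminf (Eventually.of_forall fun n => ?_)
    exact ENNReal.le_sub_of_add_le_left ENNReal.ofReal_ne_top (hbP n)
  calc B + _ ≤ B + (sInf I - B) := add_le_add le_rfl (hFatou.trans hPle)
    _ = sInf I := add_tsub_cancel_of_le hBle

/-- Energy-minimizing velocities give a minimizer of the reduced functional. -/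
lemma isMinimizer_of_velocity {ε lam : ℝ} {g k : ℝ → ℝ} (hv : Velocity g k)
    (h : ∀ g' k', Velocity g' k' → energy ε lam g k ≤ energy ε lam g' k') :
    IsMinimizer ε lam (gam g) (hig k) := by
  refine ⟨g, fun t => k t / t, admissible_gam_hig hv.1 hv.2.1 hv.2.2, fun c c' p p' hA => ?_⟩
  have h1 : Velocity c' (fun r => r * p' r) :=
    ⟨hA.memLp_γ', hA.memLp_mul, by rw [← hA.eq_gam (right_mem_Icc.2 zero_le_one), hA.γ_one]⟩
  refine (h _ _ h1).trans (le_of_eq (S_congr ?_ (fun _ _ => rfl) ?_ ?_))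
  · exact fun r hr => (hA.eq_gam (Ioo_subset_Icc_self hr)).symm
  · exact fun r hr => (hA.eq_hig (Ioo_subset_Ioc_self hr)).symm
  · intro r hr
    have := hr.1.ne'
    simp only; field_simp

/-! ### First variation -/

/-- Derivative of `pot` with respect to the gauge profile. -/
def potY (ε r y z : ℝ) : ℝ :=
  4 * Real.pi * (8 * ε / r ^ 2 * (y ^ 2 + y) * (2 * y + 1) + 8 * z ^ 2 * (2 * y + 1))

/-- Derivative of `pot` with respect to the Higgs profile. -/
def potZ (lam r y z : ℝ) : ℝ :=
  4 * Real.pi * (4 * z * (2 * y + 1) ^ 2 + lam * r ^ 2 * z * (z ^ 2 - 1))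

/-- Second-order Taylor remainder of `pot`. -/
def potR (ε lam r y z p q t : ℝ) : ℝ :=
  4 * Real.pi * (4 * ε / r ^ 2 * (p ^ 2 * (2 * y + 1) ^ 2 + 2 * (y ^ 2 + y) * p ^ 2
      + 2 * t * p ^ 3 * (2 * y + 1) + t ^ 2 * p ^ 4)
    + 2 * (q ^ 2 * (2 * y + 1) ^ 2 + 8 * z * q * (2 * y + 1) * p + 4 * z ^ 2 * p ^ 2
      + t * (8 * z * q * p ^ 2 + 4 * q ^ 2 * (2 * y + 1) * p) + t ^ 2 * (4 * q ^ 2 * p ^ 2))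
    + lam / 4 * r ^ 2 * (4 * z ^ 2 * q ^ 2 + 2 * (z ^ 2 - 1) * q ^ 2 + 4 * t * z * q ^ 3
      + t ^ 2 * q ^ 4))

/-- The potential is polynomial in the profiles, so the expansion in `t` is exact and no
differentiation under the integral is needed. -/
lemma pot_add (ε lam r y z p q t : ℝ) : pot ε lam r (y + t * p) (z + t * q)
    = pot ε lam r y z + t * (potY ε r y z * p + potZ lam r y z * q)
      + t ^ 2 * potR ε lam r y z p q t := by
  unfold pot potY potZ potR
  ring

lemma integrable_pot_of_energy_lt_top {ε lam : ℝ} (hε : 0 < ε) (hlam : 0 ≤ lam) {g k : ℝ → ℝ}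
    (hg : MemLp g 2 dr) (hk : MemLp k 2 dr) (hfin : energy ε lam g k < ⊤) :
    Integrable (fun r => pot ε lam r (gam g r) (hig k r)) dr := by
  rw [energy, S_gam_hig hε hlam hg hk] at hfin
  refine ⟨(aemeasurable_pot (aemeasurable_gam (integrable_of_memLp hg))
    (aemeasurable_hig (integrable_of_memLp hk))).aestronglyMeasurable, ?_⟩
  rw [hasFiniteIntegral_iff_ofReal (Filter.Eventually.of_forall fun r => pot_nonneg hε hlam _ _ _)]
  exact (le_add_self).trans_lt hfin

lemma energy_eq_ofReal {ε lam : ℝ} (hε : 0 < ε) (hlam : 0 ≤ lam) {g k : ℝ → ℝ}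
    (hg : MemLp g 2 dr) (hk : MemLp k 2 dr)
    (hp : Integrable (fun r => pot ε lam r (gam g r) (hig k r)) dr) :
    energy ε lam g k = ENNReal.ofReal (4 * Real.pi * (2 * ε * ∫ t, g t ^ 2 ∂dr + ∫ t, k t ^ 2 ∂dr)
      + ∫ r, pot ε lam r (gam g r) (hig k r) ∂dr) := by
  have hsq : ∀ f : ℝ → ℝ, 0 ≤ ∫ t, f t ^ 2 ∂dr := fun f => integral_nonneg fun t => sq_nonneg _
  rw [energy, S_gam_hig hε hlam hg hk, ENNReal.ofReal_add (by positivity)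
      (integral_nonneg fun r => pot_nonneg hε hlam _ _ _),
    ofReal_integral_eq_lintegral_ofReal hp
      (Filter.Eventually.of_forall fun r => pot_nonneg hε hlam _ _ _)]

/-- For `A ≠ 0` take `|t| = s` with the sign opposite to that of `A`. The choice of `s` makes `|C| s
< |A|`, so the linear term wins and the expression is negative. -/
lemma eq_zero_of_forall_quadratic {A C : ℝ} (h : ∀ t : ℝ, |t| ≤ 1 → 0 ≤ t * A + C * t ^ 2) :
    A = 0 := by
  by_contra hA
  have hA' : 0 < |A| := abs_pos.2 hA
  set s := |A| / (|A| + |C| + 1) with hs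
  have hden : 0 < |A| + |C| + 1 := by positivity
  have hs0 : 0 < s := by positivity
  have hs1 : s ≤ 1 := by rw [hs, div_le_one hden]; linarith [abs_nonneg C]
  have hsC : s * (|A| + |C| + 1) = |A| := by rw [hs]; field_simp
  have hCs : C * s ≤ |C| * s := mul_le_mul_of_nonneg_right (le_abs_self C) hs0.le
  rcases lt_or_gt_of_ne hA with h0 | h0
  · have := h s (by rw [abs_of_pos hs0]; exact hs1)
    rw [abs_of_neg h0] at *
    nlinarith
  · have := h (-s) (by rw [abs_neg, abs_of_pos hs0]; exact hs1)
    rw [abs_of_pos h0] at *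
    nlinarith

lemma gam_add_mul {g h : ℝ → ℝ} (hg : Integrable g dr) (hh : Integrable h dr) (t : ℝ) {r : ℝ}
    (hr : r ∈ Icc (0 : ℝ) 1) : gam (fun s => g s + t * h s) r = gam g r + t * gam h r := by
  rw [gam, intervalIntegral.integral_add (intervalIntegrable_of_integrable_dr hg (by simp) hr)
    ((intervalIntegrable_of_integrable_dr hh (by simp) hr).const_mul t),
    intervalIntegral.integral_const_mul, gam, gam]

lemma hig_add_mul {k l : ℝ → ℝ} (hk : Integrable k dr) (hl : Integrable l dr) (t : ℝ) {r : ℝ}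
    (hr : r ∈ Ioc (0 : ℝ) 1) :
    hig (fun s => k s + t * l s) r = hig k r + t * (hig l r - 1) := by
  have h1 : ∀ s, (k s + t * l s) / s = k s / s + t * (l s / s) := fun s => by ring
  simp only [hig, h1]
  rw [intervalIntegral.integral_add (intervalIntegrable_div hk hr (by simp))
    ((intervalIntegrable_div hl hr (by simp)).const_mul t), intervalIntegral.integral_const_mul]
  ring

lemma continuousOn_potY {ε : ℝ} {a : ℝ} (ha : 0 < a) {y z : ℝ → ℝ}
    (hy : ContinuousOn y (Icc a 1)) (hz : ContinuousOn z (Icc a 1)) :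
    ContinuousOn (fun r => potY ε r (y r) (z r)) (Icc a 1) := by
  have h0 : ∀ r ∈ Icc a 1, r ^ 2 ≠ 0 := fun r hr => (pow_pos (ha.trans_le hr.1) 2).ne'
  unfold potY
  fun_prop (disch := assumption)

lemma continuousOn_potZ {lam : ℝ} {a : ℝ} {y z : ℝ → ℝ}
    (hy : ContinuousOn y (Icc a 1)) (hz : ContinuousOn z (Icc a 1)) :
    ContinuousOn (fun r => potZ lam r (y r) (z r)) (Icc a 1) := by
  unfold potZ
  fun_prop

/-- The first variation of the reduced functional vanishes at minimizing velocities, for variations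
supported away from the origin. -/
lemma first_variation {ε lam : ℝ} (hε : 0 < ε) (hlam : 0 ≤ lam) {g k : ℝ → ℝ}
    (hv : Velocity g k) (hfin : energy ε lam g k < ⊤)
    (hmin : ∀ g' k', Velocity g' k' → energy ε lam g k ≤ energy ε lam g' k')
    {a : ℝ} (ha : a ∈ Ioo (0 : ℝ) 1) {h l : ℝ → ℝ} (hh : MemLp h 2 dr) (hl : MemLp l 2 dr)
    (hh1 : gam h 1 = 0) (hψ : ∀ r ∈ Ioo 0 a, gam h r = 0) (hχ : ∀ r ∈ Ioo 0 a, hig l r - 1 = 0) :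
    4 * Real.pi * (4 * ε * ∫ r, g r * h r ∂dr + 2 * ∫ r, k r * l r ∂dr)
      + ∫ r in a..1, (potY ε r (gam g r) (hig k r) * gam h r
        + potZ lam r (gam g r) (hig k r) * (hig l r - 1)) = 0 := by
  obtain ⟨hg, hk, hg1⟩ := hv
  have hgi := integrable_of_memLp hg
  have hki := integrable_of_memLp hk
  have hhi := integrable_of_memLp hh
  have hli := integrable_of_memLp hl
  set y := gam g
  set z := hig k
  set p := gam h
  -- `hig` is affine with constant part `1`, so the variation of the Higgs profile is `hig l - 1`.
  set q : ℝ → ℝ := fun r => hig l r - 1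
  have hsub : Icc a 1 ⊆ Icc (0 : ℝ) 1 := Icc_subset_Icc_left ha.1.le
  have hsub' : Icc a 1 ⊆ Ioc (0 : ℝ) 1 := fun r hr => ⟨ha.1.trans_le hr.1, hr.2⟩
  have hy : ContinuousOn y (Icc a 1) := (continuousOn_gam hgi).mono hsub
  have hz : ContinuousOn z (Icc a 1) := (continuousOn_hig hki).mono hsub'
  have hp : ContinuousOn p (Icc a 1) := (continuousOn_gam hhi).mono hsub
  have hq : ContinuousOn q (Icc a 1) := ((continuousOn_hig hli).mono hsub').sub continuousOn_const
  have h0 : ∀ r ∈ Icc a 1, r ^ 2 ≠ 0 := fun r hr => (pow_pos (ha.1.trans_le hr.1) 2).ne'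
  have hint := integrable_pot_of_energy_lt_top hε hlam hg hk hfin
  set Lf : ℝ → ℝ := fun r => potY ε r (y r) (z r) * p r + potZ lam r (y r) (z r) * q r with hLf
  have hLc : ContinuousOn Lf (Icc a 1) :=
    ((continuousOn_potY ha.1 hy hz).mul hp).add ((continuousOn_potZ hy hz).mul hq)
  have hRc : ContinuousOn (fun x : ℝ × ℝ =>
      potR ε lam x.1 (y x.1) (z x.1) (p x.1) (q x.1) x.2) (Icc a 1 ×ˢ Icc (-1) 1) := by
    have hm : MapsTo Prod.fst (Icc a 1 ×ˢ Icc (-1 : ℝ) 1) (Icc a 1) := fun x hx => hx.1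
    have hy' := hy.comp continuousOn_fst hm
    have hz' := hz.comp continuousOn_fst hm
    have hp' := hp.comp continuousOn_fst hm
    have hq' := hq.comp continuousOn_fst hm
    simp only [Function.comp_def] at hy' hz' hp' hq'
    have h0' : ∀ x ∈ Icc a 1 ×ˢ Icc (-1 : ℝ) 1, x.1 ^ 2 ≠ 0 := fun x hx => h0 _ hx.1
    unfold potR
    fun_prop (disch := assumption)
  -- Keeping the variation away from `0`, where `1/r²` is singular, makes the remainder continuous
  -- on a compact set and hence bounded uniformly in `t`.
  obtain ⟨C, hC⟩ := (isCompact_Icc.prod isCompact_Icc).exists_bound_of_continuousOn hRc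
  have hRt : ∀ t, |t| ≤ 1 → ContinuousOn (fun r => potR ε lam r (y r) (z r) (p r) (q r) t)
      (Icc a 1) := fun t ht =>
    hRc.comp (f := fun r => (r, t)) (by fun_prop) (fun r hr => ⟨hr, abs_le.1 ht⟩)
  -- the potential of the varied profiles
  have hvar : ∀ t, |t| ≤ 1 → Integrable (fun r => pot ε lam r (y r + t * p r) (z r + t * q r)) dr ∧
      ∫ r, pot ε lam r (y r + t * p r) (z r + t * q r) ∂dr ≤ ∫ r, pot ε lam r (y r) (z r) ∂dr
        + t * (∫ r in a..1, Lf r) + t ^ 2 * C := by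
    intro t ht
    set R : ℝ → ℝ := fun r => potR ε lam r (y r) (z r) (p r) (q r) t with hR
    have hdiff : IntegrableOn (fun r => t * Lf r + t ^ 2 * R r) (Icc a 1) :=
      ((continuousOn_const.mul hLc).add (continuousOn_const.mul (hRt t ht))).integrableOn_Icc
    have hDi : Integrable ((Ico a 1).indicator fun r => t * Lf r + t ^ 2 * R r) dr :=
      ((hdiff.mono_set Ico_subset_Icc_self).integrable_indicator measurableSet_Ico).mono_measure
        Measure.restrict_le_self
    have hpot : ∀ r ∈ Ioo (0 : ℝ) 1, pot ε lam r (y r + t * p r) (z r + t * q r)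
        = pot ε lam r (y r) (z r) + (Ico a 1).indicator (fun r => t * Lf r + t ^ 2 * R r) r := by
      intro r hr
      by_cases hra : a ≤ r
      · rw [indicator_of_mem (show r ∈ Ico a 1 from ⟨hra, hr.2⟩), pot_add]; ring
      · rw [indicator_of_notMem (fun h' => hra h'.1)]
        have h1 : p r = 0 := hψ r ⟨hr.1, not_le.1 hra⟩
        have h2 : q r = 0 := hχ r ⟨hr.1, not_le.1 hra⟩
        simp [h1, h2]
    have hae : (fun r => pot ε lam r (y r + t * p r) (z r + t * q r)) =ᵐ[dr]
        fun r => pot ε lam r (y r) (z r)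
          + (Ico a 1).indicator (fun r => t * Lf r + t ^ 2 * R r) r := by
      rw [Filter.EventuallyEq, ae_dr_iff]
      exact Filter.Eventually.of_forall hpot
    refine ⟨(hint.add hDi).congr hae.symm, ?_⟩
    rw [integral_congr_ae hae, integral_add hint hDi, add_assoc]
    refine add_le_add le_rfl ?_
    have hsubI : Ico a 1 ⊆ Ioo (0 : ℝ) 1 := fun r hr => ⟨ha.1.trans_le hr.1, hr.2⟩
    have e1 : ∫ r, (Ico a 1).indicator (fun r => t * Lf r + t ^ 2 * R r) r ∂dr
        = ∫ r in a..1, (t * Lf r + t ^ 2 * R r) := by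
      rw [integral_indicator measurableSet_Ico, dr, Measure.restrict_restrict measurableSet_Ico,
        inter_eq_left.2 hsubI, integral_Ico_eq_integral_Ioo,
        intervalIntegral.integral_of_le ha.2.le, integral_Ioc_eq_integral_Ioo]
    have hLi : IntervalIntegrable Lf volume a 1 :=
      hLc.intervalIntegrable_of_Icc ha.2.le
    have hRi : IntervalIntegrable R volume a 1 :=
      (hRt t ht).intervalIntegrable_of_Icc ha.2.le
    rw [e1, intervalIntegral.integral_add (hLi.const_mul _) (hRi.const_mul _),
      intervalIntegral.integral_const_mul, intervalIntegral.integral_const_mul]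
    refine add_le_add le_rfl (mul_le_mul_of_nonneg_left ?_ (sq_nonneg t))
    have hb : ‖∫ r in a..1, R r‖ ≤ C * |1 - a| :=
      intervalIntegral.norm_integral_le_of_norm_le_const fun r hr => by
        rw [uIoc_of_le ha.2.le] at hr
        exact hC (r, t) ⟨Ioc_subset_Icc_self hr, abs_le.1 ht⟩
    have hC0 : 0 ≤ C := (norm_nonneg _).trans
      (hC (1, 0) ⟨right_mem_Icc.2 ha.2.le, by norm_num, by norm_num⟩)
    have h1a : |1 - a| ≤ 1 := by rw [abs_of_pos (by linarith [ha.2])]; linarith [ha.1]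
    exact (le_abs_self _).trans (hb.trans (mul_le_of_le_one_right hC0 h1a))
  refine eq_zero_of_forall_quadratic
    (C := 4 * Real.pi * (2 * ε * ∫ r, h r ^ 2 ∂dr + ∫ r, l r ^ 2 ∂dr) + C) fun t ht => ?_
  obtain ⟨hvi, hvle⟩ := hvar t ht
  have hgt : MemLp (fun s => g s + t * h s) 2 dr := hg.add (hh.const_mul t)
  have hkt : MemLp (fun s => k s + t * l s) 2 dr := hk.add (hl.const_mul t)
  have hcongr : (fun r => pot ε lam r (y r + t * p r) (z r + t * q r)) =ᵐ[dr]
      fun r => pot ε lam r (gam (fun s => g s + t * h s) r) (hig (fun s => k s + t * l s) r) := by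
    rw [Filter.EventuallyEq, ae_dr_iff]
    refine Filter.Eventually.of_forall fun r hr => ?_
    rw [gam_add_mul hgi hhi t (Ioo_subset_Icc_self hr), hig_add_mul hki hli t
      (Ioo_subset_Ioc_self hr)]
  have hvel : Velocity (fun s => g s + t * h s) (fun s => k s + t * l s) :=
    ⟨hgt, hkt, by
      rw [gam_add_mul hgi hhi t (by simp), show gam h 1 = 0 from hh1,
        show gam g 1 = _ from hg1]; ring⟩
  have hle := hmin _ _ hvel
  have hsq : ∀ f : ℝ → ℝ, 0 ≤ ∫ t, f t ^ 2 ∂dr := fun f => integral_nonneg fun t => sq_nonneg _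
  rw [energy_eq_ofReal hε hlam hg hk hint, energy_eq_ofReal hε hlam hgt hkt (hvi.congr hcongr),
    ENNReal.ofReal_le_ofReal_iff, ← integral_congr_ae hcongr] at hle
  · have hexp : ∀ u v : ℝ → ℝ, MemLp u 2 dr → MemLp v 2 dr → ∫ s, (u s + t * v s) ^ 2 ∂dr
        = ∫ s, u s ^ 2 ∂dr + 2 * t * ∫ s, u s * v s ∂dr + t ^ 2 * ∫ s, v s ^ 2 ∂dr := by
      intro u v hu hv
      have huv : Integrable (fun s => u s * v s) dr := hu.integrable_mul hv
      have hd : Integrable (fun s => u s ^ 2 + 2 * t * (u s * v s)) dr :=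
        hu.integrable_sq.add (huv.const_mul _)
      rw [← integral_const_mul, ← integral_const_mul, ← integral_add hu.integrable_sq
        (huv.const_mul _), ← integral_add hd (hv.integrable_sq.const_mul _)]
      refine integral_congr_ae (Filter.Eventually.of_forall fun s => ?_)
      simp only; ring
    rw [hexp g h hg hh, hexp k l hk hl] at hle
    linarith
  · have h1 := hsq (fun s => g s + t * h s)
    have h2 := hsq (fun s => k s + t * l s)
    exact add_nonneg (by positivity) (integral_nonneg fun r => pot_nonneg hε hlam _ _ _)

/-! ### From the first variation to the Euler-Lagrange equations -/

/-- **Du Bois-Reymond lemma**, for velocities: if `∫ p h + ∫ W ∫ h = 0` for all `h` of mean zero,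
then `p` is a primitive of `W`. -/
lemma exists_eq_const_add_primitive {a : ℝ} (ha : a ∈ Ioo (0 : ℝ) 1) {p W : ℝ → ℝ}
    (hp : MemLp p 2 dr) (hW : ContinuousOn W (Icc a 1))
    (h : ∀ h : ℝ → ℝ, MemLp h 2 dr → (∀ r ∉ Ioo a 1, h r = 0) → ∫ r in a..1, h r = 0 →
      (∫ r in a..1, p r * h r) + ∫ r in a..1, W r * ∫ s in a..r, h s = 0) :
    ∃ c, ∀ᵐ r, r ∈ Ioo a 1 → p r = c - ∫ s in r..1, W s := by
  -- Extending `W` continuously to the line makes its primitive `η` a `C¹` function on `ℝ`, as the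
  -- integration by parts requires.
  set V : ℝ → ℝ := IccExtend ha.2.le ((Icc a 1).domRestrict W) with hV
  have hVc : Continuous V := (continuousOn_iff_continuous_domRestrict.1 hW).Icc_extend'
  have hVW : ∀ r ∈ Icc a 1, V r = W r := fun r hr => IccExtend_of_mem _ _ hr
  set η : ℝ → ℝ := fun r => ∫ s in (1 : ℝ)..r, V s with hη
  have hηd : ∀ r, HasDerivAt η (V r) r := fun r =>
    intervalIntegral.integral_hasDerivAt_right (hVc.intervalIntegrable _ _)
      (hVc.stronglyMeasurableAtFilter _ _) hVc.continuousAt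
  have hηderiv : deriv η = V := funext fun r => (hηd r).deriv
  have hη1 : ContDiff ℝ 1 η := by
    rw [contDiff_one_iff_deriv, hηderiv]
    exact ⟨fun r => (hηd r).differentiableAt, hVc⟩
  have hηc := hη1.continuous
  have hsub : Ioo a 1 ⊆ Ioo (0 : ℝ) 1 := Ioo_subset_Ioo_left ha.1.le
  have hηm : MemLp η 2 dr := by
    obtain ⟨C, hC⟩ := (isCompact_Icc (a := (0 : ℝ)) (b := 1)).exists_bound_of_continuousOn
      hηc.continuousOn
    refine MemLp.of_bound hηc.aestronglyMeasurable C ?_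
    rw [ae_dr_iff]
    exact Filter.Eventually.of_forall fun r hr => hC r (Ioo_subset_Icc_self hr)
  set f : ℝ → ℝ := fun r => p r - η r with hf
  have hfm : MemLp f 2 dr := hp.sub hηm
  have hii : ∀ u : ℝ → ℝ, Integrable u dr → IntervalIntegrable u volume a 1 := fun u hu =>
    intervalIntegrable_of_integrable_dr hu (Ioo_subset_Icc_self ha) (by simp)
  set m := (∫ r in a..1, f r) / (1 - a) with hm
  have h1a : (1 - a) ≠ 0 := by linarith [ha.2]
  -- The test function is the deviation of `f = p - η` from its mean; testing with it yields `∫ (f -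
  -- m)² = 0`.
  set w : ℝ → ℝ := (Ioo a 1).indicator fun r => f r - m with hw
  have hwm : MemLp w 2 dr := (hfm.sub (memLp_const m)).indicator measurableSet_Ioo
  have hw0 : ∀ r ∉ Ioo a 1, w r = 0 := fun r hr => indicator_of_notMem hr _
  have hwi : ∀ u : ℝ → ℝ, ∫ r in a..1, u r * w r = ∫ r in a..1, u r * (f r - m) := by
    intro u
    rw [intervalIntegral.integral_of_le ha.2.le, intervalIntegral.integral_of_le ha.2.le,
      integral_Ioc_eq_integral_Ioo, integral_Ioc_eq_integral_Ioo]
    refine setIntegral_congr_fun measurableSet_Ioo fun r hr => ?_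
    simp only [hw, indicator_of_mem hr]
  have hw1 : ∫ r in a..1, w r = 0 := by
    have := hwi fun _ => 1
    simp only [one_mul] at this
    rw [this, intervalIntegral.integral_sub (hii f (integrable_of_memLp hfm)) (by simp),
      intervalIntegral.integral_const, hm, smul_eq_mul]
    field_simp; ring
  have key := h w hwm hw0 hw1
  have hparts := integral_primitive_mul_deriv (f := fun r => ∫ s in a..r, w s) (g := w) (η := η)
    ha.2.le (hii w (integrable_of_memLp hwm)) (fun r _ => by simp) hη1
  have e1 : ∫ r in a..1, W r * ∫ s in a..r, w s = ∫ r in a..1, (∫ s in a..r, w s) * deriv η r := by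
    refine intervalIntegral.integral_congr fun r hr => ?_
    rw [uIcc_of_le ha.2.le] at hr
    simp only [hηderiv, hVW r hr]; ring
  rw [e1, hparts, hw1] at key
  simp only [intervalIntegral.integral_same, zero_mul, sub_zero, zero_sub] at key
  have hpw : IntervalIntegrable (fun r => p r * w r) volume a 1 := hii _ (hp.integrable_mul hwm)
  have hηw : IntervalIntegrable (fun r => w r * η r) volume a 1 := hii _ (hwm.integrable_mul hηm)
  have e2 : ∫ r in a..1, f r * w r = 0 := by
    rw [← sub_eq_add_neg, ← intervalIntegral.integral_sub hpw hηw] at key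
    rw [← key]
    refine intervalIntegral.integral_congr fun r _ => ?_
    simp only [hf]; ring
  have hfw : IntervalIntegrable (fun r => f r * w r) volume a 1 := hii _ (hfm.integrable_mul hwm)
  have e3 : ∫ r in a..1, (f r - m) ^ 2 = 0 := by
    have h1 : ∫ r in a..1, (f r - m) ^ 2 = ∫ r in a..1, (f r - m) * w r := by
      rw [hwi fun r => f r - m]; simp only [sq]
    have h2 : ∫ r in a..1, (f r - m) * w r = (∫ r in a..1, f r * w r) - m * ∫ r in a..1, w r := by
      rw [← intervalIntegral.integral_const_mul, ← intervalIntegral.integral_sub hfw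
        ((hii w (integrable_of_memLp hwm)).const_mul m)]
      refine intervalIntegral.integral_congr fun r _ => ?_
      ring
    rw [h1, h2, e2, hw1]; ring
  have hsqi : IntegrableOn (fun r => (f r - m) ^ 2) (Ioo a 1) := by
    have := ((hfm.sub (memLp_const m)).integrable_sq)
    exact IntegrableOn.mono_set (s := Ioo a 1) this hsub
  rw [intervalIntegral.integral_of_le ha.2.le, integral_Ioc_eq_integral_Ioo,
    setIntegral_eq_zero_iff_of_nonneg_ae (Filter.Eventually.of_forall fun r => sq_nonneg _) hsqi,
    Filter.EventuallyEq, ae_restrict_iff' measurableSet_Ioo] at e3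
  refine ⟨m, ?_⟩
  filter_upwards [e3] with r hr hr'
  have h3 := pow_eq_zero_iff two_ne_zero |>.1 (hr hr')
  have h4 : η r = -∫ s in r..1, W s := by
    rw [hη]; simp only
    rw [intervalIntegral.integral_symm]
    congr 1
    refine intervalIntegral.integral_congr fun s hs => ?_
    rw [uIcc_of_le hr'.2.le] at hs
    exact hVW s ⟨hr'.1.le.trans hs.1, hs.2⟩
  simp only [hf, h4] at h3
  linarith

lemma gam_of_support {a : ℝ} (ha : a ∈ Ioo (0 : ℝ) 1) {h : ℝ → ℝ} (hh : Integrable h dr)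
    (h0 : ∀ r ∉ Ioo a 1, h r = 0) :
    (∀ r ∈ Ioc 0 a, gam h r = 0) ∧ ∀ r ∈ Icc a 1, gam h r = ∫ s in a..r, h s := by
  have h1 : ∀ r ∈ Ioc 0 a, gam h r = 0 := by
    intro r hr
    refine intervalIntegral.integral_zero_ae (Filter.Eventually.of_forall fun s hs => ?_)
    rw [uIoc_of_le hr.1.le] at hs
    exact h0 s fun h' => by linarith [h'.1, hs.2, hr.2]
  refine ⟨h1, fun r hr => ?_⟩
  rw [gam_sub hh (Ioo_subset_Icc_self ha) ⟨ha.1.le.trans hr.1, hr.2⟩, h1 a ⟨ha.1, le_rfl⟩, zero_add]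

lemma integral_dr_of_support {a : ℝ} (ha : a ∈ Ioo (0 : ℝ) 1) {h : ℝ → ℝ} (u : ℝ → ℝ)
    (h0 : ∀ r ∉ Ioo a 1, h r = 0) : ∫ r, u r * h r ∂dr = ∫ r in a..1, u r * h r := by
  rw [intervalIntegral.integral_of_le ha.2.le, integral_Ioc_eq_integral_Ioo, dr]
  exact setIntegral_eq_of_subset_of_forall_sdiff_eq_zero measurableSet_Ioo
    (Ioo_subset_Ioo_left ha.1.le) (fun x hx => by rw [h0 x hx.2, mul_zero])

section EulerLagrange

variable {ε lam : ℝ} {g k : ℝ → ℝ}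

/-- Only `γ` is varied. A mean-zero `h` supported in `(a, 1)` has a primitive vanishing on `(0, a]`
and at `1`, so it is an allowed variation. The constant depends on `a` but disappears on
differentiation. -/
lemma exists_velocity_eq (hε : 0 < ε) (hlam : 0 ≤ lam)
    (hv : Velocity g k) (hfin : energy ε lam g k < ⊤)
    (hmin : ∀ g' k', Velocity g' k' → energy ε lam g k ≤ energy ε lam g' k')
    {a : ℝ} (ha : a ∈ Ioo (0 : ℝ) 1) :
    ∃ c, ∀ᵐ r, r ∈ Ioo a 1 → 16 * Real.pi * ε * g r
      = c - ∫ s in r..1, potY ε s (gam g s) (hig k s) := by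
  have hsub : Icc a 1 ⊆ Icc (0 : ℝ) 1 := Icc_subset_Icc_left ha.1.le
  have hsub' : Icc a 1 ⊆ Ioc (0 : ℝ) 1 := fun r hr => ⟨ha.1.trans_le hr.1, hr.2⟩
  refine exists_eq_const_add_primitive ha (hv.1.const_mul _)
    (continuousOn_potY ha.1 ((continuousOn_gam (integrable_of_memLp hv.1)).mono hsub)
      ((continuousOn_hig (integrable_of_memLp hv.2.1)).mono hsub')) fun h hh h0 h1 => ?_
  obtain ⟨hg0, hg1⟩ := gam_of_support ha (integrable_of_memLp hh) h0
  have hz : ∀ r, hig (fun _ => 0) r - 1 = 0 := fun r => by simp [hig]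
  have key := first_variation hε hlam hv hfin hmin ha hh (l := fun _ => 0) (memLp_const 0)
    (by rw [hg1 1 (right_mem_Icc.2 ha.2.le), h1]) (fun r hr => hg0 r ⟨hr.1, hr.2.le⟩)
    (fun r _ => hz r)
  simp only [hz, mul_zero, add_zero, integral_zero] at key
  rw [integral_dr_of_support ha g h0] at key
  have e1 : ∫ r in a..1, potY ε r (gam g r) (hig k r) * gam h r
      = ∫ r in a..1, potY ε r (gam g r) (hig k r) * ∫ s in a..r, h s := by
    refine intervalIntegral.integral_congr fun r hr => ?_
    rw [uIcc_of_le ha.2.le] at hr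
    simp only [hg1 r hr]
  have e2 : ∫ r in a..1, 16 * Real.pi * ε * g r * h r
      = 16 * Real.pi * ε * ∫ r in a..1, g r * h r := by
    rw [← intervalIntegral.integral_const_mul]; simp only [mul_assoc]
  rw [e2, ← e1, ← key]
  ring

/-- Only `φ` is varied, with velocity `l = r h`: for `h` of mean zero the variation `hig l - 1 =
-∫ᵣ¹ h` coincides with `gam h`, which again vanishes near the origin. -/
lemma exists_higgs_velocity_eq (hε : 0 < ε) (hlam : 0 ≤ lam)
    (hv : Velocity g k) (hfin : energy ε lam g k < ⊤)
    (hmin : ∀ g' k', Velocity g' k' → energy ε lam g k ≤ energy ε lam g' k')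
    {a : ℝ} (ha : a ∈ Ioo (0 : ℝ) 1) :
    ∃ c, ∀ᵐ r, r ∈ Ioo a 1 → 8 * Real.pi * (r * k r)
      = c - ∫ s in r..1, potZ lam s (gam g s) (hig k s) := by
  have hsub : Icc a 1 ⊆ Icc (0 : ℝ) 1 := Icc_subset_Icc_left ha.1.le
  have hsub' : Icc a 1 ⊆ Ioc (0 : ℝ) 1 := fun r hr => ⟨ha.1.trans_le hr.1, hr.2⟩
  have hmul : ∀ u : ℝ → ℝ, MemLp u 2 dr → MemLp (fun r => r * u r) 2 dr := by
    intro u hu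
    refine hu.of_le_mul (c := 1) (measurable_id.aestronglyMeasurable.mul hu.1) ?_
    rw [ae_dr_iff]
    refine Filter.Eventually.of_forall fun r hr => ?_
    rw [norm_mul]
    refine mul_le_mul_of_nonneg_right ?_ (norm_nonneg _)
    rw [Real.norm_eq_abs, abs_of_pos hr.1]; exact hr.2.le
  refine exists_eq_const_add_primitive ha ((hmul k hv.2.1).const_mul _)
    (continuousOn_potZ ((continuousOn_gam (integrable_of_memLp hv.1)).mono hsub)
      ((continuousOn_hig (integrable_of_memLp hv.2.1)).mono hsub')) fun h hh h0 h1 => ?_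
  have hi := integrable_of_memLp hh
  obtain ⟨hg0, hg1⟩ := gam_of_support ha hi h0
  have hgz : gam h 1 = 0 := by rw [hg1 1 (right_mem_Icc.2 ha.2.le), h1]
  have hχ : ∀ r ∈ Ioc (0 : ℝ) 1, hig (fun s => s * h s) r - 1 = gam h r := by
    intro r hr
    have e1 : ∫ t in r..1, t * h t / t = ∫ t in r..1, h t := by
      refine intervalIntegral.integral_congr fun t ht => ?_
      rw [uIcc_of_le hr.2] at ht
      have := (hr.1.trans_le ht.1).ne'
      field_simp
    have e2 := gam_sub hi (Ioc_subset_Icc_self hr) (b := 1) (by simp)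
    rw [hig, e1]
    linarith
  have h0gam : ∀ r, gam (fun _ => 0) r = 0 := fun r => by simp [gam]
  have key := first_variation hε hlam hv hfin hmin ha (h := fun _ => 0) (memLp_const 0)
    (hmul h hh) (h0gam 1) (fun r _ => h0gam r)
    (fun r hr => by
      rw [hχ r ⟨hr.1, by linarith [hr.2, ha.2]⟩]; exact hg0 r ⟨hr.1, hr.2.le⟩)
  simp only [h0gam, mul_zero, zero_add, integral_zero] at key
  have e1 : ∫ r in a..1, potZ lam r (gam g r) (hig k r) * (hig (fun s => s * h s) r - 1)
      = ∫ r in a..1, potZ lam r (gam g r) (hig k r) * ∫ s in a..r, h s := by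
    refine intervalIntegral.integral_congr fun r hr => ?_
    rw [uIcc_of_le ha.2.le] at hr
    simp only [hχ r (hsub' hr), hg1 r hr]
  have e2 : ∫ r in a..1, 8 * Real.pi * (r * k r) * h r
      = 8 * Real.pi * ∫ r in a..1, k r * (r * h r) := by
    rw [← intervalIntegral.integral_const_mul]
    refine intervalIntegral.integral_congr fun r _ => ?_
    ring
  have e3 : ∫ r, k r * (r * h r) ∂dr = ∫ r in a..1, k r * (r * h r) :=
    integral_dr_of_support ha k (h := fun r => r * h r) fun r hr => by rw [h0 r hr, mul_zero]
  rw [e3] at key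
  rw [e2, ← e1, ← key]
  ring

/-- A function with an almost everywhere continuous weak derivative is differentiable. -/
lemma hasDerivAt_of_ae_eq {y v V : ℝ → ℝ} {a : ℝ} (ha : a < 1)
    (hy : ∀ r ∈ Icc a 1, y r = y a + ∫ s in a..r, v s) (hV : ContinuousOn V (Ioo a 1))
    (hae : ∀ᵐ r, r ∈ Ioo a 1 → v r = V r) (hvi : IntervalIntegrable v volume a 1) {r : ℝ}
    (hr : r ∈ Ioo a 1) : HasDerivAt y (V r) r := by
  have h1 : ∀ x ∈ Ioo a 1, y x = y r + ∫ s in r..x, V s := by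
    intro x hx
    have hsub : ∀ u ∈ Ioo a 1, IntervalIntegrable v volume a u := fun u hu =>
      hvi.mono_set (by rw [uIcc_of_le hu.1.le, uIcc_of_le ha.le]; exact Icc_subset_Icc_right hu.2.le)
    have e1 := intervalIntegral.integral_interval_sub_left (hsub x hx) (hsub r hr)
    rw [hy x (Ioo_subset_Icc_self hx), hy r (Ioo_subset_Icc_self hr)]
    have e2 : ∫ s in r..x, v s = ∫ s in r..x, V s := by
      refine intervalIntegral.integral_congr_ae ?_
      filter_upwards [hae] with s hs hs'
      exact hs ((ordConnected_Ioo.uIcc_subset hr hx) (uIoc_subset_uIcc hs'))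
    linarith
  have h2 : HasDerivAt (fun x => y r + ∫ s in r..x, V s) (V r) r := by
    refine HasDerivAt.const_add _ (intervalIntegral.integral_hasDerivAt_right (by simp) ?_
      (hV.continuousAt (isOpen_Ioo.mem_nhds hr)))
    exact hV.stronglyMeasurableAtFilter isOpen_Ioo r hr
  refine h2.congr_of_eventuallyEq ?_
  filter_upwards [isOpen_Ioo.mem_nhds hr] with x hx using h1 x hx

lemma hasDerivAt_primitive_sub {W : ℝ → ℝ} (hW : ContinuousOn W (Ioc 0 1)) (c : ℝ) {r : ℝ}
    (hr : r ∈ Ioo (0 : ℝ) 1) : HasDerivAt (fun x => c - ∫ s in x..1, W s) (W r) r := by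
  have hi : IntervalIntegrable W volume r 1 :=
    (hW.mono fun s hs => ⟨hr.1.trans_le hs.1, hs.2⟩).intervalIntegrable_of_Icc hr.2.le
  have hW' : ContinuousOn W (Ioo 0 1) := hW.mono Ioo_subset_Ioc_self
  have := (intervalIntegral.integral_hasDerivAt_left hi
    (hW'.stronglyMeasurableAtFilter isOpen_Ioo r hr)
    (hW'.continuousAt (isOpen_Ioo.mem_nhds hr))).const_sub c
  simpa using this

lemma continuousOn_Ioc_comp {P : ℝ → ℝ} (h : ∀ a, 0 < a → ContinuousOn P (Icc a 1)) :
    ContinuousOn P (Ioc 0 1) :=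
  continuousOn_Ioc_of_Icc fun a ha => h a ha.1

/-- The Euler-Lagrange equation for the gauge profile. -/
lemma euler_lagrange_gam (hε : 0 < ε) (hlam : 0 ≤ lam)
    (hv : Velocity g k) (hfin : energy ε lam g k < ⊤)
    (hmin : ∀ g' k', Velocity g' k' → energy ε lam g k ≤ energy ε lam g' k')
    {r : ℝ} (hr : r ∈ Ioo (0 : ℝ) 1) :
    DifferentiableAt ℝ (gam g) r ∧ HasDerivAt (deriv (gam g))
      ((2 * gam g r + 1) * (2 / r ^ 2 * (gam g r ^ 2 + gam g r) + 2 / ε * hig k r ^ 2)) r := by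
  have hgi := integrable_of_memLp hv.1
  have hki := integrable_of_memLp hv.2.1
  have ha : r / 2 ∈ Ioo (0 : ℝ) 1 := ⟨by linarith [hr.1], by linarith [hr.1, hr.2]⟩
  obtain ⟨c, hc⟩ := exists_velocity_eq hε hlam hv hfin hmin ha
  have hWc : ContinuousOn (fun s => potY ε s (gam g s) (hig k s)) (Ioc 0 1) :=
    continuousOn_Ioc_comp fun a ha => continuousOn_potY ha
      ((continuousOn_gam hgi).mono (Icc_subset_Icc_left ha.le))
      ((continuousOn_hig hki).mono fun s hs => ⟨ha.trans_le hs.1, hs.2⟩)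
  -- `D` is the continuous representative of `g`; differentiating it gives the second-order
  -- equation.
  set D : ℝ → ℝ := fun x =>
    (c - ∫ s in x..1, potY ε s (gam g s) (hig k s)) / (16 * Real.pi * ε) with hD
  have hDd : ∀ x ∈ Ioo (0 : ℝ) 1, HasDerivAt D
      (potY ε x (gam g x) (hig k x) / (16 * Real.pi * ε)) x := fun x hx =>
    (hasDerivAt_primitive_sub hWc c hx).div_const _
  have hy : ∀ x ∈ Ioo (r / 2) 1, HasDerivAt (gam g) (D x) x := fun x hx =>
    hasDerivAt_of_ae_eq ha.2
      (fun s hs => gam_sub hgi (Ioo_subset_Icc_self ha) ⟨ha.1.le.trans hs.1, hs.2⟩)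
      (fun s hs => (hDd s ⟨ha.1.trans hs.1, hs.2⟩).continuousAt.continuousWithinAt)
      (by
        filter_upwards [hc] with s hs hs'
        rw [hD]; simp only; rw [← hs hs']; field_simp)
      (intervalIntegrable_of_integrable_dr hgi (Ioo_subset_Icc_self ha) (by simp)) hx
  have hr' : r ∈ Ioo (r / 2) 1 := ⟨by linarith [hr.1], hr.2⟩
  refine ⟨(hy r hr').differentiableAt, ?_⟩
  have hev : deriv (gam g) =ᶠ[nhds r] D := by
    filter_upwards [isOpen_Ioo.mem_nhds hr'] with x hx using (hy x hx).deriv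
  refine ((hDd r hr).congr_of_eventuallyEq hev).congr_deriv ?_
  unfold potY
  field_simp
  ring

/-- The Euler-Lagrange equation for the Higgs profile. -/
lemma euler_lagrange_hig (hε : 0 < ε) (hlam : 0 ≤ lam)
    (hv : Velocity g k) (hfin : energy ε lam g k < ⊤)
    (hmin : ∀ g' k', Velocity g' k' → energy ε lam g k ≤ energy ε lam g' k')
    {r : ℝ} (hr : r ∈ Ioo (0 : ℝ) 1) :
    DifferentiableAt ℝ (hig k) r ∧ HasDerivAt (fun x => x ^ 2 * deriv (hig k) x)
      (2 * hig k r * (2 * gam g r + 1) ^ 2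
        + lam / 2 * r ^ 2 * hig k r * (hig k r ^ 2 - 1)) r := by
  have hgi := integrable_of_memLp hv.1
  have hki := integrable_of_memLp hv.2.1
  have ha : r / 2 ∈ Ioo (0 : ℝ) 1 := ⟨by linarith [hr.1], by linarith [hr.1, hr.2]⟩
  obtain ⟨c, hc⟩ := exists_higgs_velocity_eq hε hlam hv hfin hmin ha
  have hWc : ContinuousOn (fun s => potZ lam s (gam g s) (hig k s)) (Ioc 0 1) :=
    continuousOn_Ioc_comp fun a ha => continuousOn_potZ
      ((continuousOn_gam hgi).mono (Icc_subset_Icc_left ha.le))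
      ((continuousOn_hig hki).mono fun s hs => ⟨ha.trans_le hs.1, hs.2⟩)
  set D : ℝ → ℝ := fun x =>
    (c - ∫ s in x..1, potZ lam s (gam g s) (hig k s)) / (8 * Real.pi) with hD
  have hDd : ∀ x ∈ Ioo (0 : ℝ) 1, HasDerivAt D
      (potZ lam x (gam g x) (hig k x) / (8 * Real.pi)) x := fun x hx =>
    (hasDerivAt_primitive_sub hWc c hx).div_const _
  have hy : ∀ x ∈ Ioo (r / 2) 1, HasDerivAt (hig k) (D x / x ^ 2) x := fun x hx =>
    hasDerivAt_of_ae_eq (V := fun x => D x / x ^ 2) ha.2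
      (fun s hs => hig_sub hki (Ioo_subset_Ioc_self ha) ⟨ha.1.trans_le hs.1, hs.2⟩)
      (fun s hs => ((hDd s ⟨ha.1.trans hs.1, hs.2⟩).continuousAt.div
        (continuous_pow 2).continuousAt (pow_pos (ha.1.trans hs.1) 2).ne').continuousWithinAt)
      (by
        filter_upwards [hc] with s hs hs'
        have hpi := Real.pi_ne_zero
        rw [hD]; simp only; rw [← hs hs']; field_simp)
      (intervalIntegrable_div hki (Ioo_subset_Ioc_self ha) (by simp)) hx
  have hr' : r ∈ Ioo (r / 2) 1 := ⟨by linarith [hr.1], hr.2⟩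
  refine ⟨(hy r hr').differentiableAt, ?_⟩
  have hev : (fun x => x ^ 2 * deriv (hig k) x) =ᶠ[nhds r] D := by
    filter_upwards [isOpen_Ioo.mem_nhds hr'] with x hx
    have hx0 := (ha.1.trans hx.1).ne'
    rw [(hy x hx).deriv]; field_simp
  refine ((hDd r hr).congr_of_eventuallyEq hev).congr_deriv ?_
  have hpi := Real.pi_ne_zero
  unfold potZ
  field_simp
  ring

end EulerLagrange

/-! ### Behaviour at the origin: excluding the singular solution and bootstrapping -/

/-- Growth of a function on `(0, 1]` whose derivative is bounded by a power. -/
lemma abs_sub_le_of_deriv_le_rpow {f f₁ : ℝ → ℝ} {C e : ℝ} (he : e ≠ 0)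
    (hf : ContinuousOn f (Ioc 0 1)) (hd : ∀ r ∈ Ioo (0 : ℝ) 1, HasDerivAt f (f₁ r) r)
    (hb : ∀ r ∈ Ioo (0 : ℝ) 1, |f₁ r| ≤ C * r ^ (e - 1)) {r : ℝ} (hr : r ∈ Ioc (0 : ℝ) 1) :
    |f r - f 1| ≤ C / e * (1 - r ^ e) := by
  have hpow : ∀ x ∈ Ioo (0 : ℝ) 1, HasDerivAt (fun x => C / e * x ^ e) (C * x ^ (e - 1)) x := by
    intro x hx
    refine ((Real.hasDerivAt_rpow_const (Or.inl hx.1.ne')).const_mul (C / e)).congr_deriv ?_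
    field_simp
  have hpc : ContinuousOn (fun x : ℝ => C / e * x ^ e) (Ioc 0 1) :=
    continuousOn_const.mul (continuousOn_id.rpow_const fun x hx => Or.inl hx.1.ne')
  have hint : interior (Ioc (0 : ℝ) 1) = Ioo 0 1 := interior_Ioc
  -- Both `f` and `-f` become monotone after adding `(C/e) x^e`; this is valid for negative `e` as
  -- well.
  have mono : ∀ σ : ℝ, σ = 1 ∨ σ = -1 →
      MonotoneOn (fun x => σ * f x + C / e * x ^ e) (Ioc 0 1) := by
    intro σ hσ
    have hder : ∀ x ∈ Ioo (0 : ℝ) 1, HasDerivAt (fun x => σ * f x + C / e * x ^ e)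
        (σ * f₁ x + C * x ^ (e - 1)) x := fun x hx => ((hd x hx).const_mul σ).add (hpow x hx)
    refine monotoneOn_of_deriv_nonneg (convex_Ioc 0 1) ((continuousOn_const.mul hf).add hpc) ?_ ?_
    · rw [hint]; exact fun x hx => (hder x hx).differentiableAt.differentiableWithinAt
    · rw [hint]; intro x hx
      rw [(hder x hx).deriv]
      have := abs_le.1 (hb x hx)
      rcases hσ with rfl | rfl <;> linarith [this.1, this.2]
  have h1 : (1 : ℝ) ∈ Ioc (0 : ℝ) 1 := by simp
  have m1 := mono 1 (Or.inl rfl) hr h1 hr.2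
  have m2 := mono (-1) (Or.inr rfl) hr h1 hr.2
  simp only [Real.one_rpow] at m1 m2
  rw [abs_le]
  constructor <;> linarith

/-- A power of growth at most two is incompatible with a delta source at the origin. -/
lemma singular_flux_eq {f f₁ q : ℝ → ℝ} {C M c : ℝ} (hc : 0 ≤ c)
    (hf : ContinuousOn f (Ioc 0 1)) (hd : ∀ r ∈ Ioo (0 : ℝ) 1, HasDerivAt f (f₁ r) r)
    (hq : ContinuousOn q (Ioo 0 1))
    (hflux : ∀ r ∈ Ioo (0 : ℝ) 1, HasDerivAt (fun r => r ^ 4 * f₁ r) (q r) r)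
    (hqb : ∀ r ∈ Ioo (0 : ℝ) 1, |q r| ≤ C * r ^ c)
    (hM : ∀ r ∈ Ioo (0 : ℝ) 1, r ^ 2 * |f r| ≤ M) :
    ∀ r ∈ Ioo (0 : ℝ) 1, r ^ 4 * f₁ r = ∫ s in (0 : ℝ)..r, q s ∧ |f₁ r| ≤ C * r ^ (c - 3) := by
  have hC : 0 ≤ C := by
    have h := (abs_nonneg _).trans (hqb (1 / 2) (by constructor <;> norm_num))
    exact nonneg_of_mul_nonneg_left h (by positivity)
  have hqi : Integrable q dr := by
    refine Integrable.of_bound (hq.aestronglyMeasurable measurableSet_Ioo) C ?_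
    rw [ae_dr_iff]
    refine Filter.Eventually.of_forall fun r hr => (hqb r hr).trans ?_
    exact mul_le_of_le_one_right hC (Real.rpow_le_one hr.1.le hr.2.le hc)
  have hii : ∀ r ∈ Ioo (0 : ℝ) 1, IntervalIntegrable q volume 0 r := fun r hr =>
    intervalIntegrable_of_integrable_dr hqi (by simp) (Ioo_subset_Icc_self hr)
  have hmd : ∀ r ∈ Ioo (0 : ℝ) 1, HasDerivAt (gam q) (q r) r := fun r hr =>
    intervalIntegral.integral_hasDerivAt_right (hii r hr)
      (hq.stronglyMeasurableAtFilter isOpen_Ioo r hr) (hq.continuousAt (isOpen_Ioo.mem_nhds hr))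
  have hmb : ∀ r ∈ Ioo (0 : ℝ) 1, |gam q r| ≤ C * r ^ (c + 1) := by
    intro r hr
    have h1 : ‖∫ s in (0 : ℝ)..r, q s‖ ≤ C * r ^ c * |r - 0| := by
      refine intervalIntegral.norm_integral_le_of_norm_le_const fun s hs => ?_
      rw [uIoc_of_le hr.1.le] at hs
      refine (hqb s ⟨hs.1, hs.2.trans_lt hr.2⟩).trans ?_
      exact mul_le_mul_of_nonneg_left (Real.rpow_le_rpow hs.1.le hs.2 hc) hC
    rw [sub_zero, abs_of_pos hr.1] at h1
    rw [Real.rpow_add_one hr.1.ne', ← mul_assoc]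
    exact h1
  -- the flux is determined up to a constant
  obtain ⟨L, hL⟩ : ∃ L, ∀ r ∈ Ioo (0 : ℝ) 1, r ^ 4 * f₁ r - gam q r = L := by
    have hder : ∀ r ∈ Ioo (0 : ℝ) 1, HasDerivAt (fun r => r ^ 4 * f₁ r - gam q r) 0 r :=
      fun r hr => ((hflux r hr).sub (hmd r hr)).congr_deriv (sub_self _)
    obtain ⟨L, hL⟩ := isOpen_Ioo.exists_is_const_of_deriv_eq_zero isPreconnected_Ioo
      (fun r hr => (hder r hr).differentiableAt.differentiableWithinAt)
      (fun r hr => (hder r hr).deriv)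
    exact ⟨L, hL⟩
  have hpow4 : ∀ r : ℝ, 0 < r → r ^ (c - 3) = r ^ (c + 1) / r ^ 4 := fun r hr => by
    rw [show c - 3 = c + 1 - (4 : ℕ) by push_cast; ring, Real.rpow_sub_natCast hr.ne']
  -- the constant vanishes
  have hL0 : L = 0 := by
    -- From `f' = (L + ∫₀ʳ q)/r⁴`, the function `f₂` is `f` with its `-(L/3) r⁻³` part removed. It
    -- is `O(r⁻²)`, and so is `f` by `hM`; hence `L r⁻³ = O(r⁻²)`, which forces `L = 0`.
    set f₂ : ℝ → ℝ := fun r => f r + L / 3 * (r ^ 3)⁻¹ with hf₂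
    have hd2 : ∀ r ∈ Ioo (0 : ℝ) 1, HasDerivAt f₂ (gam q r / r ^ 4) r := by
      intro r hr
      have hr0 := hr.1.ne'
      refine ((hd r hr).add (((hasDerivAt_pow 3 r).inv (pow_ne_zero 3 hr0)).const_mul
        (L / 3))).congr_deriv ?_
      rw [← hL r hr]
      field_simp
      ring
    have hc2 : ContinuousOn f₂ (Ioc 0 1) := hf.add (continuousOn_const.mul
      ((continuousOn_pow 3).inv₀ fun r hr => pow_ne_zero 3 hr.1.ne'))
    have hb2 : ∀ r ∈ Ioo (0 : ℝ) 1, |gam q r / r ^ 4| ≤ C * r ^ ((-2 : ℝ) - 1) := by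
      intro r hr
      have hr4 : 0 < r ^ 4 := pow_pos hr.1 4
      rw [abs_div, abs_of_pos hr4, div_le_iff₀ hr4]
      refine (hmb r hr).trans ?_
      rw [mul_assoc]
      refine mul_le_mul_of_nonneg_left ?_ hC
      rw [← Real.rpow_natCast, ← Real.rpow_add hr.1]
      refine Real.rpow_le_rpow_of_exponent_ge hr.1 hr.2.le ?_
      push_cast; linarith
    have hkey : ∀ r ∈ Ioo (0 : ℝ) 1, |L| ≤ 3 * (M + |f₂ 1| + C / 2) * r := by
      intro r hr
      have hr0 := hr.1
      have h1 := abs_sub_le_of_deriv_le_rpow (by norm_num) hc2 hd2 hb2 (Ioo_subset_Ioc_self hr)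
      have h2 : r ^ (-2 : ℝ) = (r ^ 2)⁻¹ := by
        rw [Real.rpow_neg hr0.le]; norm_cast
      rw [h2] at h1
      have h3 := hM r hr
      have h4 : |L| / 3 * (r ^ 3)⁻¹ ≤ |f₂ r - f₂ 1| + |f₂ 1| + |f r| := by
        have : L / 3 * (r ^ 3)⁻¹ = (f₂ r - f₂ 1) + f₂ 1 - f r := by simp only [hf₂]; ring
        have h5 : |L| / 3 * (r ^ 3)⁻¹ = |L / 3 * (r ^ 3)⁻¹| := by
          rw [abs_mul, abs_div, abs_of_pos (show (0 : ℝ) < 3 by norm_num),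
            abs_of_pos (show 0 < (r ^ 3)⁻¹ by positivity)]
        rw [h5, this]
        exact (abs_sub _ _).trans (add_le_add (abs_add_le _ _) le_rfl)
      have h6 : |L| / 3 * (r ^ 3)⁻¹ * r ^ 3 = |L| / 3 := by field_simp
      have h7 : |L| / 3 ≤ (|f₂ r - f₂ 1| + |f₂ 1| + |f r|) * r ^ 3 := by
        rw [← h6]; exact mul_le_mul_of_nonneg_right h4 (by positivity)
      have h8 : |f₂ r - f₂ 1| * r ^ 2 ≤ C / 2 := by
        have : |f₂ r - f₂ 1| * r ^ 2 ≤ C / -2 * (1 - (r ^ 2)⁻¹) * r ^ 2 :=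
          mul_le_mul_of_nonneg_right h1 (by positivity)
        have h9 : C / -2 * (1 - (r ^ 2)⁻¹) * r ^ 2 = C / 2 * (1 - r ^ 2) := by field_simp; ring
        rw [h9] at this
        nlinarith [mul_nonneg hC (sq_nonneg r)]
      have h10 : |f₂ 1| * r ^ 2 ≤ |f₂ 1| :=
        mul_le_of_le_one_right (abs_nonneg _) (pow_le_one₀ hr0.le hr.2.le)
      have h11 : (|f₂ r - f₂ 1| + |f₂ 1| + |f r|) * r ^ 3
          = (|f₂ r - f₂ 1| * r ^ 2 + |f₂ 1| * r ^ 2 + r ^ 2 * |f r|) * r := by ring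
      rw [h11] at h7
      have h12 := mul_le_mul_of_nonneg_right (add_le_add (add_le_add h8 h10) h3) hr0.le
      linarith
    have hlim : Filter.Tendsto (fun r : ℝ => 3 * (M + |f₂ 1| + C / 2) * r)
        (nhdsWithin 0 (Ioi 0)) (nhds 0) := by
      have : Filter.Tendsto (fun r : ℝ => 3 * (M + |f₂ 1| + C / 2) * r) (nhds 0)
          (nhds (3 * (M + |f₂ 1| + C / 2) * 0)) := (continuous_const_mul _).tendsto 0
      rw [mul_zero] at this
      exact this.mono_left nhdsWithin_le_nhds
    have h0 : |L| ≤ 0 := by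
      refine ge_of_tendsto hlim ?_
      filter_upwards [Ioo_mem_nhdsGT (zero_lt_one' ℝ)] with r hr using hkey r hr
    exact abs_eq_zero.1 (le_antisymm h0 (abs_nonneg _))
  intro r hr
  have hr4 : 0 < r ^ 4 := pow_pos hr.1 4
  have h1 : r ^ 4 * f₁ r = gam q r := by linarith [hL r hr]
  refine ⟨h1, ?_⟩
  rw [hpow4 r hr.1, ← mul_div_assoc, le_div_iff₀ hr4]
  calc |f₁ r| * r ^ 4 = |r ^ 4 * f₁ r| := by rw [abs_mul, abs_of_pos hr4, mul_comm]
    _ ≤ _ := by rw [h1]; exact hmb r hr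

/-- Right-hand side of the equation for `F = γ / r²` as a function of `s = r²`, `F` and `H`. -/
def rhsF (ε s F H : ℝ) : ℝ :=
  6 * F ^ 2 + 4 * s * F ^ 3 + 2 / ε * H ^ 2 * (1 + 2 * s * F)

/-- Right-hand side of the equation for `H = φ / r` as a function of `s = r²`, `F` and `H`. -/
def rhsH (lam s F H : ℝ) : ℝ :=
  8 * F * H + 8 * s * F ^ 2 * H + lam / 2 * H * (s * H ^ 2 - 1)

/-- The system satisfied by `f = γ / r²` and `h = φ / r` on `(0, 1)`. -/
structure RadialSystem (ε lam : ℝ) (f f₁ h h₁ : ℝ → ℝ) : Prop where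
  cont_f : ContinuousOn f (Ioc 0 1)
  cont_h : ContinuousOn h (Ioc 0 1)
  df : ∀ r ∈ Ioo (0 : ℝ) 1, HasDerivAt f (f₁ r) r
  dh : ∀ r ∈ Ioo (0 : ℝ) 1, HasDerivAt h (h₁ r) r
  flux_f : ∀ r ∈ Ioo (0 : ℝ) 1,
    HasDerivAt (fun r => r ^ 4 * f₁ r) (r ^ 4 * rhsF ε (r ^ 2) (f r) (h r)) r
  flux_h : ∀ r ∈ Ioo (0 : ℝ) 1,
    HasDerivAt (fun r => r ^ 4 * h₁ r) (r ^ 4 * rhsH lam (r ^ 2) (f r) (h r)) r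

/-- Both functions are `O(r^{-a})` at the origin. -/
def RpowBound (f h : ℝ → ℝ) (a : ℝ) : Prop :=
  ∃ C, ∀ r ∈ Ioc (0 : ℝ) 1, |f r| ≤ C * r ^ (-a) ∧ |h r| ≤ C * r ^ (-a)

lemma RpowBound.mono {f h : ℝ → ℝ} {a b : ℝ} (hb : RpowBound f h a) (hab : a ≤ b) :
    RpowBound f h b := by
  obtain ⟨C, hC⟩ := hb
  have hC0 : 0 ≤ C := by
    have := (abs_nonneg _).trans (hC 1 (by simp)).1
    simpa using this
  refine ⟨C, fun r hr => ?_⟩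
  have : r ^ (-a) ≤ r ^ (-b) := Real.rpow_le_rpow_of_exponent_ge hr.1 hr.2 (by linarith)
  have h1 := mul_le_mul_of_nonneg_left this hC0
  exact ⟨(hC r hr).1.trans h1, (hC r hr).2.trans h1⟩

/-- Here `x` stands for `r^(-a)` and `s` for `r²`. For `a ≤ 2` one has `s x ≤ 1`, so a factor `s F`
is bounded and the cubic terms are no worse than the quadratic ones. -/
lemma abs_rhsF_le {ε s F H C x : ℝ} (hε : 0 < ε) (hs : 0 ≤ s) (hsx : s * x ≤ 1) (hC : 0 ≤ C)
    (hF : |F| ≤ C * x) (hH : |H| ≤ C * x) :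
    |rhsF ε s F H| ≤ (6 * C ^ 2 + 4 * C ^ 3 + 2 / ε * C ^ 2 * (1 + 2 * C)) * x ^ 2 := by
  have hF2 : F ^ 2 ≤ C ^ 2 * x ^ 2 := by
    rw [← sq_abs, ← mul_pow]; exact pow_le_pow_left₀ (abs_nonneg _) hF 2
  have hH2 : H ^ 2 ≤ C ^ 2 * x ^ 2 := by
    rw [← sq_abs, ← mul_pow]; exact pow_le_pow_left₀ (abs_nonneg _) hH 2
  have hsF : |s * F| ≤ C := by
    rw [abs_mul, abs_of_nonneg hs]
    calc s * |F| ≤ s * (C * x) := mul_le_mul_of_nonneg_left hF hs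
      _ = C * (s * x) := by ring
      _ ≤ C := mul_le_of_le_one_right hC hsx
  have h1 : |6 * F ^ 2| ≤ 6 * (C ^ 2 * x ^ 2) := by
    rw [abs_of_nonneg (by positivity)]; linarith
  have h2 : |4 * s * F ^ 3| ≤ 4 * (C * (C ^ 2 * x ^ 2)) := by
    rw [show 4 * s * F ^ 3 = 4 * ((s * F) * F ^ 2) by ring, abs_mul, abs_mul,
      abs_of_nonneg (sq_nonneg F), abs_of_pos (show (0 : ℝ) < 4 by norm_num)]
    gcongr
  have h3 : |2 / ε * H ^ 2 * (1 + 2 * s * F)| ≤ 2 / ε * (C ^ 2 * x ^ 2) * (1 + 2 * C) := by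
    rw [abs_mul, abs_of_nonneg (show 0 ≤ 2 / ε * H ^ 2 by positivity)]
    have : |1 + 2 * s * F| ≤ 1 + 2 * C := by
      rw [mul_assoc]
      refine (abs_add_le _ _).trans ?_
      rw [abs_one, abs_mul, abs_of_pos (show (0 : ℝ) < 2 by norm_num)]
      linarith
    gcongr
  calc |rhsF ε s F H| ≤ |6 * F ^ 2| + |4 * s * F ^ 3| + |2 / ε * H ^ 2 * (1 + 2 * s * F)| :=
        (abs_add_le _ _).trans (add_le_add (abs_add_le _ _) le_rfl)
    _ ≤ _ := by linarith

/-- As for `rhsF`; the additional assumptions `1 ≤ x` and `1 ≤ C` absorb the linear term `-(λ/2) H`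
into a multiple of `x²`. -/
lemma abs_rhsH_le {lam s F H C x : ℝ} (hlam : 0 ≤ lam) (hs : 0 ≤ s) (hsx : s * x ≤ 1) (hC : 1 ≤ C)
    (hx : 1 ≤ x) (hF : |F| ≤ C * x) (hH : |H| ≤ C * x) :
    |rhsH lam s F H| ≤ (8 * C ^ 2 + 8 * C ^ 3 + lam / 2 * (C ^ 3 + C ^ 2)) * x ^ 2 := by
  have hC0 : 0 ≤ C := by linarith
  have hFH : |F * H| ≤ C ^ 2 * x ^ 2 := by
    rw [abs_mul, ← mul_pow, sq]; gcongr
  have hH2 : H ^ 2 ≤ C ^ 2 * x ^ 2 := by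
    rw [← sq_abs, ← mul_pow]; exact pow_le_pow_left₀ (abs_nonneg _) hH 2
  have hs' : ∀ G : ℝ, |G| ≤ C * x → |s * G| ≤ C := fun G hG => by
    rw [abs_mul, abs_of_nonneg hs]
    calc s * |G| ≤ s * (C * x) := mul_le_mul_of_nonneg_left hG hs
      _ = C * (s * x) := by ring
      _ ≤ C := mul_le_of_le_one_right hC0 hsx
  have h1 : |8 * F * H| ≤ 8 * (C ^ 2 * x ^ 2) := by
    rw [mul_assoc, abs_mul, abs_of_pos (show (0 : ℝ) < 8 by norm_num)]; gcongr
  have h2 : |8 * s * F ^ 2 * H| ≤ 8 * (C * (C ^ 2 * x ^ 2)) := by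
    rw [show 8 * s * F ^ 2 * H = 8 * ((s * F) * (F * H)) by ring, abs_mul, abs_mul (s * F),
      abs_of_pos (show (0 : ℝ) < 8 by norm_num)]
    gcongr
    exact hs' F hF
  have h3 : |lam / 2 * H * (s * H ^ 2 - 1)| ≤ lam / 2 * ((C ^ 3 + C ^ 2) * x ^ 2) := by
    rw [show lam / 2 * H * (s * H ^ 2 - 1) = lam / 2 * ((s * H) * H ^ 2 - H) by ring, abs_mul,
      abs_of_nonneg (show 0 ≤ lam / 2 by positivity)]
    refine mul_le_mul_of_nonneg_left ?_ (by positivity)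
    have h4 : |s * H * H ^ 2| ≤ C * (C ^ 2 * x ^ 2) := by
      rw [abs_mul, abs_of_nonneg (sq_nonneg H)]
      gcongr
      exact hs' H hH
    have h5 : C * x ≤ C ^ 2 * x ^ 2 := by
      have : 1 ≤ C * x := by nlinarith
      rw [← mul_pow]; nlinarith
    calc |s * H * H ^ 2 - H| ≤ |s * H * H ^ 2| + |H| := abs_sub _ _
      _ ≤ _ := by nlinarith
  calc |rhsH lam s F H| ≤ |8 * F * H| + |8 * s * F ^ 2 * H| + |lam / 2 * H * (s * H ^ 2 - 1)| :=
        (abs_add_le _ _).trans (add_le_add (abs_add_le _ _) le_rfl)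
    _ ≤ _ := by linarith

namespace RadialSystem

variable {ε lam : ℝ} {f f₁ h h₁ : ℝ → ℝ}

lemma continuousOn_rhsF (hS : RadialSystem ε lam f f₁ h h₁) :
    ContinuousOn (fun r => r ^ 4 * rhsF ε (r ^ 2) (f r) (h r)) (Ioo 0 1) := by
  have h1 := hS.cont_f.mono Ioo_subset_Ioc_self
  have h2 := hS.cont_h.mono Ioo_subset_Ioc_self
  unfold rhsF
  fun_prop

lemma continuousOn_rhsH (hS : RadialSystem ε lam f f₁ h h₁) :
    ContinuousOn (fun r => r ^ 4 * rhsH lam (r ^ 2) (f r) (h r)) (Ioo 0 1) := by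
  have h1 := hS.cont_f.mono Ioo_subset_Ioc_self
  have h2 := hS.cont_h.mono Ioo_subset_Ioc_self
  unfold rhsH
  fun_prop

/-- Fluxes and derivative bounds obtained from a power bound. -/
lemma flux_of_bound (hS : RadialSystem ε lam f f₁ h h₁) (hε : 0 < ε) (hlam : 0 ≤ lam) {a : ℝ}
    (ha0 : 0 ≤ a) (ha2 : a ≤ 2) (hb : RpowBound f h a) : ∃ C, ∀ r ∈ Ioo (0 : ℝ) 1,
      (r ^ 4 * f₁ r = ∫ s in (0 : ℝ)..r, s ^ 4 * rhsF ε (s ^ 2) (f s) (h s)) ∧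
      (r ^ 4 * h₁ r = ∫ s in (0 : ℝ)..r, s ^ 4 * rhsH lam (s ^ 2) (f s) (h s)) ∧
      |f₁ r| ≤ C * r ^ (1 - 2 * a) ∧ |h₁ r| ≤ C * r ^ (1 - 2 * a) := by
  obtain ⟨C₀, hC₀⟩ := hb
  set C := max C₀ 1 with hCdef
  have hC1 : 1 ≤ C := le_max_right _ _
  have hC0 : 0 ≤ C := by linarith
  have hx1 : ∀ r ∈ Ioo (0 : ℝ) 1, 1 ≤ r ^ (-a) := fun r hr =>
    Real.one_le_rpow_of_pos_of_le_one_of_nonpos hr.1 hr.2.le (by linarith)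
  have hC : ∀ r ∈ Ioo (0 : ℝ) 1, |f r| ≤ C * r ^ (-a) ∧ |h r| ≤ C * r ^ (-a) := fun r hr => by
    have h1 : C₀ * r ^ (-a) ≤ C * r ^ (-a) :=
      mul_le_mul_of_nonneg_right (le_max_left _ _) (by linarith [hx1 r hr])
    have h2 := hC₀ r (Ioo_subset_Ioc_self hr)
    exact ⟨h2.1.trans h1, h2.2.trans h1⟩
  have hsx : ∀ r ∈ Ioo (0 : ℝ) 1, r ^ 2 * r ^ (-a) ≤ 1 := fun r hr => by
    rw [← Real.rpow_natCast, ← Real.rpow_add hr.1]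
    exact Real.rpow_le_one hr.1.le hr.2.le (by push_cast; linarith)
  have hexp : ∀ r ∈ Ioo (0 : ℝ) 1, r ^ 4 * (r ^ (-a)) ^ 2 = r ^ (4 - 2 * a) := fun r hr => by
    rw [← Real.rpow_natCast, ← Real.rpow_natCast, ← Real.rpow_mul hr.1.le, ← Real.rpow_add hr.1]
    congr 1; push_cast; ring
  have hM : ∀ u : ℝ → ℝ, (∀ r ∈ Ioo (0 : ℝ) 1, |u r| ≤ C * r ^ (-a)) →
      ∀ r ∈ Ioo (0 : ℝ) 1, r ^ 2 * |u r| ≤ C := fun u hu r hr => by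
    calc r ^ 2 * |u r| ≤ r ^ 2 * (C * r ^ (-a)) := by gcongr; exact hu r hr
      _ = C * (r ^ 2 * r ^ (-a)) := by ring
      _ ≤ C := mul_le_of_le_one_right hC0 (hsx r hr)
  set CF := 6 * C ^ 2 + 4 * C ^ 3 + 2 / ε * C ^ 2 * (1 + 2 * C)
  set CH := 8 * C ^ 2 + 8 * C ^ 3 + lam / 2 * (C ^ 3 + C ^ 2)
  have hqF : ∀ r ∈ Ioo (0 : ℝ) 1, |r ^ 4 * rhsF ε (r ^ 2) (f r) (h r)|
      ≤ max CF CH * r ^ (4 - 2 * a) := fun r hr => by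
    have h1 := abs_rhsF_le hε (sq_nonneg r) (hsx r hr) hC0 (hC r hr).1 (hC r hr).2
    have hr4 : 0 < r ^ 4 := pow_pos hr.1 4
    rw [abs_mul, abs_of_pos hr4, ← hexp r hr]
    calc r ^ 4 * |rhsF ε (r ^ 2) (f r) (h r)| ≤ r ^ 4 * (CF * (r ^ (-a)) ^ 2) := by gcongr
      _ = CF * (r ^ 4 * (r ^ (-a)) ^ 2) := by ring
      _ ≤ _ := by gcongr; exact le_max_left _ _
  have hqH : ∀ r ∈ Ioo (0 : ℝ) 1, |r ^ 4 * rhsH lam (r ^ 2) (f r) (h r)|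
      ≤ max CF CH * r ^ (4 - 2 * a) := fun r hr => by
    have h1 := abs_rhsH_le hlam (sq_nonneg r) (hsx r hr) hC1 (hx1 r hr)
      (hC r hr).1 (hC r hr).2
    have hr4 : 0 < r ^ 4 := pow_pos hr.1 4
    rw [abs_mul, abs_of_pos hr4, ← hexp r hr]
    calc r ^ 4 * |rhsH lam (r ^ 2) (f r) (h r)| ≤ r ^ 4 * (CH * (r ^ (-a)) ^ 2) := by gcongr
      _ = CH * (r ^ 4 * (r ^ (-a)) ^ 2) := by ring
      _ ≤ _ := by gcongr; exact le_max_right _ _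
  have h1 := singular_flux_eq (by linarith) hS.cont_f hS.df hS.continuousOn_rhsF hS.flux_f hqF
    (hM f fun r hr => (hC r hr).1)
  have h2 := singular_flux_eq (by linarith) hS.cont_h hS.dh hS.continuousOn_rhsH hS.flux_h hqH
    (hM h fun r hr => (hC r hr).2)
  have he : 4 - 2 * a - 3 = 1 - 2 * a := by ring
  rw [he] at h1 h2
  exact ⟨_, fun r hr => ⟨(h1 r hr).1, (h2 r hr).1, (h1 r hr).2, (h2 r hr).2⟩⟩

/-- Integrating down from `r = 1`, negative `e` gives growth `r^e` and positive `e` gives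
boundedness. The case `e = 0`, which would produce a logarithm, is excluded. -/
lemma bound_of_deriv {u u₁ : ℝ → ℝ} {C e : ℝ} (he : e ≠ 0)
    (hu : ContinuousOn u (Ioc 0 1)) (hd : ∀ r ∈ Ioo (0 : ℝ) 1, HasDerivAt u (u₁ r) r)
    (hb : ∀ r ∈ Ioo (0 : ℝ) 1, |u₁ r| ≤ C * r ^ (e - 1)) :
    ∃ C', ∀ r ∈ Ioc (0 : ℝ) 1, |u r| ≤ C' * r ^ (min e 0) := by
  refine ⟨|u 1| + |C / e|, fun r hr => ?_⟩
  have h1 := abs_sub_le_of_deriv_le_rpow he hu hd hb hr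
  have h2 : 1 ≤ r ^ (min e 0) :=
    Real.one_le_rpow_of_pos_of_le_one_of_nonpos hr.1 hr.2 (min_le_right _ _)
  have h3 : |1 - r ^ e| ≤ r ^ (min e 0) := by
    have h0 : 0 ≤ r ^ e := Real.rpow_nonneg hr.1.le e
    have h4 : r ^ e ≤ r ^ (min e 0) :=
      Real.rpow_le_rpow_of_exponent_ge hr.1 hr.2 (min_le_left _ _)
    rw [abs_le]; constructor <;> linarith
  have h5 : |u r| ≤ |u r - u 1| + |u 1| := by
    have := abs_add_le (u r - u 1) (u 1)
    simpa using this
  calc |u r| ≤ |u r - u 1| + |u 1| := h5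
    _ ≤ |C / e| * |1 - r ^ e| + |u 1| := by
        gcongr; exact h1.trans ((le_abs_self _).trans (abs_mul _ _).le)
    _ ≤ |C / e| * r ^ (min e 0) + |u 1| * r ^ (min e 0) := by
        gcongr; exact le_mul_of_one_le_right (abs_nonneg _) h2
    _ = _ := by ring

/-- The right-hand sides are `O(r^(-2a))` and inverting the radial Laplacian gains two powers. The
value `a = 1` is the logarithmic case. -/
lemma improve_bound (hS : RadialSystem ε lam f f₁ h h₁) (hε : 0 < ε) (hlam : 0 ≤ lam) {a : ℝ}
    (ha0 : 0 ≤ a) (ha1 : a ≠ 1) (ha2 : a ≤ 2) (hb : RpowBound f h a) :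
    RpowBound f h (max (2 * a - 2) 0) := by
  obtain ⟨C, hC⟩ := hS.flux_of_bound hε hlam ha0 ha2 hb
  have he : 2 - 2 * a ≠ 0 := fun h => ha1 (by linarith)
  have hexp : 2 - 2 * a - 1 = 1 - 2 * a := by ring
  obtain ⟨C₁, h1⟩ := bound_of_deriv he hS.cont_f hS.df
    (fun r hr => by rw [hexp]; exact (hC r hr).2.2.1)
  obtain ⟨C₂, h2⟩ := bound_of_deriv he hS.cont_h hS.dh
    (fun r hr => by rw [hexp]; exact (hC r hr).2.2.2)
  have hm : -max (2 * a - 2) 0 = min (2 - 2 * a) 0 := by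
    rw [← min_neg_neg, neg_zero, neg_sub]
  refine ⟨max C₁ C₂, fun r hr => ?_⟩
  rw [hm]
  have hp : 0 ≤ r ^ (min (2 - 2 * a) 0) := Real.rpow_nonneg hr.1.le _
  exact ⟨(h1 r hr).trans (mul_le_mul_of_nonneg_right (le_max_left _ _) hp),
    (h2 r hr).trans (mul_le_mul_of_nonneg_right (le_max_right _ _) hp)⟩

/-- Solutions that are `O(r^{-3/2})` are bounded. -/
lemma bounded (hS : RadialSystem ε lam f f₁ h h₁) (hε : 0 < ε) (hlam : 0 ≤ lam)
    (hb : RpowBound f h (3 / 2)) : RpowBound f h 0 := by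
  -- The exponents run `3/2 → 1`, relaxed to `5/4` to avoid the logarithmic case, then `5/4 → 1/2 →
  -- 0`.
  have h1 := (hS.improve_bound hε hlam (by norm_num) (by norm_num) (by norm_num) hb).mono
    (b := 5 / 4) (by norm_num)
  have h2 := (hS.improve_bound hε hlam (by norm_num) (by norm_num) (by norm_num) h1).mono
    (b := 1 / 2) (by norm_num)
  exact (hS.improve_bound hε hlam (by norm_num) (by norm_num) (by norm_num) h2).mono
    (b := 0) (by norm_num)

end RadialSystem

/-! ### Smoothness in the variable `s = r²` -/

/-- The averages `∫₀¹ tᵐ p(s t²) dt`, inverting the radial Laplacian in the variable `s = r²`. -/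
def avg (m : ℕ) (p : ℝ → ℝ) (s : ℝ) : ℝ := ∫ t in (0 : ℝ)..1, t ^ m * p (s * t ^ 2)

lemma continuous_avg (m : ℕ) {p : ℝ → ℝ} (hp : Continuous p) : Continuous (avg m p) :=
  intervalIntegral.continuous_parametric_intervalIntegral_of_continuous'
    (f := fun s t => t ^ m * p (s * t ^ 2)) (by unfold Function.uncurry; fun_prop) 0 1

lemma hasDerivAt_avg (m : ℕ) {p : ℝ → ℝ} (hp : ContDiff ℝ 1 p) (s : ℝ) :
    HasDerivAt (avg m p) (avg (m + 2) (deriv p) s) s := by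
  have hp' : Continuous (deriv p) := hp.continuous_deriv le_rfl
  obtain ⟨C, hC⟩ := (isCompact_Icc (a := -(|s| + 1)) (b := |s| + 1)).exists_bound_of_continuousOn
    hp'.continuousOn
  refine (intervalIntegral.hasDerivAt_integral_of_dominated_loc_of_deriv_le
    (F := fun x t => t ^ m * p (x * t ^ 2)) (F' := fun x t => t ^ (m + 2) * deriv p (x * t ^ 2))
    (bound := fun _ => C) (ball_mem_nhds s one_pos) ?_ ?_ ?_ ?_ ?_ ?_).2
  · exact Filter.Eventually.of_forall fun x => by
      have : Continuous fun t => t ^ m * p (x * t ^ 2) := by fun_prop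
      exact this.aestronglyMeasurable
  · have : Continuous fun t => t ^ m * p (s * t ^ 2) := by fun_prop
    exact this.intervalIntegrable _ _
  · have : Continuous fun t => t ^ (m + 2) * deriv p (s * t ^ 2) := by fun_prop
    exact this.aestronglyMeasurable
  · refine Filter.Eventually.of_forall fun t ht x hx => ?_
    rw [uIoc_of_le zero_le_one] at ht
    have ht1 : |t ^ (m + 2)| ≤ 1 := by
      rw [abs_of_nonneg (pow_nonneg ht.1.le _)]; exact pow_le_one₀ ht.1.le ht.2
    have ht2 : |t ^ 2| ≤ 1 := by
      rw [abs_of_nonneg (pow_nonneg ht.1.le _)]; exact pow_le_one₀ ht.1.le ht.2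
    have hx1 : |x| ≤ |s| + 1 := by
      have h1 : |x - s| < 1 := by simpa [Real.dist_eq] using hx
      have h2 := abs_add_le (x - s) s
      rw [sub_add_cancel] at h2
      linarith
    have hxt : |x * t ^ 2| ≤ |s| + 1 := by
      rw [abs_mul]
      exact (mul_le_of_le_one_right (abs_nonneg _) ht2).trans hx1
    have h3 := hC _ (abs_le.1 hxt)
    rw [norm_mul, Real.norm_eq_abs]
    exact (mul_le_of_le_one_left (norm_nonneg _) ht1).trans h3
  · simp
  · refine Filter.Eventually.of_forall fun t _ x _ => ?_
    have h1 : HasDerivAt (fun x => p (x * t ^ 2)) (deriv p (x * t ^ 2) * (1 * t ^ 2)) x :=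
      ((hp.differentiable one_ne_zero (x * t ^ 2)).hasDerivAt).comp x
        ((hasDerivAt_id x).mul_const (t ^ 2))
    exact (h1.const_mul (t ^ m)).congr_deriv (by ring)

/-- Differentiating in `s` brings out a factor `t²` and so raises `m` by two; the induction
therefore quantifies over `m`. -/
lemma contDiff_avg (n : ℕ) : ∀ (m : ℕ) {p : ℝ → ℝ}, ContDiff ℝ n p → ContDiff ℝ n (avg m p) := by
  induction n with
  | zero =>
    intro m p hp
    rw [Nat.cast_zero, contDiff_zero] at *
    exact continuous_avg m hp
  | succ n ih =>
    intro m p hp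
    have h1 : ContDiff ℝ 1 p := hp.of_le (by exact_mod_cast Nat.le_add_left 1 n)
    have hd := hasDerivAt_avg m h1
    rw [Nat.cast_succ, contDiff_succ_iff_deriv] at hp ⊢
    refine ⟨fun s => (hd s).differentiableAt, by simp, ?_⟩
    rw [show deriv (avg m p) = avg (m + 2) (deriv p) from funext fun s => (hd s).deriv]
    exact ih (m + 2) hp.2.2

/-- Integrate `d/dt (t⁵ p(s t²))` over `[0, 1]`. In this way `F₁ = ½ avg 4 p` satisfies `4 s F₁' +
10 F₁ = p`, the form of the profile equations. -/
lemma avg_identity {p : ℝ → ℝ} (hp : ContDiff ℝ 1 p) (s : ℝ) :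
    2 * s * avg 6 (deriv p) s + 5 * avg 4 p s = p s := by
  have hp' : Continuous (deriv p) := hp.continuous_deriv le_rfl
  have hder : ∀ t : ℝ, HasDerivAt (fun t => t ^ 5 * p (s * t ^ 2))
      (2 * s * (t ^ 6 * deriv p (s * t ^ 2)) + 5 * (t ^ 4 * p (s * t ^ 2))) t := by
    intro t
    have h1 : HasDerivAt (fun t => p (s * t ^ 2)) (deriv p (s * t ^ 2) * (s * (2 * t))) t := by
      refine ((hp.differentiable one_ne_zero (s * t ^ 2)).hasDerivAt).comp t ?_
      simpa using (hasDerivAt_pow 2 t).const_mul s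
    refine ((hasDerivAt_pow 5 t).mul h1).congr_deriv ?_
    push_cast; ring
  have c1 : Continuous fun t => t ^ 6 * deriv p (s * t ^ 2) := by fun_prop
  have c2 : Continuous fun t => t ^ 4 * p (s * t ^ 2) := by fun_prop
  have h := intervalIntegral.integral_eq_sub_of_hasDerivAt (a := 0) (b := 1)
    (fun t _ => hder t) (((c1.const_mul _).add (c2.const_mul _)).intervalIntegrable _ _)
  rw [intervalIntegral.integral_add ((c1.const_mul _).intervalIntegrable _ _)
    ((c2.const_mul _).intervalIntegrable _ _), intervalIntegral.integral_const_mul,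
    intervalIntegral.integral_const_mul] at h
  simpa [avg] using h

lemma avg_congr {m : ℕ} {p q : ℝ → ℝ} (h : EqOn p q (Icc 0 1)) :
    EqOn (avg m p) (avg m q) (Icc 0 1) := by
  intro s hs
  refine intervalIntegral.integral_congr fun t ht => ?_
  rw [uIcc_of_le zero_le_one] at ht
  have : s * t ^ 2 ∈ Icc (0 : ℝ) 1 :=
    ⟨mul_nonneg hs.1 (sq_nonneg t), mul_le_one₀ hs.2 (sq_nonneg t) (pow_le_one₀ ht.1 ht.2)⟩
  simp only [h this]

/-- `C^n` primitives. -/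
lemma contDiff_primitive {n : ℕ} {p : ℝ → ℝ} (hp : ContDiff ℝ n p) (c : ℝ) :
    ContDiff ℝ (n + 1 : ℕ) (fun s => c + ∫ t in (0 : ℝ)..s, p t) ∧
      ∀ s, HasDerivAt (fun s => c + ∫ t in (0 : ℝ)..s, p t) (p s) s := by
  have hd : ∀ s, HasDerivAt (fun s => c + ∫ t in (0 : ℝ)..s, p t) (p s) s := fun s =>
    (intervalIntegral.integral_hasDerivAt_right (hp.continuous.intervalIntegrable _ _)
      (hp.continuous.stronglyMeasurableAtFilter _ _) hp.continuous.continuousAt).const_add c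
  refine ⟨?_, hd⟩
  rw [Nat.cast_succ, contDiff_succ_iff_deriv, funext fun s => (hd s).deriv]
  exact ⟨fun s => (hd s).differentiableAt, by simp, hp⟩

lemma contDiff_rhsF (ε : ℝ) {n : ℕ} {F H : ℝ → ℝ} (hF : ContDiff ℝ n F) (hH : ContDiff ℝ n H) :
    ContDiff ℝ n (fun s => rhsF ε s (F s) (H s)) := by
  unfold rhsF; fun_prop

lemma contDiff_rhsH (lam : ℝ) {n : ℕ} {F H : ℝ → ℝ} (hF : ContDiff ℝ n F)
    (hH : ContDiff ℝ n H) : ContDiff ℝ n (fun s => rhsH lam s (F s) (H s)) := by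
  unfold rhsH; fun_prop

/-- The integrated system for the profiles in the variable `s = r²`. -/
structure IntegralSystem (ε lam : ℝ) (F H : ℝ → ℝ) : Prop where
  cont_F : Continuous F
  cont_H : Continuous H
  dF : ∀ s ∈ Ioo (0 : ℝ) 1, HasDerivAt F (1 / 2 * avg 4 (fun s => rhsF ε s (F s) (H s)) s) s
  dH : ∀ s ∈ Ioo (0 : ℝ) 1, HasDerivAt H (1 / 2 * avg 4 (fun s => rhsH lam s (F s) (H s)) s) s

namespace IntegralSystem

variable {ε lam : ℝ} {F H : ℝ → ℝ}

/-- The derivative is known only on the open interval, and continuity extends the formula to the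
endpoints. Since `s t²` stays in `[0, 1]`, `p` may be exchanged for any `q` agreeing with it there,
in particular for a smoother extension. -/
lemma eqOn_primitive {u p q : ℝ → ℝ} (hu : Continuous u) (hp : Continuous p)
    (hd : ∀ s ∈ Ioo (0 : ℝ) 1, HasDerivAt u (1 / 2 * avg 4 p s) s) (hpq : EqOn q p (Icc 0 1)) :
    EqOn (fun s => u 0 + ∫ t in (0 : ℝ)..s, 1 / 2 * avg 4 q t) u (Icc 0 1) := by
  intro s hs
  have h1 := intervalIntegral.integral_eq_sub_of_hasDerivAt_of_le hs.1 hu.continuousOn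
    (fun x hx => hd x ⟨hx.1, hx.2.trans_le hs.2⟩)
    (((continuous_avg 4 hp).const_mul _).intervalIntegrable _ _)
  have h2 : ∫ t in (0 : ℝ)..s, 1 / 2 * avg 4 q t = ∫ t in (0 : ℝ)..s, 1 / 2 * avg 4 p t := by
    refine intervalIntegral.integral_congr fun t ht => ?_
    rw [uIcc_of_le hs.1] at ht
    simp only [avg_congr hpq ⟨ht.1, ht.2.trans hs.2⟩]
  simp only [h2, h1]
  ring

lemma continuous_rhsF (hF : Continuous F) (hH : Continuous H) :
    Continuous fun s => rhsF ε s (F s) (H s) := by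
  unfold rhsF; fun_prop

lemma continuous_rhsH (hF : Continuous F) (hH : Continuous H) :
    Continuous fun s => rhsH lam s (F s) (H s) := by
  unfold rhsH; fun_prop

/-- The profiles have `C^n` extensions, for every `n`. -/
lemma exists_contDiff (hS : IntegralSystem ε lam F H) (n : ℕ) : ∃ F' H' : ℝ → ℝ,
    ContDiff ℝ n F' ∧ ContDiff ℝ n H' ∧ EqOn F' F (Icc 0 1) ∧ EqOn H' H (Icc 0 1) := by
  induction n with
  | zero =>
    exact ⟨F, H, by simpa using hS.cont_F, by simpa using hS.cont_H, fun _ _ => rfl, fun _ _ => rfl⟩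
  | succ n ih =>
    -- Inserting the `C^n` extensions into the right-hand sides and integrating the averages gives
    -- new extensions of class `C^(n+1)`; they may differ from the old ones outside `[0, 1]`.
    obtain ⟨F', H', hF', hH', eF, eH⟩ := ih
    have h1 := contDiff_rhsF ε hF' hH'
    have h2 := contDiff_rhsH lam hF' hH'
    have h3 := (contDiff_primitive (contDiff_const.mul (contDiff_avg n 4 h1)) (c := F 0)
      (p := fun t => 1 / 2 * avg 4 (fun s => rhsF ε s (F' s) (H' s)) t)).1
    have h4 := (contDiff_primitive (contDiff_const.mul (contDiff_avg n 4 h2)) (c := H 0)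
      (p := fun t => 1 / 2 * avg 4 (fun s => rhsH lam s (F' s) (H' s)) t)).1
    refine ⟨_, _, h3, h4, ?_, ?_⟩
    · exact eqOn_primitive hS.cont_F (continuous_rhsF hS.cont_F hS.cont_H) hS.dF
        fun s hs => by simp only [eF hs, eH hs]
    · exact eqOn_primitive hS.cont_H (continuous_rhsH hS.cont_F hS.cont_H) hS.dH
        fun s hs => by simp only [eF hs, eH hs]

lemma contDiffOn (hS : IntegralSystem ε lam F H) :
    ContDiffOn ℝ ∞ F (Icc 0 1) ∧ ContDiffOn ℝ ∞ H (Icc 0 1) := by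
  constructor <;> rw [contDiffOn_infty] <;> intro n <;>
    obtain ⟨F', H', hF', hH', eF, eH⟩ := hS.exists_contDiff n
  · exact hF'.contDiffOn.congr fun s hs => (eF hs).symm
  · exact hH'.contDiffOn.congr fun s hs => (eH hs).symm

lemma exists_profileEq (hS : IntegralSystem ε lam F H) (hF1 : F 1 = -(1 / 2)) (hH1 : H 1 = 1) :
    ∃ F₁ F₂ H₁ H₂, ProfileEq ε lam F F₁ F₂ H H₁ H₂ := by
  -- Class `C¹` suffices: it makes the right-hand sides `C¹`, so the averages defining the first
  -- derivatives can be differentiated once more.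
  obtain ⟨F', H', hF', hH', eF, eH⟩ := hS.exists_contDiff 1
  have h1 := contDiff_rhsF ε hF' hH'
  have h2 := contDiff_rhsH lam hF' hH'
  rw [Nat.cast_one] at h1 h2
  set p := fun s => rhsF ε s (F' s) (H' s) with hp
  set q := fun s => rhsH lam s (F' s) (H' s) with hq
  have e1 := eqOn_primitive hS.cont_F (continuous_rhsF hS.cont_F hS.cont_H) hS.dF
    (q := p) fun s hs => by simp only [hp, eF hs, eH hs]
  have e2 := eqOn_primitive hS.cont_H (continuous_rhsH hS.cont_F hS.cont_H) hS.dH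
    (q := q) fun s hs => by simp only [hq, eF hs, eH hs]
  have d1 := (contDiff_primitive (n := 0) (c := F 0) (p := fun t => 1 / 2 * avg 4 p t)
    (by simpa using (continuous_avg 4 h1.continuous).const_mul _)).2
  have d2 := (contDiff_primitive (n := 0) (c := H 0) (p := fun t => 1 / 2 * avg 4 q t)
    (by simpa using (continuous_avg 4 h2.continuous).const_mul _)).2
  refine ⟨fun s => 1 / 2 * avg 4 p s, fun s => 1 / 2 * avg 6 (deriv p) s,
    fun s => 1 / 2 * avg 4 q s, fun s => 1 / 2 * avg 6 (deriv q) s, ?_, ?_, ?_, ?_, ?_, ?_, hF1, hH1⟩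
  · exact fun s hs => (d1 s).hasDerivWithinAt.congr (fun x hx => (e1 hx).symm) (e1 hs).symm
  · exact fun s _ => ((hasDerivAt_avg 4 h1 s).const_mul _).hasDerivWithinAt
  · exact fun s hs => (d2 s).hasDerivWithinAt.congr (fun x hx => (e2 hx).symm) (e2 hs).symm
  · exact fun s _ => ((hasDerivAt_avg 4 h2 s).const_mul _).hasDerivWithinAt
  · intro s hs
    have h3 := avg_identity h1 s
    have h4 : p s = rhsF ε s (F s) (H s) := by simp only [hp, eF hs, eH hs]
    rw [rhsF] at h4
    linarith
  · intro s hs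
    have h3 := avg_identity h2 s
    have h4 : q s = rhsH lam s (F s) (H s) := by simp only [hq, eF hs, eH hs]
    rw [rhsH] at h4
    linarith

end IntegralSystem

/-! ### From the minimizer to the integrated system -/

/-- Extension of a function on `(0, 1]` with bounded derivative. -/
lemma exists_continuous_extension {f f₁ : ℝ → ℝ} {C : ℝ} (hf : ContinuousOn f (Ioc 0 1))
    (hd : ∀ r ∈ Ioo (0 : ℝ) 1, HasDerivAt f (f₁ r) r) (hb : ∀ r ∈ Ioo (0 : ℝ) 1, |f₁ r| ≤ C) :
    ∃ u : ℝ → ℝ, Continuous u ∧ EqOn u f (Ioc 0 1) := by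
  have hC : 0 ≤ C := (abs_nonneg _).trans (hb (1 / 2) (by constructor <;> norm_num))
  have hL : LipschitzOnWith ⟨C, hC⟩ f (Ioo 0 1) :=
    (convex_Ioo 0 1).lipschitzOnWith_of_nnnorm_hasDerivWithin_le
      (fun r hr => (hd r hr).hasDerivWithinAt) (fun r hr => hb r hr)
  obtain ⟨u, hu, hfu⟩ := hL.extend_real
  refine ⟨u, hu.continuous, ?_⟩
  exact (hfu.symm).of_subset_closure hu.continuous.continuousOn hf Ioo_subset_Ioc_self
    (by rw [closure_Ioo zero_ne_one]; exact Ioc_subset_Icc_self)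

/-- Put `r = √s`. The substitution `x = r t` turns the flux integral into `r⁵ avg 4 P s`, so `f'(r)
= r · avg 4 P s`, and the factor `r` cancels against `d√s/ds = 1/(2r)`. -/
lemma hasDerivAt_comp_sqrt {u f f₁ P : ℝ → ℝ} (hu : EqOn u f (Ioc 0 1))
    (hd : ∀ r ∈ Ioo (0 : ℝ) 1, HasDerivAt f (f₁ r) r)
    (hflux : ∀ r ∈ Ioo (0 : ℝ) 1, r ^ 4 * f₁ r = ∫ s in (0 : ℝ)..r, s ^ 4 * P (s ^ 2)) {s : ℝ}
    (hs : s ∈ Ioo (0 : ℝ) 1) : HasDerivAt (fun s => u √s) (1 / 2 * avg 4 P s) s := by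
  have hr : √s ∈ Ioo (0 : ℝ) 1 :=
    ⟨Real.sqrt_pos.2 hs.1, by rw [Real.sqrt_lt' one_pos]; simpa using hs.2⟩
  have h1 : HasDerivAt u (f₁ √s) √s := (hd _ hr).congr_of_eventuallyEq (by
    filter_upwards [isOpen_Ioo.mem_nhds hr] with x hx using hu (Ioo_subset_Ioc_self hx))
  refine (h1.comp s (Real.hasDerivAt_sqrt hs.1.ne')).congr_deriv ?_
  have h2 : ∫ x in (0 : ℝ)..√s, x ^ 4 * P (x ^ 2) = √s ^ 5 * avg 4 P s := by
    have h3 := intervalIntegral.mul_integral_comp_mul_left (a := 0) (b := 1) (c := √s)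
      (f := fun x => x ^ 4 * P (x ^ 2))
    rw [mul_zero, mul_one] at h3
    rw [← h3, avg, ← intervalIntegral.integral_const_mul, ← intervalIntegral.integral_const_mul]
    refine intervalIntegral.integral_congr fun t _ => ?_
    simp only [mul_pow, Real.sq_sqrt hs.1.le]
    ring
  have h4 := hflux _ hr
  rw [h2] at h4
  have hr0 := hr.1.ne'
  have h5 : f₁ √s = √s * avg 4 P s :=
    mul_left_cancel₀ (pow_ne_zero 4 hr0) (by rw [h4]; ring)
  rw [h5]
  field_simp

/-- Solutions of the radial system that are not too singular extend to the origin as functions of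
`r²` solving the integrated system. -/
theorem RadialSystem.exists_integralSystem {ε lam : ℝ} (hε : 0 < ε) (hlam : 0 ≤ lam)
    {f f₁ h h₁ : ℝ → ℝ} (hS : RadialSystem ε lam f f₁ h h₁) (hb : RpowBound f h (3 / 2)) :
    ∃ F H, IntegralSystem ε lam F H ∧ ∀ r ∈ Ioc (0 : ℝ) 1, F (r ^ 2) = f r ∧ H (r ^ 2) = h r := by
  obtain ⟨C, hC⟩ := hS.flux_of_bound hε hlam le_rfl (by norm_num) (hS.bounded hε hlam hb)
  have hbd : ∀ r ∈ Ioo (0 : ℝ) 1, |f₁ r| ≤ |C| ∧ |h₁ r| ≤ |C| := by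
    intro r hr
    have h1 := (hC r hr).2.2
    simp only [mul_zero, sub_zero, Real.rpow_one] at h1
    have h2 : C * r ≤ |C| := by
      calc C * r ≤ |C| * r := mul_le_mul_of_nonneg_right (le_abs_self C) hr.1.le
        _ ≤ |C| := mul_le_of_le_one_right (abs_nonneg C) hr.2.le
    exact ⟨h1.1.trans h2, h1.2.trans h2⟩
  obtain ⟨u, huc, huf⟩ := exists_continuous_extension hS.cont_f hS.df fun r hr => (hbd r hr).1
  obtain ⟨v, hvc, hvh⟩ := exists_continuous_extension hS.cont_h hS.dh fun r hr => (hbd r hr).2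
  have hcong : ∀ (R : ℝ → ℝ → ℝ → ℝ), ∀ r ∈ Ioo (0 : ℝ) 1,
      ∫ s in (0 : ℝ)..r, s ^ 4 * R (s ^ 2) (f s) (h s)
        = ∫ s in (0 : ℝ)..r, s ^ 4 * R (s ^ 2) (u √(s ^ 2)) (v √(s ^ 2)) := by
    intro R r hr
    refine intervalIntegral.integral_congr_ae (Filter.Eventually.of_forall fun s hs => ?_)
    rw [uIoc_of_le hr.1.le] at hs
    have hs' : s ∈ Ioc (0 : ℝ) 1 := ⟨hs.1, hs.2.trans hr.2.le⟩
    rw [Real.sqrt_sq hs.1.le, huf hs', hvh hs']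
  -- Since `√s = 0` for `s < 0`, these functions are continuous on the whole line, being constant on
  -- the negative half-axis.
  refine ⟨fun s => u √s, fun s => v √s, ⟨huc.comp Real.continuous_sqrt,
    hvc.comp Real.continuous_sqrt, fun s hs => ?_, fun s hs => ?_⟩, fun r hr => ?_⟩
  · exact hasDerivAt_comp_sqrt (P := fun s => rhsF ε s (u √s) (v √s)) huf hS.df
      (fun r hr => by rw [(hC r hr).1, hcong (rhsF ε) r hr]) hs
  · exact hasDerivAt_comp_sqrt (P := fun s => rhsH lam s (u √s) (v √s)) hvh hS.dh
      (fun r hr => by rw [(hC r hr).2.1, hcong (rhsH lam) r hr]) hs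
  · simp only [Real.sqrt_sq hr.1.le]
    exact ⟨huf hr, hvh hr⟩

/-- The Euler-Lagrange equations in terms of `γ / r²` and `φ / r`. -/
lemma radialSystem_of_minimizer {ε lam : ℝ} (hε : 0 < ε) (hlam : 0 ≤ lam) {g k : ℝ → ℝ}
    (hv : Velocity g k) (hfin : energy ε lam g k < ⊤)
    (hmin : ∀ g' k', Velocity g' k' → energy ε lam g k ≤ energy ε lam g' k') :
    RadialSystem ε lam (fun r => gam g r / r ^ 2)
      (fun r => deriv (gam g) r / r ^ 2 - 2 * gam g r / r ^ 3) (fun r => hig k r / r)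
      (fun r => deriv (hig k) r / r - hig k r / r ^ 2) := by
  have hgi := integrable_of_memLp hv.1
  have hki := integrable_of_memLp hv.2.1
  refine ⟨?_, ?_, fun r hr => ?_, fun r hr => ?_, fun r hr => ?_, fun r hr => ?_⟩
  · exact ((continuousOn_gam hgi).mono Ioc_subset_Icc_self).div (continuousOn_pow 2)
      fun r hr => (pow_pos hr.1 2).ne'
  · exact (continuousOn_hig hki).div continuousOn_id fun r hr => hr.1.ne'
  · have hr0 := hr.1.ne'
    have h1 := (euler_lagrange_gam hε hlam hv hfin hmin hr).1.hasDerivAt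
    refine (h1.div (hasDerivAt_pow 2 r) (pow_ne_zero 2 hr0)).congr_deriv ?_
    push_cast; field_simp
  · have hr0 := hr.1.ne'
    have h1 := (euler_lagrange_hig hε hlam hv hfin hmin hr).1.hasDerivAt
    refine (h1.div (hasDerivAt_id r) hr0).congr_deriv ?_
    simp only [id_eq]; field_simp
  · have hr0 := hr.1.ne'
    obtain ⟨h1, h2⟩ := euler_lagrange_gam hε hlam hv hfin hmin hr
    -- Here `r⁴ f' = r² γ' - 2rγ` has derivative `r² γ'' - 2γ`, and `-2γ` cancels the linear part of
    -- `r² γ''`. In the Higgs equation below `-2rφ` cancels the linear term in the same way.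
    have h3 : HasDerivAt (fun r => r ^ 2 * deriv (gam g) r - 2 * r * gam g r)
        (r ^ 4 * rhsF ε (r ^ 2) (gam g r / r ^ 2) (hig k r / r)) r := by
      refine (((hasDerivAt_pow 2 r).mul h2).sub
        (((hasDerivAt_id r).const_mul 2).mul h1.hasDerivAt)).congr_deriv ?_
      unfold rhsF
      simp only [id_eq]
      field_simp
      ring
    refine h3.congr_of_eventuallyEq ?_
    filter_upwards [isOpen_Ioo.mem_nhds hr] with x hx
    have := hx.1.ne'
    field_simp
  · have hr0 := hr.1.ne'
    obtain ⟨h1, h2⟩ := euler_lagrange_hig hε hlam hv hfin hmin hr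
    have h3 : HasDerivAt (fun r => r * (r ^ 2 * deriv (hig k) r) - r ^ 2 * hig k r)
        (r ^ 4 * rhsH lam (r ^ 2) (gam g r / r ^ 2) (hig k r / r)) r := by
      refine (((hasDerivAt_id r).mul h2).sub
        ((hasDerivAt_pow 2 r).mul h1.hasDerivAt)).congr_deriv ?_
      unfold rhsH
      simp only [id_eq]
      field_simp
      ring
    refine h3.congr_of_eventuallyEq ?_
    filter_upwards [isOpen_Ioo.mem_nhds hr] with x hx
    have := hx.1.ne'
    field_simp

/-- The rates `√r` for `γ` and `1/√r` for `φ` yield the same exponent: `√r / r²` and `(1/√r) / r`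
are both `r^(-3/2)`. -/
lemma rpowBound_of_velocity {g k : ℝ → ℝ} (hg : MemLp g 2 dr) (hk : MemLp k 2 dr) :
    RpowBound (fun r => gam g r / r ^ 2) (fun r => hig k r / r) (3 / 2) := by
  set A := ∫ t, g t ^ 2 ∂dr
  set B := ∫ t, k t ^ 2 ∂dr
  have hA : 0 ≤ A := integral_nonneg fun t => sq_nonneg _
  have hB : 0 ≤ B := integral_nonneg fun t => sq_nonneg _
  refine ⟨A + B + 2, fun r hr => ?_⟩
  have hq : 0 < √r := Real.sqrt_pos.2 hr.1
  have hsq : √r ^ 2 = r := Real.sq_sqrt hr.1.le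
  have hq1 : √r ≤ 1 := Real.sqrt_le_one.2 hr.2
  have hpow : r ^ (-(3 / 2) : ℝ) = (√r ^ 3)⁻¹ := by
    rw [Real.rpow_neg hr.1.le, Real.sqrt_eq_rpow, ← Real.rpow_natCast, ← Real.rpow_mul hr.1.le]
    norm_num
  have h1 := abs_gam_le hg hr
  have h2 := abs_hig_le hk hr
  rw [hpow]
  constructor
  · rw [abs_div, abs_of_pos (pow_pos hr.1 2), ← div_eq_mul_inv, div_le_div_iff₀ (pow_pos hr.1 2)
      (pow_pos hq 3)]
    calc |gam g r| * √r ^ 3 ≤ (A + 1) / 2 * √r * √r ^ 3 := by gcongr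
      _ = (A + 1) / 2 * r ^ 2 := by nth_rw 3 [← hsq]; ring
      _ ≤ (A + B + 2) * r ^ 2 := by gcongr; linarith
  · rw [abs_div, abs_of_pos hr.1, ← div_eq_mul_inv, div_le_div_iff₀ hr.1 (pow_pos hq 3)]
    calc |hig k r| * √r ^ 3 ≤ (1 + (B + 1) / (2 * √r)) * √r ^ 3 := by gcongr
      _ = (√r + (B + 1) / 2) * √r ^ 2 := by field_simp
      _ ≤ (A + B + 2) * r := by
        rw [hsq]
        exact mul_le_mul_of_nonneg_right (by linarith) hr.1.le

end YMH
end

/-! ### Assembly -/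

theorem theorem5p1 (ε lam : ℝ) (hε : 0 < ε) (hlam : 0 ≤ lam) :
    ∃ (γ φ : ℝ → ℝ) (A : YMH.Form1) (Φ : YMH.Form0),
      YMH.IsMinimizer ε lam γ φ ∧
      YMH.HasProfile γ φ A Φ ∧
      YMH.IsSmoothPair A Φ ∧
      YMH.IsSymmetric A Φ ∧
      YMH.IsSolution ε lam A Φ := by
  obtain ⟨g, k, hv, hfin, hmin⟩ := YMH.exists_minimizer hε hlam
  obtain ⟨F, H, hS, hFH⟩ := (YMH.radialSystem_of_minimizer hε hlam hv hfin
    hmin).exists_integralSystem hε hlam (YMH.rpowBound_of_velocity hv.1 hv.2.1)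
  -- At `r = 1` one has `s = 1` and both divisors equal `1`, so the boundary values of `γ` and `φ`
  -- are those of `F` and `H`.
  have h1 := hFH 1 (by simp)
  have hF1 : F 1 = -(1 / 2) := by simpa [hv.2.2] using h1.1
  have hH1 : H 1 = 1 := by simpa [YMH.hig] using h1.2
  obtain ⟨F₁, F₂, H₁, H₂, hP⟩ := hS.exists_profileEq hF1 hH1
  refine ⟨YMH.gam g, YMH.hig k, YMH.radialConn F, YMH.radialHiggs H,
    YMH.isMinimizer_of_velocity hv hmin, fun x hx hx0 => ?_,
    YMH.isSmoothPair_radial hS.contDiffOn.1 hS.contDiffOn.2, YMH.isSymmetric_radial F H,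
    YMH.isSolution_radial hε hP⟩
  have hx' : ‖x‖ ∈ Ioc (0 : ℝ) 1 := ⟨norm_pos_iff.2 hx0, mem_closedBall_zero_iff.1 hx⟩
  have h2 := hFH _ hx'
  exact ⟨fun i => by rw [YMH.radialConn, h2.1], by rw [YMH.radialHiggs, h2.2]⟩
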